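/- Let $\ell\ge 6$ be a fixed even integer. Graphs are finite and simple, and $|G|$ is the number of vertices of $G$. A hole is an induced cycle of length at least four; a hole is long if its length is at least $\ell$. For a hole $C$ of $G$, a vertex $v\in V(G)\setminus V(C)$ is $C$-major if no three-vertex path of $C$ contains all neighbours of $v$ in $V(C)$. A graph $G$ is a candidate if it contains no long even hole of length at most $2\ell$, and none of the following. (i) A long jewel of order at most $\ell+1$: induced paths $Q_1,Q_2,P$ of $G$ with the same ends, where $Q_1,Q_2$ have different parity and at most $\ell+1$ vertices each, $P$ has length at least $\ell-\min(|E(Q_1)|,|E(Q_2)|)$, and the interior of $P$ is disjoint from the interiors of $Q_1,Q_2$, with no edges between them. (ii) A long theta as an induced subgraph: the union of three paths joining two nonadjacent vertices, with pairwise disjoint interiors, such that the union of any two of the paths is a cycle of length at least $\ell$. (iii) A long ban-the-bomb as an induced subgraph: distinct vertices $u,v_1,v_2,w,x$, where $u\hbox{-}v_1\hbox{-}w\hbox{-}v_2\hbox{-}u$ is a cycle, $v_1,v_2$ are nonadjacent, $u,w$ may or may not be adjacent, $x$ is adjacent to $u$ and nonadjacent to $v_1,v_2,w$, together with paths $P_1,P_2$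 of length at least two, where $P_i$ has ends $x,v_i$, with no further vertices or edges; the interiors of $P_1,P_2$ contain neither $u$ nor $w$, and $P_1,P_2$ share only $x$; and the holes formed by $P_1$ and $u$, by $P_2$ and $u$, and by $P_1$, $P_2$ and $w$ all have length at least $\ell$. (iv) A long near-prism as an induced subgraph: two triangles $\{a_1,a_2,a_3\}$, $\{b_1,b_2,b_3\}$ sharing at most one vertex, and three pairwise vertex-disjoint paths $P_i$ with ends $a_i,b_i$ (possibly of length zero), with no further vertices or edges, where any two of the paths induce a hole of length at least $\ell$. Given a linear order of $E(G)$, a set $X\subseteq E(G)$ is lighter than $Y\subseteq E(G)$ if $|X|<|Y|$, or $|X|=|Y|$, $X\ne Y$ and the first edge of the symmetric difference of $X$ and $Y$ belongs to $Y$. A lightest long even hole is a long even hole such that no long even hole has a lighter edge set. **Theorem.** There is an algorithm (a program for a unit-cost random access machine with words of $O(\log |G|)$ bits) with the following specifications, where the constants hidden in the $\mathcal O$-notation depend only on $\ell$. Input: a candidate $G$ and a linear order of $E(G)$. Output: a list of $\mathcal O(|G|^{4\ell-1})$ subsets of $V(G)$ such that for every lightest long even hole $C$ of $G$, some set $X$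 in the list contains all $C$-major vertices and satisfies $X\cap V(C)=\emptyset$. Running time: $\mathcal O(|G|^{4\ell+2})$. -/

import Mathlib

open SimpleGraph

namespace LongEvenHole

section Graphs

variable {V : Type*} (G : SimpleGraph V)

/-- `X` and `Y` are disjoint and there is no edge between them. -/
def Anticomplete (X Y : Set V) : Prop :=
  Disjoint X Y ∧ ∀ x ∈ X, ∀ y ∈ Y, ¬ G.Adj x y

variable {G} in
/-- The vertices of a path that are not ends of it. -/
def interior {u v : V} (P : G.Walk u v) : Set V :=
  {w | w ∈ P.support ∧ w ≠ u ∧ w ≠ v}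

variable {G} in
/-- An induced path of `G`. -/
def IsInducedPath {u v : V} (P : G.Walk u v) : Prop :=
  P.IsPath ∧ P.IsChordless

/-- `C` is the vertex set of a hole of length `k`: the subgraph induced on `C` is a cycle of
length `k ≥ 4`. As a hole is an induced subgraph, it is identified with its vertex set. -/
def IsHoleOfLength (C : Set V) (k : ℕ) : Prop :=
  4 ≤ k ∧ Nonempty (G.induce C ≃g cycleGraph k)

/-- `C` is a hole that has even length at least `ℓ`. -/
def IsLongEvenHole (ℓ : ℕ) (C : Set V) : Prop :=
  ∃ k, IsHoleOfLength G C k ∧ ℓ ≤ k ∧ Even k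

/-- `x` is `C`-major: it lies outside `C`, and no three-vertex path `a - b - c` of the hole `C`
contains all neighbours of `x` in `C`. -/
def IsMajor (C : Set V) (x : V) : Prop :=
  x ∉ C ∧ ¬ ∃ a ∈ C, ∃ b ∈ C, ∃ c ∈ C, a ≠ c ∧ G.Adj a b ∧ G.Adj b c ∧
    ∀ w ∈ C, G.Adj x w → w = a ∨ w = b ∨ w = c

/-- `G` has a long jewel of order at most `k`, formed by `Q₁, Q₂, P`. -/
def HasLongJewel (ℓ k : ℕ) : Prop :=
  ∃ (u v : V) (Q₁ Q₂ P : G.Walk u v),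
    IsInducedPath Q₁ ∧ IsInducedPath Q₂ ∧ IsInducedPath P ∧
    Q₁.length % 2 ≠ Q₂.length % 2 ∧
    ℓ ≤ P.length + min Q₁.length Q₂.length ∧
    Anticomplete G (interior P) (interior Q₁ ∪ interior Q₂) ∧
    max (Q₁.length + 1) (Q₂.length + 1) ≤ k

/-- Some induced subgraph of `G` is a long theta: it is the union of three paths `P i` joining
nonadjacent vertices `u, v`, with pairwise disjoint interiors, and the three cycles formed by two
of the paths have length at least `ℓ`. -/
def HasLongTheta (ℓ : ℕ) : Prop :=
  ∃ (u v : V) (P : Fin 3 → G.Walk u v),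
    u ≠ v ∧ ¬ G.Adj u v ∧ (∀ i, (P i).IsPath) ∧
    (∀ i j, i ≠ j → Disjoint (interior (P i)) (interior (P j))) ∧
    (∀ x y, (∃ i, x ∈ (P i).support) → (∃ j, y ∈ (P j).support) → G.Adj x y →
      ∃ i, s(x, y) ∈ (P i).edges) ∧
    ∀ i j, i ≠ j → ℓ ≤ (P i).length + (P j).length

/-- Some induced subgraph of `G` is a long ban-the-bomb. Whether `u` and `w` are adjacent is left
open. The three holes `x - P₁ - v₁ - u - x`, `x - P₂ - v₂ - u - x` and
`x - P₁ - v₁ - w - v₂ - P₂ - x` have length at least `ℓ`. -/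
def HasLongBanTheBomb (ℓ : ℕ) : Prop :=
  ∃ (u v₁ v₂ w x : V) (P₁ : G.Walk x v₁) (P₂ : G.Walk x v₂),
    [u, v₁, v₂, w, x].Nodup ∧
    G.Adj u v₁ ∧ G.Adj v₁ w ∧ G.Adj w v₂ ∧ G.Adj v₂ u ∧ ¬ G.Adj v₁ v₂ ∧
    G.Adj x u ∧ ¬ G.Adj x v₁ ∧ ¬ G.Adj x v₂ ∧ ¬ G.Adj x w ∧
    IsInducedPath P₁ ∧ IsInducedPath P₂ ∧ 2 ≤ P₁.length ∧ 2 ≤ P₂.length ∧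
    Anticomplete G (interior P₁) {u, w} ∧ Anticomplete G (interior P₂) {u, w} ∧
    Anticomplete G {z | z ∈ P₁.support ∧ z ≠ x} {z | z ∈ P₂.support ∧ z ≠ x} ∧
    ℓ ≤ P₁.length + 2 ∧ ℓ ≤ P₂.length + 2 ∧ ℓ ≤ P₁.length + P₂.length + 2

/-- Some induced subgraph of `G` is a long near-prism: it consists of the triangles
`{a 0, a 1, a 2}` and `{b 0, b 1, b 2}`, which share at most one vertex, and of three
vertex-disjoint paths `P i` from `a i` to `b i`. Two of the paths induce a hole, of length
`(P i).length + (P j).length + 2`, which is at least `ℓ`. -/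
def HasLongNearPrism (ℓ : ℕ) : Prop :=
  ∃ (a b : Fin 3 → V) (P : ∀ i, G.Walk (a i) (b i)),
    (∀ i j, i ≠ j → G.Adj (a i) (a j)) ∧ (∀ i j, i ≠ j → G.Adj (b i) (b j)) ∧
    (Set.range a ∩ Set.range b).Subsingleton ∧ (∀ i, (P i).IsPath) ∧
    (∀ i j, i ≠ j → ∀ x ∈ (P i).support, x ∉ (P j).support) ∧
    (∀ x y, (∃ i, x ∈ (P i).support) → (∃ j, y ∈ (P j).support) → G.Adj x y →
      (∃ i, s(x, y) ∈ (P i).edges) ∨ (x ∈ Set.range a ∧ y ∈ Set.range a) ∨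
        (x ∈ Set.range b ∧ y ∈ Set.range b)) ∧
    ∀ i j, i ≠ j → ℓ ≤ (P i).length + (P j).length + 2

/-- A candidate (for the fixed bound `ℓ`). -/
def IsCandidate (ℓ : ℕ) : Prop :=
  (¬ ∃ C k, IsHoleOfLength G C k ∧ ℓ ≤ k ∧ Even k ∧ k ≤ 2 * ℓ) ∧
  ¬ HasLongJewel G ℓ (ℓ + 1) ∧ ¬ HasLongTheta G ℓ ∧ ¬ HasLongBanTheBomb G ℓ ∧
  ¬ HasLongNearPrism G ℓ

/-- The edges of the subgraph induced on `C`. -/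
def edgesOn (C : Set V) : Set (Sym2 V) :=
  {e | e ∈ G.edgeSet ∧ ∀ v ∈ e, v ∈ C}

/-- The list `es` presents a linear order of `E(G)`: it lists every edge of `G` exactly once, as
a pair of ends in either order. -/
def IsEdgeOrder (es : List (V × V)) : Prop :=
  (es.map fun e => s(e.1, e.2)).Nodup ∧
  ∀ u v, G.Adj u v ↔ s(u, v) ∈ es.map fun e => s(e.1, e.2)

/-- With respect to the linear order `es` of the edges, `X` is lighter than `Y`: it has fewer
elements, or equally many and is lexicographically earlier, that is, the first edge in which `X`
and `Y` differ belongs to `Y`. -/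
def Lighter (es : List (Sym2 V)) (X Y : Set (Sym2 V)) : Prop :=
  X.ncard < Y.ncard ∨ X.ncard = Y.ncard ∧ ∃ (i : ℕ) (hi : i < es.length),
    es[i] ∈ Y ∧ es[i] ∉ X ∧ ∀ (j : ℕ) (hj : j < i), es[j] ∈ X ↔ es[j] ∈ Y

/-- `C` is a lightest long even hole of `G`: no long even hole has a lighter edge set. -/
def IsLightestLongEvenHole (ℓ : ℕ) (es : List (V × V)) (C : Set V) : Prop :=
  IsLongEvenHole G ℓ C ∧ ∀ D, IsLongEvenHole G ℓ D →
    ¬ Lighter (es.map fun e => s(e.1, e.2)) (edgesOn G D) (edgesOn G C)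

end Graphs

/-! A word RAM with unit costs, programmed in structured form. Its words are the natural numbers
below a bound `W`; a computation that would produce a number that is not below `W` gets stuck. -/

/-- The arithmetic operations on words (subtraction is truncated at zero). -/
inductive Op
  | add
  | sub
  | mul
  | div
  | mod

/-- The value of an arithmetic operation. -/
def Op.eval : Op → ℕ → ℕ → ℕ
  | .add, a, b => a + b
  | .sub, a, b => a - b
  | .mul, a, b => a * b
  | .div, a, b => a / b
  | .mod, a, b => a % b

/-- Programs. The arguments `d a b` are numbers of registers. -/
inductive Prog
  /-- do nothing -/
  | skip
  /-- `reg d := k` -/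
  | const (d k : ℕ)
  /-- `reg d := reg a` -/
  | copy (d a : ℕ)
  /-- `reg d := reg a ∘ reg b` -/
  | arith (o : Op) (d a b : ℕ)
  /-- `reg d := mem (reg a)` -/
  | load (d a : ℕ)
  /-- `mem (reg a) := reg b` -/
  | store (a b : ℕ)
  /-- append `reg a` to the output tape -/
  | write (a : ℕ)
  /-- first `p`, then `q` -/
  | seq (p q : Prog)
  /-- if `reg a < reg b` then `p` else `q` -/
  | ifLt (a b : ℕ) (p q : Prog)
  /-- while `reg a < reg b` do `p` -/
  | whileLt (a b : ℕ) (p : Prog)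

/-- A configuration: the registers, the memory, and the output tape. -/
structure State where
  reg : ℕ → ℕ
  mem : ℕ → ℕ
  out : List ℕ

/-- `Exec W p s t s'`: with words below `W`, the program `p`, started in `s`, halts in `s'` after
exactly `t` steps. Every instruction and every evaluation of a test is one step. -/
inductive Exec (W : ℕ) : Prog → State → ℕ → State → Prop
  | skip (s : State) : Exec W .skip s 1 s
  | const (s : State) (d k : ℕ) (h : k < W) :
      Exec W (.const d k) s 1 { s with reg := Function.update s.reg d k }
  | copy (s : State) (d a : ℕ) :
      Exec W (.copy d a) s 1 { s with reg := Function.update s.reg d (s.reg a) }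
  | arith (s : State) (o : Op) (d a b : ℕ) (h : o.eval (s.reg a) (s.reg b) < W) :
      Exec W (.arith o d a b) s 1
        { s with reg := Function.update s.reg d (o.eval (s.reg a) (s.reg b)) }
  | load (s : State) (d a : ℕ) :
      Exec W (.load d a) s 1 { s with reg := Function.update s.reg d (s.mem (s.reg a)) }
  | store (s : State) (a b : ℕ) :
      Exec W (.store a b) s 1 { s with mem := Function.update s.mem (s.reg a) (s.reg b) }
  | write (s : State) (a : ℕ) :
      Exec W (.write a) s 1 { s with out := s.out ++ [s.reg a] }
  | seq {p q : Prog} {s s' s'' : State} {t t' : ℕ} (hp : Exec W p s t s')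
      (hq : Exec W q s' t' s'') : Exec W (.seq p q) s (t + t') s''
  | ifTrue {a b : ℕ} {p q : Prog} {s s' : State} {t : ℕ} (h : s.reg a < s.reg b)
      (hp : Exec W p s t s') : Exec W (.ifLt a b p q) s (t + 1) s'
  | ifFalse {a b : ℕ} {p q : Prog} {s s' : State} {t : ℕ} (h : ¬ s.reg a < s.reg b)
      (hq : Exec W q s t s') : Exec W (.ifLt a b p q) s (t + 1) s'
  | whileTrue {a b : ℕ} {p : Prog} {s s' s'' : State} {t t' : ℕ} (h : s.reg a < s.reg b)
      (hp : Exec W p s t s') (hw : Exec W (.whileLt a b p) s' t' s'') :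
      Exec W (.whileLt a b p) s (t + t' + 1) s''
  | whileFalse {a b : ℕ} {p : Prog} {s : State} (h : ¬ s.reg a < s.reg b) :
      Exec W (.whileLt a b p) s 1 s

/-- The input for a graph with vertex set `{0, …, n - 1}` and edges listed by `es`:
the number `n` of vertices, the number of edges, and then the two ends of each edge in order. -/
def encodeInput (n : ℕ) (es : List (Fin n × Fin n)) : List ℕ :=
  n :: es.length :: es.flatMap fun e => [(e.1 : ℕ), (e.2 : ℕ)]

/-- The start configuration: the input is in the memory from address `0` on, and everything else
is zero or empty. -/
def initState (input : List ℕ) : State where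
  reg := fun _ => 0
  mem := fun i => input.getD i 0
  out := []

/-- The contents of the output tape for a list of sets of vertices: their characteristic vectors,
of length `n` each, one after the other. -/
def encodeSets {n : ℕ} (L : List (Finset (Fin n))) : List ℕ :=
  L.flatMap fun X => List.ofFn fun v : Fin n => if v ∈ X then 1 else 0

end LongEvenHole

open LongEvenHole

/-!
A lightest long even hole `C` is in particular a shortest one (`HoleMap.ncard_edgesOn`), and in a
candidate its length exceeds `2ℓ`. The aim is to describe, by a bounded number of vertices, a set
that contains the `C`-major vertices and misses `C`; the list then runs over all tuples of
vertices of that length.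

A gap of a major vertex is a path of `C` between two of its neighbours with no neighbour inside.
Among all major vertices and all their gaps, choose a major vertex `x` with a gap `P` of the
greatest length `m`. By this choice every major vertex has a neighbour in `P`. If `m` is at most
`2ℓ - 6`, the vertices of `P` serve as hitters: every major vertex is adjacent to a hitter, and
the vertices of `C` with a neighbour in `P` are excluded because they belong to the tuple
(`ShortestHole.exists_marksMajors_of_short`). Otherwise `m` is odd, and the rest of `C` is long
(`LargestGap.odd`, `LargestGap.add_lt`).

In that case take as hitters the vertices of `P` near its two ends. A major vertex that is
adjacent neither to `x` nor to a hitter is a hat: its neighbours in `P` are two consecutive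
vertices, and its neighbours beyond `P` are restricted as well (`LargestGap.exists_isHat`), since
anything else produces a forbidden induced subgraph or a shorter long even hole. Let `y` be the
hat whose first neighbour beyond `P` comes latest, or `x` again if there are no hats. A hat that
is not adjacent to `y` has a neighbour in `C` close to one of two neighbours of `y`
(`IsHat.exists_adj_near`). With boundedly many further hitters there, every major vertex is
adjacent to a hitter or to one of the excluders `x` and `y`.

The excluders may be adjacent to vertices that are not major, and to vertices of `C`, so their
neighbours need a further test. Let the zone consist of the vertices that are not in the tuple and
adjacent neither to a hitter nor to an excluder, and of some vertices of `P` in the tuple that are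
allowed in spite of this. The zone contains the middle part of `P`. A bridge through the zone from
there to the rest of `C` is at least as long as an arc of `C` between its ends
(`Bridge.le_length`), and a walk in the zone that joins the ends of the middle part of `P` and
avoids the neighbours of the rest of `C` is at least as long as that part
(`Zone.le_of_reach_ends`). It follows that no vertex of `C` beyond `P` has a neighbour on a
shortest path of the zone from the midpoint to one of these ends (`Zone.not_touches`), whereas the
middle part of `P` itself consists of two such paths, and every major vertex that is not adjacent
to a hitter has a neighbour in it. Hence the vertices outside the tuple that are adjacent to a
hitter, or to an excluder and a vertex on such a shortest path, form a set as required
(`LargestGap.marksMajors_tuple`).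

This takes `4ℓ - 2` vertices, so there are `n ^ (4ℓ - 2)` sets. Each of them is computed from its
tuple in `O(n ^ 3)` steps, most of them spent on the distances in the zone from three sources, by
the method of Bellman and Ford (`Setting.run_mark`, `timeDeg_markAll`). The program is written in
a small structured language, `Cmd`, whose commands compile to the random access machine
(`Cmd.exec`). The total time is `O(n ^ (4ℓ + 1))`, and all numbers that occur are bounded by a
polynomial in `n`.
-/

namespace LongEvenHole

/-! ### Induced paths given by sequences of vertices -/

section Paths

variable {V : Type*} {G : SimpleGraph V}

/-- The vertices `f 0, …, f n` are distinct and induce a path, in this order. -/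
def IndPath (G : SimpleGraph V) (f : ℕ → V) (n : ℕ) : Prop :=
  ∀ i j, i ≤ n → j ≤ n → (f i = f j → i = j) ∧ (G.Adj (f i) (f j) ↔ i + 1 = j ∨ j + 1 = i)

theorem IndPath.const (v : V) : IndPath G (fun _ => v) 0 := by
  intro i j hi hj
  refine ⟨fun _ => by omega, ?_⟩
  simp only [SimpleGraph.irrefl, false_iff]
  omega

theorem IndPath.reverse {f : ℕ → V} {n : ℕ} (h : IndPath G f n) :
    IndPath G (fun i => f (n - i)) n := by
  intro i j hi hj
  obtain ⟨h1, h2⟩ := h (n - i) (n - j) (by omega) (by omega)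
  refine ⟨fun e => by have := h1 e; omega, ?_⟩
  simp only [h2]
  omega

theorem IndPath.mono {f : ℕ → V} {n m : ℕ} (h : IndPath G f n) (hm : m ≤ n) : IndPath G f m :=
  fun i j hi hj => h i j (hi.trans hm) (hj.trans hm)

theorem IndPath.shift {f : ℕ → V} {n m : ℕ} (a : ℕ) (h : IndPath G f n) (hm : a + m ≤ n) :
    IndPath G (fun i => f (a + i)) m := by
  intro i j hi hj
  obtain ⟨h1, h2⟩ := h (a + i) (a + j) (by omega) (by omega)
  refine ⟨fun e => by have := h1 e; omega, ?_⟩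
  simp only [h2]
  omega

/-- The sequence `f 0, …, f n, g 0, g 1, …`. -/
def glue (f : ℕ → V) (n : ℕ) (g : ℕ → V) : ℕ → V :=
  fun i => if i ≤ n then f i else g (i - n - 1)

theorem glue_left {f : ℕ → V} {n : ℕ} {g : ℕ → V} {i : ℕ} (h : i ≤ n) : glue f n g i = f i :=
  if_pos h

theorem glue_right {f : ℕ → V} {n : ℕ} {g : ℕ → V} (i : ℕ) : glue f n g (n + 1 + i) = g i := by
  unfold glue
  rw [if_neg (by omega)]
  congr 1
  omega

theorem glue_cases {f : ℕ → V} {n : ℕ} {g : ℕ → V} {m i : ℕ} (h : i ≤ n + m + 1) :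
    (i ≤ n ∧ glue f n g i = f i) ∨ ∃ j ≤ m, i = n + 1 + j ∧ glue f n g i = g j := by
  by_cases hi : i ≤ n
  · exact .inl ⟨hi, glue_left hi⟩
  · obtain ⟨j, rfl⟩ : ∃ j, i = n + 1 + j := ⟨i - n - 1, by omega⟩
    exact .inr ⟨j, by omega, rfl, glue_right j⟩

/-- Two induced paths whose only connection is an edge from the end of the first to the start of the
second form an induced path. -/
theorem IndPath.append {f g : ℕ → V} {n m : ℕ} (hf : IndPath G f n) (hg : IndPath G g m)
    (hne : ∀ i ≤ n, ∀ j ≤ m, f i ≠ g j)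
    (hadj : ∀ i ≤ n, ∀ j ≤ m, G.Adj (f i) (g j) ↔ i = n ∧ j = 0) :
    IndPath G (glue f n g) (n + m + 1) := by
  intro i j hi hj
  rcases glue_cases (f := f) (g := g) hi with ⟨hi, e⟩ | ⟨i, hi, rfl, e⟩ <;>
  rcases glue_cases (f := f) (g := g) hj with ⟨hj, e'⟩ | ⟨j, hj, rfl, e'⟩ <;> rw [e, e']
  · exact hf i j hi hj
  · refine ⟨fun h => absurd h (hne _ hi _ ‹_›), ?_⟩
    rw [hadj _ hi _ ‹_›]
    omega
  · refine ⟨fun h => absurd h.symm (hne _ hj _ ‹_›), ?_⟩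
    rw [G.adj_comm, hadj _ hj _ ‹_›]
    omega
  · obtain ⟨h1, h2⟩ := hg i j ‹_› ‹_›
    refine ⟨fun e => by have := h1 e; omega, ?_⟩
    simp only [h2]
    omega

theorem exists_walk_of_adj {f : ℕ → V} (n : ℕ) (h : ∀ i < n, G.Adj (f i) (f (i + 1))) :
    ∃ p : G.Walk (f 0) (f n), p.length = n ∧ p.support = (List.range (n + 1)).map f ∧
      ∀ e, e ∈ p.edges ↔ ∃ i < n, e = s(f i, f (i + 1)) := by
  induction n with
  | zero => exact ⟨.nil, rfl, rfl, fun e => by simp⟩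
  | succ n ih =>
    obtain ⟨p, h1, h2, h3⟩ := ih fun i hi => h i (by omega)
    refine ⟨p.concat (h n (by omega)), by simp [h1], ?_, fun e => ?_⟩
    · rw [Walk.support_concat, h2, List.range_succ (n := n + 1)]
      simp
    · rw [Walk.edges_concat, List.concat_eq_append, List.mem_append, h3]
      constructor
      · rintro (⟨i, hi, rfl⟩ | hw)
        · exact ⟨i, by omega, rfl⟩
        · exact ⟨n, by omega, by simpa using hw⟩
      · rintro ⟨i, hi, rfl⟩
        rcases Nat.lt_or_ge i n with hn | hn
        · exact .inl ⟨i, hn, rfl⟩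
        · obtain rfl : i = n := by omega
          exact .inr (by simp)

/-- A sequence that induces a path is the sequence of vertices of an induced path. -/
theorem IndPath.exists_walk {f : ℕ → V} {n : ℕ} (h : IndPath G f n) {u v : V} (hu : f 0 = u)
    (hv : f n = v) :
    ∃ p : G.Walk u v, p.length = n ∧ IsInducedPath p ∧ (∀ w, w ∈ p.support ↔ ∃ i ≤ n, w = f i) ∧
      ∀ e, e ∈ p.edges ↔ ∃ i < n, e = s(f i, f (i + 1)) := by
  subst hu hv
  obtain ⟨p, h1, h2, h3⟩ := exists_walk_of_adj (G := G) (f := f) n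
    fun i hi => ((h i (i + 1) (by omega) (by omega)).2).2 (.inl rfl)
  have h4 : ∀ w, w ∈ p.support ↔ ∃ i ≤ n, w = f i := by
    intro w
    simp only [h2, List.mem_map, List.mem_range, Nat.lt_succ_iff, eq_comm]
  refine ⟨p, h1, ⟨?_, ?_⟩, h4, h3⟩
  · rw [Walk.isPath_def, h2]
    refine List.Nodup.map_on (fun i hi j hj e => ?_) List.nodup_range
    rw [List.mem_range] at hi hj
    exact (h i j (by omega) (by omega)).1 e
  · rw [Walk.isChordless_iff_forall_mem_edges]
    intro a b ha hb hab
    obtain ⟨i, hi, rfl⟩ := (h4 a).1 ha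
    obtain ⟨j, hj, rfl⟩ := (h4 b).1 hb
    rw [h3]
    rcases (h i j hi hj).2.1 hab with rfl | rfl
    · exact ⟨i, by omega, rfl⟩
    · exact ⟨j, by omega, Sym2.eq_swap⟩

/-- A vertex whose neighbours in an induced path are its two ends completes it to a hole. -/
theorem IndPath.exists_hole {f : ℕ → V} {n : ℕ} (h : IndPath G f n) (hn : 2 ≤ n) {s : V}
    (hs : ∀ i ≤ n, s ≠ f i) (hadj : ∀ i ≤ n, G.Adj s (f i) ↔ i = 0 ∨ i = n) :
    ∃ C, IsHoleOfLength G C (n + 2) := by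
  have key : ∀ i j : ℕ, i ≤ n + 1 → j ≤ n + 1 →
      (glue f n (fun _ => s) i = glue f n (fun _ => s) j → i = j) ∧
      (G.Adj (glue f n (fun _ => s) i) (glue f n (fun _ => s) j) ↔
        i + 1 = j ∨ j + 1 = i ∨ (i = 0 ∧ j = n + 1) ∨ (i = n + 1 ∧ j = 0)) := by
    intro i j hi hj
    rcases glue_cases (f := f) (g := fun _ => s) (m := 0) hi with ⟨hi, e⟩ | ⟨i, hi, rfl, e⟩ <;>
    rcases glue_cases (f := f) (g := fun _ => s) (m := 0) hj with ⟨hj, e'⟩ | ⟨j, hj, rfl, e'⟩ <;>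
    rw [e, e']
    · refine ⟨(h i j hi hj).1, ?_⟩
      rw [(h i j hi hj).2]
      omega
    · refine ⟨fun e => absurd e.symm (hs _ hi), ?_⟩
      rw [G.adj_comm, hadj _ hi]
      omega
    · refine ⟨fun e => absurd e (hs _ hj), ?_⟩
      rw [hadj _ hj]
      omega
    · refine ⟨fun e => by omega, ?_⟩
      simp only [SimpleGraph.irrefl, false_iff]
      omega
  let F : Fin (n + 2) → V := fun i => glue f n (fun _ => s) i
  have hF : Function.Injective F := fun i j e =>
    Fin.ext ((key i j (by omega) (by omega)).1 e)
  refine ⟨Set.range F, by omega, ⟨RelIso.symm ⟨Equiv.ofInjective F hF, ?_⟩⟩⟩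
  intro i j
  show G.Adj (F i) (F j) ↔ _
  rw [(key i j (by omega) (by omega)).2, cycleGraph_adj']
  have hi := i.2
  have hj := j.2
  simp only [Fin.val_sub]
  have e1 : ∀ a b : ℕ, a < n + 2 → b < n + 2 →
      ((n + 2 - b + a) % (n + 2) = 1 ↔ b + 1 = a ∨ a = 0 ∧ b = n + 1) := by
    intro a b ha hb
    rcases Nat.lt_or_ge (n + 2 - b + a) (n + 2) with hlt | hge
    · rw [Nat.mod_eq_of_lt hlt]; omega
    · rw [Nat.mod_eq_sub_mod hge, Nat.mod_eq_of_lt (by omega)]; omega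
  rw [e1 _ _ hi hj, e1 _ _ hj hi]
  omega

end Paths

/-! ### Recognising the forbidden configurations -/

section Configurations

variable {V : Type*} {G : SimpleGraph V}

/-- The sequences `f 0, …, f n` and `g 0, …, g m` are disjoint, with no edge between them. -/
def Apart (G : SimpleGraph V) (f : ℕ → V) (n : ℕ) (g : ℕ → V) (m : ℕ) : Prop :=
  ∀ i ≤ n, ∀ j ≤ m, f i ≠ g j ∧ ¬ G.Adj (f i) (g j)

theorem Apart.symm {f g : ℕ → V} {n m : ℕ} (h : Apart G f n g m) : Apart G g m f n :=
  fun i hi j hj => ⟨(h j hj i hi).1.symm, fun e => (h j hj i hi).2 e.symm⟩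

/-- `u` is adjacent to the first vertex and `v` to the last vertex of the induced path
`g 0, …, g m`; apart from this, there are no edges and no coincidences. -/
structure Links (G : SimpleGraph V) (u v : V) (g : ℕ → V) (m : ℕ) : Prop where
  indPath : IndPath G g m
  left_ne : ∀ i ≤ m, u ≠ g i
  right_ne : ∀ i ≤ m, v ≠ g i
  left_adj : ∀ i ≤ m, G.Adj u (g i) ↔ i = 0
  right_adj : ∀ i ≤ m, G.Adj v (g i) ↔ i = m

theorem Links.reverse {u v : V} {g : ℕ → V} {m : ℕ} (h : Links G u v g m) :
    Links G v u (fun i => g (m - i)) m where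
  indPath := h.indPath.reverse
  left_ne i _ := h.right_ne _ (by omega)
  right_ne i _ := h.left_ne _ (by omega)
  left_adj i _ := by rw [h.right_adj _ (by omega)]; omega
  right_adj i _ := by rw [h.left_adj _ (by omega)]; omega

theorem Links.exists_walk {u v : V} {g : ℕ → V} {m : ℕ} (h : Links G u v g m) (huv : u ≠ v)
    (hnadj : ¬ G.Adj u v) :
    ∃ p : G.Walk u v, p.length = m + 2 ∧ IsInducedPath p ∧
      ∀ w, w ∈ p.support ↔ w = u ∨ w = v ∨ ∃ i ≤ m, w = g i := by
  have h1 : IndPath G (glue g m fun _ => v) (m + 0 + 1) :=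
    h.indPath.append (.const v) (fun i hi _ _ => (h.right_ne i hi).symm) fun i hi j hj => by
      rw [G.adj_comm, h.right_adj i hi]; omega
  have h2 : IndPath G (glue (fun _ => u) 0 (glue g m fun _ => v)) (0 + (m + 0 + 1) + 1) := by
    refine (IndPath.const u).append h1 (fun _ _ j hj => ?_) fun i hi j hj => ?_
    · rcases glue_cases (f := g) (g := fun _ => v) (n := m) (m := 0) hj with
        ⟨hj, e⟩ | ⟨i, hi, rfl, e⟩ <;> rw [e]
      exacts [h.left_ne _ hj, huv]
    · rcases glue_cases (f := g) (g := fun _ => v) (n := m) (m := 0) hj with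
        ⟨hj, e⟩ | ⟨i, hi, rfl, e⟩ <;> rw [e]
      · rw [h.left_adj _ hj]; omega
      · exact iff_of_false hnadj (by omega)
  obtain ⟨p, hp, hi, hs, -⟩ := h2.exists_walk (u := u) (v := v) rfl (by
    rw [show 0 + (m + 0 + 1) + 1 = 0 + 1 + (m + 1 + 0) by ring, glue_right, glue_right])
  refine ⟨p, by omega, hi, fun w => (hs w).trans ⟨?_, ?_⟩⟩
  · rintro ⟨i, hi, rfl⟩
    rcases glue_cases (f := fun _ => u) (g := glue g m fun _ => v) hi with
      ⟨_, e⟩ | ⟨j, hj, rfl, e⟩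
    · exact .inl e
    · rw [e]
      rcases glue_cases (f := g) (g := fun _ => v) (n := m) (m := 0) hj with
        ⟨hj, e⟩ | ⟨i, hi, rfl, e⟩ <;> rw [e]
      exacts [.inr (.inr ⟨_, hj, rfl⟩), .inr (.inl rfl)]
  · rintro (rfl | rfl | ⟨i, hi, rfl⟩)
    · exact ⟨0, by omega, rfl⟩
    · refine ⟨0 + 1 + (m + 1 + 0), by omega, ?_⟩
      rw [glue_right, glue_right]
    · refine ⟨0 + 1 + i, by omega, ?_⟩
      rw [glue_right, glue_left hi]

/-- Three sequences between `u` and `v` that are pairwise apart form a theta. -/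
theorem hasLongTheta_of_links {ℓ : ℕ} {u v : V} (huv : u ≠ v) (hnadj : ¬ G.Adj u v)
    {f g h : ℕ → V} {n m k : ℕ} (hf : Links G u v f n) (hg : Links G u v g m)
    (hh : Links G u v h k) (hfg : Apart G f n g m) (hfh : Apart G f n h k)
    (hgh : Apart G g m h k) (h1 : ℓ ≤ n + m + 4) (h2 : ℓ ≤ n + k + 4) (h3 : ℓ ≤ m + k + 4) :
    HasLongTheta G ℓ := by
  obtain ⟨p, hp, hip, hsp⟩ := hf.exists_walk huv hnadj
  obtain ⟨q, hq, hiq, hsq⟩ := hg.exists_walk huv hnadj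
  obtain ⟨r, hr, hir, hsr⟩ := hh.exists_walk huv hnadj
  have disj : ∀ {f g : ℕ → V} {n m : ℕ} {p q : G.Walk u v}, Apart G f n g m →
      (∀ w, w ∈ p.support ↔ w = u ∨ w = v ∨ ∃ i ≤ n, w = f i) →
      (∀ w, w ∈ q.support ↔ w = u ∨ w = v ∨ ∃ i ≤ m, w = g i) →
      Disjoint (interior p) (interior q) := by
    intro f g n m p q hap hp hq
    rw [Set.disjoint_left]
    rintro w ⟨hw, hwu, hwv⟩ ⟨hw', -, -⟩
    obtain ⟨i, hi, rfl⟩ := ((hp w).1 hw).resolve_left hwu |>.resolve_left hwv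
    obtain ⟨j, hj, e⟩ := ((hq _).1 hw').resolve_left hwu |>.resolve_left hwv
    exact (hap i hi j hj).1 e
  have edge : ∀ {f g : ℕ → V} {n m : ℕ} {p q : G.Walk u v}, Apart G f n g m →
      p.IsChordless → q.IsChordless →
      (∀ w, w ∈ p.support ↔ w = u ∨ w = v ∨ ∃ i ≤ n, w = f i) →
      (∀ w, w ∈ q.support ↔ w = u ∨ w = v ∨ ∃ i ≤ m, w = g i) →
      ∀ x y, x ∈ p.support → y ∈ q.support → G.Adj x y → s(x, y) ∈ p.edges ∨ s(x, y) ∈ q.edges := by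
    intro f g n m p q hap hcp hcq hp hq x y hx hy hxy
    by_cases hxq : x ∈ q.support
    · exact .inr (hcq.mem_edges hxq hy hxy)
    by_cases hyp : y ∈ p.support
    · exact .inl (hcp.mem_edges hx hyp hxy)
    have hxu : x ≠ u := by rintro rfl; exact hxq q.start_mem_support
    have hxv : x ≠ v := by rintro rfl; exact hxq q.end_mem_support
    have hyu : y ≠ u := by rintro rfl; exact hyp p.start_mem_support
    have hyv : y ≠ v := by rintro rfl; exact hyp p.end_mem_support
    obtain ⟨i, hi, rfl⟩ := ((hp x).1 hx).resolve_left hxu |>.resolve_left hxv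
    obtain ⟨j, hj, rfl⟩ := ((hq y).1 hy).resolve_left hyu |>.resolve_left hyv
    exact absurd hxy (hap i hi j hj).2
  refine ⟨u, v, ![p, q, r], huv, hnadj, ?_, ?_, ?_, ?_⟩
  · intro i; fin_cases i
    exacts [hip.1, hiq.1, hir.1]
  · intro i j hij
    fin_cases i <;> fin_cases j <;> simp only [ne_eq, not_true_eq_false] at hij
    exacts [disj hfg hsp hsq, disj hfh hsp hsr, disj hfg.symm hsq hsp, disj hgh hsq hsr,
      disj hfh.symm hsr hsp, disj hgh.symm hsr hsq]
  · rintro x y ⟨i, hx⟩ ⟨j, hy⟩ hxy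
    by_cases hij : i = j
    · subst hij
      refine ⟨i, Walk.IsChordless.mem_edges ?_ hx hy hxy⟩
      fin_cases i
      exacts [hip.2, hiq.2, hir.2]
    · suffices h : s(x, y) ∈ (![p, q, r] i).edges ∨ s(x, y) ∈ (![p, q, r] j).edges from
        h.elim (fun h => ⟨i, h⟩) fun h => ⟨j, h⟩
      fin_cases i <;> fin_cases j <;> simp only [not_true_eq_false] at hij
      exacts [edge hfg hip.2 hiq.2 hsp hsq x y hx hy hxy,
        edge hfh hip.2 hir.2 hsp hsr x y hx hy hxy,
        edge hfg.symm hiq.2 hip.2 hsq hsp x y hx hy hxy, edge hgh hiq.2 hir.2 hsq hsr x y hx hy hxy,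
        edge hfh.symm hir.2 hip.2 hsr hsp x y hx hy hxy,
        edge hgh.symm hir.2 hiq.2 hsr hsq x y hx hy hxy]
  · intro i j hij
    fin_cases i <;> fin_cases j <;> simp only [ne_eq, not_true_eq_false] at hij <;>
      simp <;> omega

/-- Between two sequences of a near-prism, only the first vertices and the last vertices are
adjacent. -/
def PrismPair (G : SimpleGraph V) (f : ℕ → V) (n : ℕ) (g : ℕ → V) (m : ℕ) : Prop :=
  ∀ i ≤ n, ∀ j ≤ m, f i ≠ g j ∧ (G.Adj (f i) (g j) ↔ i = 0 ∧ j = 0 ∨ i = n ∧ j = m)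

theorem PrismPair.symm {f g : ℕ → V} {n m : ℕ} (h : PrismPair G f n g m) :
    PrismPair G g m f n := by
  intro i hi j hj
  refine ⟨(h j hj i hi).1.symm, ?_⟩
  rw [G.adj_comm, (h j hj i hi).2]
  tauto

theorem hasLongNearPrism_of_prismPair {ℓ : ℕ} {f g h : ℕ → V} {n m k : ℕ} (hf : IndPath G f n)
    (hg : IndPath G g m) (hh : IndPath G h k) (hfg : PrismPair G f n g m)
    (hfh : PrismPair G f n h k) (hgh : PrismPair G g m h k) (hn : 0 < n) (hm : 0 < m)
    (h1 : ℓ ≤ n + m + 2) (h2 : ℓ ≤ n + k + 2) (h3 : ℓ ≤ m + k + 2) :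
    HasLongNearPrism G ℓ := by
  let F : Fin 3 → ℕ → V := ![f, g, h]
  let N : Fin 3 → ℕ := ![n, m, k]
  have hF : ∀ i, IndPath G (F i) (N i) := by
    intro i; fin_cases i
    exacts [hf, hg, hh]
  have hpair : ∀ i j, i ≠ j → PrismPair G (F i) (N i) (F j) (N j) := by
    intro i j hij
    fin_cases i <;> fin_cases j <;> simp only [ne_eq, not_true_eq_false] at hij
    exacts [hfg, hfh, hfg.symm, hgh, hfh.symm, hgh.symm]
  choose P hP using fun i => (hF i).exists_walk (u := F i 0) (v := F i (N i)) rfl rfl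
  have meet : ∀ i j, F i 0 = F j (N j) → i = j ∧ i = 2 := by
    intro i j e
    by_cases hij : i = j
    · subst hij
      refine ⟨rfl, ?_⟩
      have := (hF i 0 (N i) (by omega) le_rfl).1 e
      fin_cases i
      · exact absurd this (by simp [N]; omega)
      · exact absurd this (by simp [N]; omega)
      · rfl
    · exact absurd e (hpair i j hij 0 (by omega) _ le_rfl).1
  refine ⟨fun i => F i 0, fun i => F i (N i), P, fun i j hij => ?_, fun i j hij => ?_, ?_,
    fun i => (hP i).2.1.1, fun i j hij x hx hx' => ?_, ?_, fun i j hij => ?_⟩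
  · exact ((hpair i j hij 0 (by omega) 0 (by omega)).2).2 (.inl ⟨rfl, rfl⟩)
  · exact ((hpair i j hij _ le_rfl _ le_rfl).2).2 (.inr ⟨rfl, rfl⟩)
  · rintro _ ⟨⟨i, rfl⟩, ⟨j, hj⟩⟩ _ ⟨⟨i', rfl⟩, ⟨j', hj'⟩⟩
    rw [(meet i j hj.symm).2, (meet i' j' hj'.symm).2]
  · obtain ⟨a, ha, rfl⟩ := ((hP i).2.2.1 x).1 hx
    obtain ⟨b, hb, e⟩ := ((hP j).2.2.1 _).1 hx'
    exact (hpair i j hij a ha b hb).1 e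
  · rintro x y ⟨i, hx⟩ ⟨j, hy⟩ hxy
    by_cases hij : i = j
    · subst hij
      exact .inl ⟨i, (hP i).2.1.2.mem_edges hx hy hxy⟩
    · obtain ⟨a, ha, rfl⟩ := ((hP i).2.2.1 x).1 hx
      obtain ⟨b, hb, rfl⟩ := ((hP j).2.2.1 y).1 hy
      rcases (hpair i j hij a ha b hb).2.1 hxy with ⟨rfl, rfl⟩ | ⟨rfl, rfl⟩
      · exact .inr (.inl ⟨⟨i, rfl⟩, ⟨j, rfl⟩⟩)
      · exact .inr (.inr ⟨⟨i, rfl⟩, ⟨j, rfl⟩⟩)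
  · rw [(hP i).1, (hP j).1]
    fin_cases i <;> fin_cases j <;> simp only [ne_eq, not_true_eq_false] at hij <;>
      simp [N] <;> omega

/-- The vertices `u` and `w` are twins with respect to the path `v₁ - w - v₂` of a hole, and `u` is
linked by `x` to the rest of the hole. -/
theorem hasLongBanTheBomb_of_links {ℓ : ℕ} {u v₁ v₂ w x : V} {f g : ℕ → V} {n m : ℕ}
    (hd : [u, v₁, v₂, w, x].Nodup) (h1 : G.Adj u v₁) (h2 : G.Adj v₁ w) (h3 : G.Adj w v₂)
    (h4 : G.Adj v₂ u) (h5 : ¬ G.Adj v₁ v₂) (h6 : G.Adj x u) (h7 : ¬ G.Adj x v₁)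
    (h8 : ¬ G.Adj x v₂) (h9 : ¬ G.Adj x w) (hf : Links G x v₁ f n) (hg : Links G x v₂ g m)
    (hfu : ∀ i ≤ n, f i ≠ u ∧ ¬ G.Adj (f i) u) (hfw : ∀ i ≤ n, f i ≠ w ∧ ¬ G.Adj (f i) w)
    (hgu : ∀ i ≤ m, g i ≠ u ∧ ¬ G.Adj (g i) u) (hgw : ∀ i ≤ m, g i ≠ w ∧ ¬ G.Adj (g i) w)
    (hfg : Apart G f n g m) (hfv : ∀ i ≤ n, f i ≠ v₂ ∧ ¬ G.Adj (f i) v₂)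
    (hgv : ∀ i ≤ m, g i ≠ v₁ ∧ ¬ G.Adj (g i) v₁)
    (hn : ℓ ≤ n + 4) (hm : ℓ ≤ m + 4) :
    HasLongBanTheBomb G ℓ := by
  simp only [List.nodup_cons, List.mem_cons, List.not_mem_nil, or_false, not_or] at hd
  obtain ⟨⟨d1, d2, d3, d4⟩, ⟨d5, d6, d7⟩, ⟨d8, d9⟩, d10, -⟩ := hd
  obtain ⟨p, hp, hip, hsp⟩ := hf.exists_walk (Ne.symm d7) h7
  obtain ⟨q, hq, hiq, hsq⟩ := hg.exists_walk (Ne.symm d9) h8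
  have hint : ∀ {v : V} {f : ℕ → V} {n : ℕ} {p : G.Walk x v},
      (∀ w, w ∈ p.support ↔ w = x ∨ w = v ∨ ∃ i ≤ n, w = f i) →
      (∀ i ≤ n, f i ≠ u ∧ ¬ G.Adj (f i) u) → (∀ i ≤ n, f i ≠ w ∧ ¬ G.Adj (f i) w) →
      Anticomplete G (interior p) {u, w} := by
    intro v f n p hs hu hw
    refine ⟨Set.disjoint_left.2 ?_, ?_⟩
    · rintro y ⟨hy, hyx, hyv⟩ hy'
      obtain ⟨i, hi, rfl⟩ := ((hs y).1 hy).resolve_left hyx |>.resolve_left hyv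
      rcases hy' with e | e
      exacts [(hu i hi).1 e, (hw i hi).1 e]
    · rintro y ⟨hy, hyx, hyv⟩ z hz
      obtain ⟨i, hi, rfl⟩ := ((hs y).1 hy).resolve_left hyx |>.resolve_left hyv
      rcases hz with rfl | rfl
      exacts [(hu i hi).2, (hw i hi).2]
  refine ⟨u, v₁, v₂, w, x, p, q, ?_, h1, h2, h3, h4, h5, h6, h7, h8, h9, hip, hiq, by omega,
    by omega, hint hsp hfu hfw, hint hsq hgu hgw, ⟨Set.disjoint_left.2 ?_, ?_⟩, by omega, by omega,
    by omega⟩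
  · simp only [List.nodup_cons, List.mem_cons, List.not_mem_nil, or_false, not_or]
    exact ⟨⟨d1, d2, d3, d4⟩, ⟨d5, d6, d7⟩, ⟨d8, d9⟩, d10, id, List.nodup_nil⟩
  · rintro y ⟨hy, hyx⟩ ⟨hy', -⟩
    rcases ((hsp y).1 hy).resolve_left hyx with rfl | ⟨i, hi, rfl⟩ <;>
    rcases ((hsq _).1 hy').resolve_left hyx with e | ⟨j, hj, e⟩
    exacts [d5 e, (hgv j hj).1 e.symm, (hfv i hi).1 e, (hfg i hi j hj).1 e]
  · rintro y ⟨hy, hyx⟩ z ⟨hz, hzx⟩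
    rcases ((hsp y).1 hy).resolve_left hyx with rfl | ⟨i, hi, rfl⟩ <;>
    rcases ((hsq _).1 hz).resolve_left hzx with rfl | ⟨j, hj, rfl⟩
    exacts [h5, fun h => (hgv j hj).2 h.symm, (hfv i hi).2, (hfg i hi j hj).2]

/-- Two nonadjacent vertices joined by three sequences, of which the first is apart from the other
two, form a jewel. -/
theorem hasLongJewel_of_links {ℓ k : ℕ} {u v : V} (huv : u ≠ v) (hnadj : ¬ G.Adj u v)
    {f g h : ℕ → V} {n m r : ℕ} (hf : Links G u v f n) (hg : Links G u v g m)
    (hh : Links G u v h r) (hfg : Apart G f n g m) (hfh : Apart G f n h r)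
    (hpar : m % 2 ≠ r % 2) (h1 : ℓ ≤ n + m + 4) (h2 : ℓ ≤ n + r + 4) (h3 : m + 3 ≤ k)
    (h4 : r + 3 ≤ k) : HasLongJewel G ℓ k := by
  obtain ⟨p, hp, hip, hsp⟩ := hf.exists_walk huv hnadj
  obtain ⟨q, hq, hiq, hsq⟩ := hg.exists_walk huv hnadj
  obtain ⟨s, hr, hir, hsr⟩ := hh.exists_walk huv hnadj
  refine ⟨u, v, q, s, p, hiq, hir, hip, by omega, by omega, ⟨Set.disjoint_left.2 ?_, ?_⟩, by omega⟩
  · rintro y ⟨hy, hyu, hyv⟩ hy'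
    obtain ⟨i, hi, rfl⟩ := ((hsp y).1 hy).resolve_left hyu |>.resolve_left hyv
    rcases hy' with ⟨hy', -, -⟩ | ⟨hy', -, -⟩
    · obtain ⟨j, hj, e⟩ := ((hsq _).1 hy').resolve_left hyu |>.resolve_left hyv
      exact (hfg i hi j hj).1 e
    · obtain ⟨j, hj, e⟩ := ((hsr _).1 hy').resolve_left hyu |>.resolve_left hyv
      exact (hfh i hi j hj).1 e
  · rintro y ⟨hy, hyu, hyv⟩ z hz
    obtain ⟨i, hi, rfl⟩ := ((hsp y).1 hy).resolve_left hyu |>.resolve_left hyv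
    rcases hz with ⟨hz, hzu, hzv⟩ | ⟨hz, hzu, hzv⟩
    · obtain ⟨j, hj, rfl⟩ := ((hsq _).1 hz).resolve_left hzu |>.resolve_left hzv
      exact (hfg i hi j hj).2
    · obtain ⟨j, hj, rfl⟩ := ((hsr _).1 hz).resolve_left hzu |>.resolve_left hzv
      exact (hfh i hi j hj).2

end Configurations

/-! ### Periodic numberings of holes -/

section Holes

variable {V : Type*} {G : SimpleGraph V}

/-- `c` runs around a hole of length `k`, with period `k`. -/
structure HoleMap (G : SimpleGraph V) (k : ℕ) (c : ℤ → V) : Prop where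
  four_le : 4 ≤ k
  eq_iff_dvd : ∀ i j, c i = c j ↔ (k : ℤ) ∣ i - j
  adj_iff_dvd : ∀ i j, G.Adj (c i) (c j) ↔ (k : ℤ) ∣ i - j - 1 ∨ (k : ℤ) ∣ j - i - 1

theorem dvd_iff_of_abs_lt {k z : ℤ} (h1 : -(2 * k) < z) (h2 : z < 2 * k) :
    k ∣ z ↔ z = 0 ∨ z = k ∨ z = -k := by
  constructor
  · rintro ⟨q, rfl⟩
    have hk : 0 < k := by linarith
    have hq1 : -2 < q := by nlinarith
    have hq2 : q < 2 := by nlinarith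
    obtain rfl | rfl | rfl : q = -1 ∨ q = 0 ∨ q = 1 := by omega
    all_goals simp
  · rintro (rfl | rfl | rfl) <;> simp

namespace HoleMap

variable {k : ℕ} {c : ℤ → V}

theorem eq_iff (h : HoleMap G k c) {i j : ℤ} (h1 : i - j < 2 * k - 1) (h2 : j - i < 2 * k - 1) :
    c i = c j ↔ i - j = 0 ∨ i - j = k ∨ i - j = -k := by
  rw [h.eq_iff_dvd, dvd_iff_of_abs_lt (by omega) (by omega)]

theorem adj_iff (h : HoleMap G k c) {i j : ℤ} (h1 : i - j < 2 * k - 1) (h2 : j - i < 2 * k - 1) :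
    G.Adj (c i) (c j) ↔ i - j = 1 ∨ j - i = 1 ∨ i - j = k - 1 ∨ j - i = k - 1 ∨ i - j = k + 1 ∨
      j - i = k + 1 := by
  rw [h.adj_iff_dvd, dvd_iff_of_abs_lt (by omega) (by omega),
    dvd_iff_of_abs_lt (by omega) (by omega)]
  omega

theorem add_period (h : HoleMap G k c) (i : ℤ) : c (i + k) = c i := by
  rw [h.eq_iff_dvd]
  simp

theorem comp_add (h : HoleMap G k c) (a : ℤ) : HoleMap G k fun i => c (i + a) where
  four_le := h.four_le
  eq_iff_dvd i j := by rw [h.eq_iff_dvd]; ring_nf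
  adj_iff_dvd i j := by rw [h.adj_iff_dvd]; ring_nf

theorem exists_mem_Ico (h : HoleMap G k c) (a i : ℤ) : ∃ j, a ≤ j ∧ j < a + k ∧ c j = c i := by
  have hk : (0 : ℤ) < k := by have := h.four_le; omega
  refine ⟨a + (i - a) % k, ?_, ?_, ?_⟩
  · have := Int.emod_nonneg (i - a) hk.ne'; omega
  · have := Int.emod_lt_of_pos (i - a) hk; omega
  · rw [h.eq_iff_dvd]
    have := Int.emod_add_mul_ediv (i - a) k
    exact ⟨-((i - a) / k), by linarith⟩

/-- An arc of a hole, read upwards (`ε = 1`) or downwards (`ε = -1`). -/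
theorem indPath_arc (h : HoleMap G k c) {n : ℕ} (hn : n + 2 ≤ k) (a : ℤ) {ε : ℤ}
    (hε : ε = 1 ∨ ε = -1) : IndPath G (fun i => c (a + ε * i)) n := by
  intro i j hi hj
  constructor
  · rw [h.eq_iff] <;> rcases hε with rfl | rfl <;> omega
  · rw [h.adj_iff] <;> rcases hε with rfl | rfl <;> omega

end HoleMap

theorem IsHoleOfLength.exists_holeMap {C : Set V} {k : ℕ} (h : IsHoleOfLength G C k) :
    ∃ c, HoleMap G k c ∧ C = Set.range c := by
  obtain ⟨hk, ⟨φ⟩⟩ := h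
  have hk0 : 0 < k := by omega
  have : NeZero k := ⟨hk0.ne'⟩
  have hlt : ∀ i : ℤ, (i % k).toNat < k := fun i => by
    have := Int.emod_lt_of_pos i (show (0 : ℤ) < k by omega)
    omega
  let r : ℤ → Fin k := fun i => ⟨(i % k).toNat, hlt i⟩
  have hval : ∀ i : ℤ, (((r i).val : ℕ) : ℤ) = i % k := fun i =>
    Int.toNat_of_nonneg (Int.emod_nonneg i (by omega))
  have hsub : ∀ i j : ℤ, (((r i - r j).val : ℕ) : ℤ) = (i - j) % k := by
    intro i j
    rw [Fin.val_sub]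
    push_cast [hval, (r j).2.le]
    rw [sub_add_eq_add_sub, add_sub_assoc, Int.add_emod_left,
      ← Int.sub_emod]
  refine ⟨fun i => (φ.symm (r i)).1, ⟨hk, fun i j => ?_, fun i j => ?_⟩, ?_⟩
  · rw [Subtype.coe_inj, φ.symm.injective.eq_iff, ← Int.emod_eq_emod_iff_emod_sub_eq_zero.trans
      Int.dvd_iff_emod_eq_zero.symm, ← hval, ← hval, Fin.ext_iff, Nat.cast_inj]
  · have : G.Adj (φ.symm (r i)).1 (φ.symm (r j)).1 ↔ (cycleGraph k).Adj (r i) (r j) :=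
      φ.symm.map_rel_iff
    rw [this, cycleGraph_adj']
    have one : ∀ i j : ℤ, (r i - r j).val = 1 ↔ (k : ℤ) ∣ i - j - 1 := by
      intro i j
      rw [← Nat.cast_inj (R := ℤ), hsub, Nat.cast_one, ← Int.emod_emod_of_dvd (i - j) (dvd_refl _),
        Int.dvd_iff_emod_eq_zero, ← Int.emod_eq_emod_iff_emod_sub_eq_zero,
        Int.emod_emod_of_dvd _ (dvd_refl _), Int.emod_eq_of_lt (a := 1) (by omega) (by omega)]
    rw [one, one]
  · ext v
    constructor
    · intro hv
      refine ⟨((φ ⟨v, hv⟩).val : ℕ), ?_⟩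
      have : r ((φ ⟨v, hv⟩).val : ℕ) = φ ⟨v, hv⟩ := by
        refine Fin.ext ?_
        rw [← Nat.cast_inj (R := ℤ), hval,
          Int.emod_eq_of_lt (by omega) (by have := (φ ⟨v, hv⟩).2; omega)]
      simp only [this, RelIso.symm_apply_apply]
    · rintro ⟨i, rfl⟩
      exact (φ.symm (r i)).2

/-- Every even hole of length at least `ℓ` has length at least `k`. -/
def EvenHolesGE (G : SimpleGraph V) (ℓ k : ℕ) : Prop :=
  ∀ C n, IsHoleOfLength G C n → Even n → ℓ ≤ n → k ≤ n

variable {ℓ k : ℕ} {c : ℤ → V}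

/-- A vertex with exactly two neighbours in an arc, its ends, completes it to a hole. -/
theorem EvenHolesGE.of_arc (hmin : EvenHolesGE G ℓ k) (h : HoleMap G k c) {a b : ℤ}
    (hab : a + 2 ≤ b) {s : V} (hs : s ∉ Set.range c)
    (hadj : ∀ i, a ≤ i → i ≤ b → (G.Adj s (c i) ↔ i = a ∨ i = b)) (hev : Even (b - a))
    (hℓ : ℓ ≤ b - a + 2) (hk : b - a + 2 < k) : False := by
  obtain ⟨n, hn⟩ : ∃ n : ℕ, b - a = n := ⟨(b - a).toNat, by omega⟩
  obtain ⟨C, hC⟩ := (h.indPath_arc (n := n) (by omega) a (.inl rfl)).exists_hole (by omega)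
    (fun i _ e => hs ⟨_, e.symm⟩) (s := s) (fun i hi => by rw [hadj _ (by omega) (by omega)]; omega)
  have := hmin C _ hC (by rw [hn, Int.even_coe_nat] at hev; exact hev.add even_two) (by omega)
  omega

/-- Two sequences between nonadjacent vertices `s` and `t` that are apart form a hole. -/
theorem Links.exists_hole {s t : V} {f g : ℕ → V} {n m : ℕ} (hst : s ≠ t) (hnadj : ¬ G.Adj s t)
    (hf : Links G s t f n) (hg : Links G s t g m) (hfg : Apart G f n g m) :
    ∃ C, IsHoleOfLength G C (n + m + 4) := by
  have h1 : IndPath G (glue f n fun _ => t) (n + 0 + 1) :=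
    hf.indPath.append (.const t) (fun i hi _ _ => (hf.right_ne i hi).symm) fun i hi j hj => by
      rw [G.adj_comm, hf.right_adj i hi]; omega
  have h2 : IndPath G (glue (glue f n fun _ => t) (n + 1) fun i => g (m - i)) (n + 1 + m + 1) := by
    refine h1.append hg.reverse.indPath (fun i hi j hj => ?_) fun i hi j hj => ?_
    · rcases glue_cases (f := f) (g := fun _ => t) (n := n) (m := 0) hi with
        ⟨hi, e⟩ | ⟨i, hi, rfl, e⟩ <;> rw [e]
      exacts [(hfg i hi _ (by omega)).1, hg.right_ne _ (by omega)]
    · rcases glue_cases (f := f) (g := fun _ => t) (n := n) (m := 0) hi with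
        ⟨hi, e⟩ | ⟨i, hi, rfl, e⟩ <;> rw [e]
      · exact iff_of_false (hfg i hi _ (by omega)).2 (by omega)
      · rw [hg.right_adj _ (by omega)]; omega
  have h3 := h2.exists_hole (s := s) (by omega) (fun i hi => ?_) fun i hi => ?_
  · rwa [show n + m + 4 = n + 1 + m + 1 + 2 by ring]
  · rcases glue_cases (f := glue f n fun _ => t) (n := n + 1) (m := m) hi with
      ⟨hi, e⟩ | ⟨i, hi, rfl, e⟩ <;> rw [e]
    · rcases glue_cases (f := f) (g := fun _ => t) (n := n) (m := 0) hi with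
        ⟨hi, e⟩ | ⟨i, hi, rfl, e⟩ <;> rw [e]
      exacts [hf.left_ne _ hi, hst]
    · exact hg.left_ne _ (by omega)
  · rcases glue_cases (f := glue f n fun _ => t) (n := n + 1) (m := m) hi with
      ⟨hi, e⟩ | ⟨i, hi, rfl, e⟩ <;> rw [e]
    · rcases glue_cases (f := f) (g := fun _ => t) (n := n) (m := 0) hi with
        ⟨hi, e⟩ | ⟨i, hi, rfl, e⟩ <;> rw [e]
      · rw [hf.left_adj _ hi]; omega
      · exact iff_of_false hnadj (by omega)
    · rw [hg.left_adj _ (by omega)]; omega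

/-- An arc read upwards from its end adjacent to `s` to its end adjacent to `t`. -/
theorem HoleMap.links_up (h : HoleMap G k c) {a : ℤ} {n : ℕ} (hn : n + 2 ≤ k) {s t : V}
    (hs : s ∉ Set.range c) (ht : t ∉ Set.range c)
    (has : ∀ i, a ≤ i → i ≤ a + n → (G.Adj s (c i) ↔ i = a))
    (hat : ∀ i, a ≤ i → i ≤ a + n → (G.Adj t (c i) ↔ i = a + n)) :
    Links G s t (fun i => c (a + 1 * i)) n where
  indPath := h.indPath_arc hn a (.inl rfl)
  left_ne i _ e := hs ⟨_, e.symm⟩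
  right_ne i _ e := ht ⟨_, e.symm⟩
  left_adj i hi := by rw [has _ (by omega) (by omega)]; omega
  right_adj i hi := by rw [hat _ (by omega) (by omega)]; omega

/-- An arc read downwards from its end adjacent to `s` to its end adjacent to `t`. -/
theorem HoleMap.links_down (h : HoleMap G k c) {b : ℤ} {n : ℕ} (hn : n + 2 ≤ k) {s t : V}
    (hs : s ∉ Set.range c) (ht : t ∉ Set.range c)
    (has : ∀ i, b - n ≤ i → i ≤ b → (G.Adj s (c i) ↔ i = b))
    (hat : ∀ i, b - n ≤ i → i ≤ b → (G.Adj t (c i) ↔ i = b - n)) :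
    Links G s t (fun i => c (b + (-1) * i)) n where
  indPath := h.indPath_arc hn b (.inr rfl)
  left_ne i _ e := hs ⟨_, e.symm⟩
  right_ne i _ e := ht ⟨_, e.symm⟩
  left_adj i hi := by rw [has _ (by omega) (by omega)]; omega
  right_adj i hi := by rw [hat _ (by omega) (by omega)]; omega

/-- `v` has exactly one neighbour in the arc `c a, …, c b`, namely `c e`. -/
def OnlyAt (G : SimpleGraph V) (c : ℤ → V) (v : V) (a b e : ℤ) : Prop :=
  ∀ i, a ≤ i → i ≤ b → (G.Adj v (c i) ↔ i = e)

/-- Two arcs between `s` and `t`, both read upwards from `s` to `t`. -/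
theorem EvenHolesGE.of_arcs_same (hmin : EvenHolesGE G ℓ k) (h : HoleMap G k c) {s t : V}
    (hs : s ∉ Set.range c) (ht : t ∉ Set.range c) (hst : s ≠ t) (hnadj : ¬ G.Adj s t)
    {a b a' b' : ℤ} (hab : a ≤ b) (hba : b + 2 ≤ a') (hab' : a' ≤ b') (hba' : b' + 2 ≤ a + k)
    (h1 : OnlyAt G c s a b a) (h2 : OnlyAt G c t a b b) (h3 : OnlyAt G c s a' b' a')
    (h4 : OnlyAt G c t a' b' b') (hev : Even (b - a + (b' - a')))
    (hℓ : ℓ ≤ b - a + (b' - a') + 4) (hk : b - a + (b' - a') + 4 < k) : False := by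
  obtain ⟨n, hn⟩ : ∃ n : ℕ, b = a + n := ⟨(b - a).toNat, by omega⟩
  obtain ⟨m, hm⟩ : ∃ m : ℕ, b' = a' + m := ⟨(b' - a').toNat, by omega⟩
  subst hn hm
  obtain ⟨C, hC⟩ := Links.exists_hole hst hnadj (h.links_up (n := n) (by omega) hs ht h1 h2)
    (h.links_up (n := m) (by omega) hs ht h3 h4) (fun i hi j hj => by
      refine ⟨?_, ?_⟩
      · rw [Ne, h.eq_iff] <;> omega
      · rw [h.adj_iff] <;> omega)
  have := hmin C _ hC (by
    rw [show a + n - a + (a' + m - a') = ((n + m : ℕ) : ℤ) by push_cast; ring,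
      Int.even_coe_nat] at hev
    exact hev.add ⟨2, rfl⟩) (by omega)
  omega

/-- Two arcs between `s` and `t`, the first read upwards and the second read downwards from `s` to
`t`. -/
theorem EvenHolesGE.of_arcs_opp (hmin : EvenHolesGE G ℓ k) (h : HoleMap G k c) {s t : V}
    (hs : s ∉ Set.range c) (ht : t ∉ Set.range c) (hst : s ≠ t) (hnadj : ¬ G.Adj s t)
    {a b a' b' : ℤ} (hab : a ≤ b) (hba : b + 2 ≤ a') (hab' : a' ≤ b') (hba' : b' + 2 ≤ a + k)
    (h1 : OnlyAt G c s a b a) (h2 : OnlyAt G c t a b b) (h3 : OnlyAt G c s a' b' b')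
    (h4 : OnlyAt G c t a' b' a') (hev : Even (b - a + (b' - a')))
    (hℓ : ℓ ≤ b - a + (b' - a') + 4) (hk : b - a + (b' - a') + 4 < k) : False := by
  obtain ⟨n, hn⟩ : ∃ n : ℕ, b = a + n := ⟨(b - a).toNat, by omega⟩
  obtain ⟨m, hm⟩ : ∃ m : ℕ, a' = b' - m := ⟨(b' - a').toNat, by omega⟩
  subst hn hm
  obtain ⟨C, hC⟩ := Links.exists_hole hst hnadj (h.links_up (n := n) (by omega) hs ht h1 h2)
    (h.links_down (n := m) (by omega) hs ht h3 h4) (fun i hi j hj => by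
      refine ⟨?_, ?_⟩
      · rw [Ne, h.eq_iff] <;> omega
      · rw [h.adj_iff] <;> omega)
  have := hmin C _ hC (by
    rw [show a + n - a + (b' - (b' - m)) = ((n + m : ℕ) : ℤ) by push_cast; ring,
      Int.even_coe_nat] at hev
    exact hev.add ⟨2, rfl⟩) (by omega)
  omega

end Holes

/-! ### Major vertices and their gaps -/

section Majors

variable {V : Type*} {G : SimpleGraph V} {ℓ k : ℕ} {c : ℤ → V}

/-- `c` numbers a shortest long even hole, of length `k`, in a candidate. -/
structure ShortestHole (G : SimpleGraph V) (ℓ k : ℕ) (c : ℤ → V) : Prop where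
  six_le : 6 ≤ ℓ
  even_bound : Even ℓ
  hole : HoleMap G k c
  even_length : Even k
  lt_length : 2 * ℓ < k
  min : EvenHolesGE G ℓ k
  no_jewel : ¬ HasLongJewel G ℓ (ℓ + 1)
  no_theta : ¬ HasLongTheta G ℓ
  no_bomb : ¬ HasLongBanTheBomb G ℓ
  no_prism : ¬ HasLongNearPrism G ℓ

theorem ShortestHole.comp_add (H : ShortestHole G ℓ k c) (a : ℤ) :
    ShortestHole G ℓ k fun i => c (i + a) :=
  { H with hole := H.hole.comp_add a }

/-- `x` is major if it has neighbours outside every three-vertex path of the hole. -/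
theorem HoleMap.isMajor_iff (h : HoleMap G k c) {x : V} :
    IsMajor G (Set.range c) x ↔ x ∉ Set.range c ∧
      ∀ n : ℤ, ∃ j : ℤ, n + 2 ≤ j ∧ j + 2 ≤ n + k ∧ G.Adj x (c j) := by
  have h4 := h.four_le
  refine and_congr_right fun _ => ⟨fun hx n => ?_, ?_⟩
  · by_contra! hno
    refine hx ⟨c (n - 1), ⟨_, rfl⟩, c n, ⟨_, rfl⟩, c (n + 1), ⟨_, rfl⟩, ?_, ?_, ?_, ?_⟩
    · rw [Ne, h.eq_iff] <;> omega
    · rw [h.adj_iff] <;> omega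
    · rw [h.adj_iff] <;> omega
    · rintro _ ⟨i, rfl⟩ hi
      obtain ⟨j, hj1, hj2, hj⟩ := h.exists_mem_Ico (n - 1) i
      rw [← hj] at hi ⊢
      by_cases e1 : j = n - 1
      · simp [e1]
      by_cases e2 : j = n
      · simp [e2]
      by_cases e3 : j = n + 1
      · simp [e3]
      · exact absurd hi (hno j (by omega) (by omega))
  · rintro hx ⟨_, ⟨a, rfl⟩, _, ⟨b, rfl⟩, _, ⟨d, rfl⟩, hne, hab, hbd, hall⟩
    have nb : ∀ i, G.Adj (c b) (c i) → c i = c (b - 1) ∨ c i = c (b + 1) := by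
      intro i hi
      rw [h.adj_iff_dvd] at hi
      rw [h.eq_iff_dvd, h.eq_iff_dvd]
      rcases hi with hi | hi
      · left; rwa [show i - (b - 1) = -(b - i - 1) by ring, dvd_neg]
      · right; rwa [show i - (b + 1) = i - b - 1 by ring]
    obtain ⟨j, hj1, hj2, hj⟩ := hx b
    have e1 : c j ≠ c (b - 1) := by rw [Ne, h.eq_iff] <;> omega
    have e2 : c j ≠ c b := by rw [Ne, h.eq_iff] <;> omega
    have e3 : c j ≠ c (b + 1) := by rw [Ne, h.eq_iff] <;> omega
    rcases hall _ ⟨j, rfl⟩ hj with e | e | e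
    · exact (nb a hab.symm).elim (fun e' => e1 (e.trans e')) fun e' => e3 (e.trans e')
    · exact e2 e
    · exact (nb d hbd).elim (fun e' => e1 (e.trans e')) fun e' => e3 (e.trans e')

/-- A vertex off the hole that is not major sees the hole only around some position `n`. -/
theorem HoleMap.exists_window (h : HoleMap G k c) {x : V} (hx : x ∉ Set.range c)
    (hmaj : ¬ IsMajor G (Set.range c) x) :
    ∃ n : ℤ, ∀ j : ℤ, n + 2 ≤ j → j + 2 ≤ n + k → ¬ G.Adj x (c j) := by
  by_contra! hno
  exact hmaj (h.isMajor_iff.2 ⟨hx, fun n => by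
    obtain ⟨j, h1, h2, h3⟩ := hno n; exact ⟨j, h1, h2, h3⟩⟩)

/-- A vertex off a hole whose neighbours form two disjoint edges of it, not too close to each other,
completes it to a near-prism. -/
theorem ShortestHole.no_two_edges (H : ShortestHole G ℓ k c) {y : V} (hy : y ∉ Set.range c)
    {p q : ℤ} (hpq : ℓ ≤ q - p + 1) (hqp : ℓ ≤ p + k - q + 1)
    (hadj : ∀ i, p < i → i ≤ p + k → (G.Adj y (c i) ↔ i = p + 1 ∨ i = q ∨ i = q + 1 ∨ i = p + k)) :
    False := by
  have h6 := H.six_le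
  have hk := H.lt_length
  obtain ⟨n, hn⟩ : ∃ n : ℕ, q = p + 1 + n := ⟨(q - p - 1).toNat, by omega⟩
  obtain ⟨m, hm⟩ : ∃ m : ℕ, p + k = q + 1 + m := ⟨(p + k - q - 1).toNat, by omega⟩
  refine H.no_prism (hasLongNearPrism_of_prismPair (n := n) (m := m)
    (H.hole.indPath_arc (n := n) (by omega) (p + 1) (.inl rfl))
    (H.hole.indPath_arc (n := m) (by omega) (p + k) (.inr rfl)) (.const y) ?_ ?_ ?_ (by omega)
    (by omega) (by omega) (by omega) (by omega))
  · intro i hi j hj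
    refine ⟨?_, ?_⟩
    · rw [Ne, H.hole.eq_iff] <;> omega
    · rw [H.hole.adj_iff] <;> omega
  · intro i hi j hj
    refine ⟨fun e => hy ⟨_, e⟩, ?_⟩
    rw [G.adj_comm, hadj _ (by omega) (by omega)]
    omega
  · intro i hi j hj
    refine ⟨fun e => hy ⟨_, e⟩, ?_⟩
    rw [G.adj_comm, hadj _ (by omega) (by omega)]
    omega

/-- `x` is a major vertex with gap `c 0, …, c m`: its two ends are neighbours of `x` and there are
no others in it. The gap is not short, and every major vertex has a neighbour in it. -/
structure LargestGap (G : SimpleGraph V) (ℓ k : ℕ) (c : ℤ → V) (x : V) (m : ℤ) : Prop where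
  major : IsMajor G (Set.range c) x
  adj_iff : ∀ i, 0 ≤ i → i ≤ m → (G.Adj x (c i) ↔ i = 0 ∨ i = m)
  exists_adj : ∀ y, IsMajor G (Set.range c) y → ∃ i, 0 ≤ i ∧ i ≤ m ∧ G.Adj y (c i)
  large : 2 * (ℓ : ℤ) - 5 ≤ m
  lt : m < k

namespace LargestGap

variable {x : V} {m : ℤ}

theorem notMem (M : LargestGap G ℓ k c x m) : x ∉ Set.range c := M.major.1

theorem add_three_le (H : ShortestHole G ℓ k c) (M : LargestGap G ℓ k c x m) : m + 3 ≤ k := by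
  have h6 := H.six_le
  have := M.lt
  have := M.large
  obtain ⟨j, h1, h2, h3⟩ := (H.hole.isMajor_iff.1 M.major).2 (-1)
  by_contra! hlt
  have hjm : j ≤ m := by omega
  have := (M.adj_iff j (by omega) hjm).1 h3
  -- all neighbours of `x` lie in the arc from `m` to `k`, which has at most three vertices
  obtain ⟨j, h1, h2, h3⟩ := (H.hole.isMajor_iff.1 M.major).2 (k - 1)
  rw [← sub_add_cancel j (k : ℤ), H.hole.add_period] at h3
  have := (M.adj_iff (j - k) (by omega) (by omega)).1 h3
  omega

/-- Otherwise `x` completes the gap to an even hole that is too short. -/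
theorem odd (H : ShortestHole G ℓ k c) (M : LargestGap G ℓ k c x m) : ¬ Even m := by
  intro he
  have h6 := H.six_le
  have := M.large
  have := M.add_three_le H
  exact H.min.of_arc H.hole (a := 0) (b := m) (by omega) M.notMem M.adj_iff (by simpa using he)
    (by omega) (by omega)

/-- Otherwise the two paths from `c 0` to `c m`, through `x` and through the rest of the hole, are
short and of different parity, so that they form a long jewel with the gap. -/
theorem add_lt (H : ShortestHole G ℓ k c) (M : LargestGap G ℓ k c x m) : m + ℓ < k := by
  have h6 := H.six_le
  have hk := H.lt_length
  have := M.large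
  have h3 := M.add_three_le H
  have hodd := M.odd H
  have hke := H.even_length
  by_contra! hlt
  obtain ⟨n, hn⟩ : ∃ n : ℕ, m = n + 2 := ⟨(m - 2).toNat, by omega⟩
  obtain ⟨r, hr⟩ : ∃ r : ℕ, (k : ℤ) = m + 2 + r := ⟨(k - m - 2).toNat, by omega⟩
  have hx := M.notMem
  have hne : c 0 ≠ c m := by rw [Ne, H.hole.eq_iff] <;> omega
  have hna : ¬ G.Adj (c 0) (c m) := by rw [H.hole.adj_iff] <;> omega
  refine H.no_jewel (hasLongJewel_of_links (n := n) (m := r) (r := 0) hne hna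
    (f := fun i => c (1 + 1 * i)) (g := fun i => c (-1 + (-1) * i)) (h := fun _ => x)
    ⟨H.hole.indPath_arc (by omega) 1 (.inl rfl), ?_, ?_, ?_, ?_⟩
    ⟨H.hole.indPath_arc (by omega) (-1) (.inr rfl), ?_, ?_, ?_, ?_⟩
    ⟨.const x, ?_, ?_, ?_, ?_⟩ ?_ ?_ ?_ (by omega) (by omega) (by omega) (by omega))
  any_goals intro i hi
  · rw [Ne, H.hole.eq_iff] <;> omega
  · rw [Ne, H.hole.eq_iff] <;> omega
  · rw [H.hole.adj_iff] <;> omega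
  · rw [H.hole.adj_iff] <;> omega
  · rw [Ne, H.hole.eq_iff] <;> omega
  · rw [Ne, H.hole.eq_iff] <;> omega
  · rw [H.hole.adj_iff] <;> omega
  · rw [H.hole.adj_iff] <;> omega
  · exact fun e => hx ⟨_, e⟩
  · exact fun e => hx ⟨_, e⟩
  · rw [G.adj_comm, M.adj_iff _ (by omega) (by omega)]; omega
  · rw [G.adj_comm, M.adj_iff _ (by omega) (by omega)]; omega
  · intro j hj
    refine ⟨?_, ?_⟩
    · rw [Ne, H.hole.eq_iff] <;> omega
    · rw [H.hole.adj_iff] <;> omega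
  · intro j hj
    refine ⟨fun e => hx ⟨_, e⟩, ?_⟩
    rw [G.adj_comm, M.adj_iff _ (by omega) (by omega)]; omega
  · rw [Int.not_even_iff] at hodd
    rw [Nat.even_iff] at hke
    omega

/-- The neighbours of `x` are not confined to the gap and the two vertices next to it: if the others
are both of these vertices, there is a near-prism, if only one of them, an even hole, and if there
are none, a theta. -/
theorem exists_outer_adj (H : ShortestHole G ℓ k c) (M : LargestGap G ℓ k c x m) :
    ∃ j, m + 2 ≤ j ∧ j + 2 ≤ k ∧ G.Adj x (c j) := by
  have h6 := H.six_le
  have hk := H.lt_length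
  have := M.large
  have hlt := M.add_lt H
  have hodd := M.odd H
  have hke := H.even_length
  have hx := M.notMem
  have hk0 : G.Adj x (c k) := by
    rw [← zero_add (k : ℤ), H.hole.add_period]
    exact (M.adj_iff 0 le_rfl (by omega)).2 (.inl rfl)
  have hm : G.Adj x (c m) := (M.adj_iff m (by omega) le_rfl).2 (.inr rfl)
  by_contra! hno
  have hin : ∀ i : ℤ, k < i → i < k + m → ¬ G.Adj x (c i) := by
    intro i h1 h2
    rw [← sub_add_cancel i (k : ℤ), H.hole.add_period, M.adj_iff _ (by omega) (by omega)]
    omega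
  by_cases h1 : G.Adj x (c (m + 1)) <;> by_cases h2 : G.Adj x (c (k - 1))
  · refine H.no_two_edges hx (p := m) (q := k - 1) (by omega) (by omega) fun i hi1 hi2 => ?_
    have hmk : G.Adj x (c (m + k)) := by rwa [H.hole.add_period]
    by_cases e1 : i = m + 1
    · simp [e1, h1]
    by_cases e2 : i = k - 1
    · simp [e2, h2]
    by_cases e3 : i = k
    · simp [e3, hk0]
    by_cases e4 : i = m + k
    · simp [e4, hmk]
    refine iff_of_false ?_ (by omega)
    rcases lt_or_ge i k with hik | hik
    exacts [hno i (by omega) (by omega), hin i (by omega) (by omega)]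
  · refine H.min.of_arc H.hole (a := m + 1) (b := k) (by omega) hx (fun i hi1 hi2 => ?_) ?_
      (by omega) (by omega)
    · by_cases e1 : i = m + 1
      · simp [e1, h1]
      by_cases e2 : i = k - 1
      · subst e2; exact iff_of_false h2 (by omega)
      by_cases e3 : i = k
      · simp [e3, hk0]
      exact iff_of_false (hno i (by omega) (by omega)) (by omega)
    · rw [Int.even_iff]; rw [Int.not_even_iff] at hodd; rw [Nat.even_iff] at hke; omega
  · refine H.min.of_arc H.hole (a := m) (b := k - 1) (by omega) hx (fun i hi1 hi2 => ?_) ?_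
      (by omega) (by omega)
    · by_cases e1 : i = m + 1
      · subst e1; exact iff_of_false h1 (by omega)
      by_cases e2 : i = k - 1
      · simp [e2, h2]
      by_cases e3 : i = m
      · simp [e3, hm]
      exact iff_of_false (hno i (by omega) (by omega)) (by omega)
    · rw [Int.even_iff]; rw [Int.not_even_iff] at hodd; rw [Nat.even_iff] at hke; omega
  · obtain ⟨n, hn⟩ : ∃ n : ℕ, m = n + 2 := ⟨(m - 2).toNat, by omega⟩
    obtain ⟨r, hr⟩ : ∃ r : ℕ, (k : ℤ) = m + 2 + r := ⟨(k - m - 2).toNat, by omega⟩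
    have hne : c 0 ≠ c m := by rw [Ne, H.hole.eq_iff] <;> omega
    have hna : ¬ G.Adj (c 0) (c m) := by rw [H.hole.adj_iff] <;> omega
    refine H.no_theta (hasLongTheta_of_links (n := n) (m := r) (k := 0) hne hna
      (f := fun i => c (1 + 1 * i)) (g := fun i => c (k - 1 + (-1) * i)) (h := fun _ => x)
      ⟨H.hole.indPath_arc (by omega) 1 (.inl rfl), ?_, ?_, ?_, ?_⟩
      ⟨H.hole.indPath_arc (by omega) (k - 1) (.inr rfl), ?_, ?_, ?_, ?_⟩
      ⟨.const x, ?_, ?_, ?_, ?_⟩ ?_ ?_ ?_ (by omega) (by omega) (by omega))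
    any_goals intro i hi
    · rw [Ne, H.hole.eq_iff] <;> omega
    · rw [Ne, H.hole.eq_iff] <;> omega
    · rw [H.hole.adj_iff] <;> omega
    · rw [H.hole.adj_iff] <;> omega
    · rw [Ne, H.hole.eq_iff] <;> omega
    · rw [Ne, H.hole.eq_iff] <;> omega
    · rw [H.hole.adj_iff] <;> omega
    · rw [H.hole.adj_iff] <;> omega
    · exact fun e => hx ⟨_, e⟩
    · exact fun e => hx ⟨_, e⟩
    · rw [G.adj_comm, M.adj_iff _ (by omega) (by omega)]; omega
    · rw [G.adj_comm, M.adj_iff _ (by omega) (by omega)]; omega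
    · intro j hj
      refine ⟨?_, ?_⟩
      · rw [Ne, H.hole.eq_iff] <;> omega
      · rw [H.hole.adj_iff] <;> omega
    · intro j hj
      refine ⟨fun e => hx ⟨_, e⟩, ?_⟩
      rw [G.adj_comm, M.adj_iff _ (by omega) (by omega)]; omega
    · intro j hj
      refine ⟨fun e => hx ⟨_, e⟩, ?_⟩
      rw [G.adj_comm]
      rcases eq_or_ne i 0 with rfl | hi0
      · convert h2 using 3; simp
      rcases eq_or_ne i r with rfl | hir
      · convert h1 using 3; omega
      exact hno _ (by omega) (by omega)

end LargestGap

end Majors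

/-! ### Major vertices that are not adjacent to the vertex with the largest gap -/

section Hats

variable {V : Type*} {G : SimpleGraph V} {ℓ k : ℕ} {c : ℤ → V} {x : V} {m : ℤ}

/-- `y` has no neighbours among the vertices of the hole close to the ends of the gap. -/
def Unhit (G : SimpleGraph V) (ℓ : ℕ) (c : ℤ → V) (m : ℤ) (y : V) : Prop :=
  (∀ i : ℤ, -1 ≤ i → i ≤ ℓ - 5 → ¬ G.Adj y (c i)) ∧
  ∀ i : ℤ, m - ℓ + 5 ≤ i → i ≤ m + 1 → ¬ G.Adj y (c i)

/-- Two vertices off the hole with neighbours in an arc are linked through this arc. -/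
theorem HoleMap.exists_links (h : HoleMap G k c) {x y : V} (hx : x ∉ Set.range c)
    (hy : y ∉ Set.range c) {a b : ℤ} (hab : b + 2 ≤ a + k)
    (hxa : ∃ i, a ≤ i ∧ i ≤ b ∧ G.Adj x (c i)) (hya : ∃ i, a ≤ i ∧ i ≤ b ∧ G.Adj y (c i)) :
    ∃ f n, Links G x y f n ∧ ∀ i ≤ n, ∃ j, a ≤ j ∧ j ≤ b ∧ f i = c j := by
  classical
  have hex : ∃ d : ℕ, ∃ i j, a ≤ i ∧ i ≤ b ∧ a ≤ j ∧ j ≤ b ∧ G.Adj x (c i) ∧ G.Adj y (c j) ∧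
      (i - j).natAbs = d := by
    obtain ⟨i, hi⟩ := hxa
    obtain ⟨j, hj⟩ := hya
    exact ⟨_, i, j, hi.1, hi.2.1, hj.1, hj.2.1, hi.2.2, hj.2.2, rfl⟩
  obtain ⟨i, j, hi1, hi2, hj1, hj2, hi, hj, hd⟩ := Nat.find_spec hex
  have hmin := @Nat.find_min _ _ hex
  -- a closest pair of neighbours of `x` and `y` in the arc
  have hmin : ∀ i' j', a ≤ i' → i' ≤ b → a ≤ j' → j' ≤ b → G.Adj x (c i') → G.Adj y (c j') →
      (i - j).natAbs ≤ (i' - j').natAbs := by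
    intro i' j' h1 h2 h3 h4 h5 h6
    by_contra! hlt
    exact hmin (hd ▸ hlt) ⟨i', j', h1, h2, h3, h4, h5, h6, rfl⟩
  rcases le_total i j with hij | hij
  · obtain ⟨n, rfl⟩ : ∃ n : ℕ, j = i + n := ⟨(j - i).toNat, by omega⟩
    refine ⟨_, n, h.links_up (a := i) (by omega) hx hy (fun q h1 h2 => ⟨fun hq => ?_, ?_⟩)
      (fun q h1 h2 => ⟨fun hq => ?_, ?_⟩), fun q hq => ⟨_, ?_, ?_, rfl⟩⟩
    · have := hmin q _ (by omega) (by omega) hj1 hj2 hq hj; omega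
    · rintro rfl; exact hi
    · have := hmin _ q hi1 hi2 (by omega) (by omega) hi hq; omega
    · rintro rfl; exact hj
    · omega
    · omega
  · obtain ⟨n, rfl⟩ : ∃ n : ℕ, j = i - n := ⟨(i - j).toNat, by omega⟩
    refine ⟨_, n, h.links_down (b := i) (by omega) hx hy (fun q h1 h2 => ⟨fun hq => ?_, ?_⟩)
      (fun q h1 h2 => ⟨fun hq => ?_, ?_⟩), fun q hq => ⟨_, ?_, ?_, rfl⟩⟩
    · have := hmin q _ (by omega) (by omega) hj1 hj2 hq hj; omega
    · rintro rfl; exact hi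
    · have := hmin _ q hi1 hi2 (by omega) (by omega) hi hq; omega
    · rintro rfl; exact hj
    · omega
    · omega

theorem exists_min_int {P : ℤ → Prop} {a b : ℤ} (h : ∃ i, a ≤ i ∧ i ≤ b ∧ P i) :
    ∃ i, a ≤ i ∧ i ≤ b ∧ P i ∧ ∀ j, a ≤ j → j < i → ¬ P j := by
  classical
  obtain ⟨i, h1, h2, h3⟩ := h
  have hex : ∃ d : ℕ, P (a + d) := ⟨(i - a).toNat, by
    rwa [show a + ((i - a).toNat : ℤ) = i by omega]⟩
  have hle : Nat.find hex ≤ (i - a).toNat := Nat.find_min' hex (by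
    rwa [show a + ((i - a).toNat : ℤ) = i by omega])
  refine ⟨a + Nat.find hex, by omega, by omega, Nat.find_spec hex, fun j hj hji hP => ?_⟩
  exact Nat.find_min hex (m := (j - a).toNat) (by omega) (by
    rwa [show a + ((j - a).toNat : ℤ) = j by omega])

theorem exists_max_int {P : ℤ → Prop} {a b : ℤ} (h : ∃ i, a ≤ i ∧ i ≤ b ∧ P i) :
    ∃ i, a ≤ i ∧ i ≤ b ∧ P i ∧ ∀ j, i < j → j ≤ b → ¬ P j := by
  obtain ⟨i, h1, h2, h3⟩ := h
  obtain ⟨j, h4, h5, h6, h7⟩ := exists_min_int (P := fun i => P (-i)) (a := -b) (b := -a)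
    ⟨-i, by omega, by omega, by simpa using h3⟩
  exact ⟨-j, by omega, by omega, h6, fun q hq hqb hP => h7 (-q) (by omega) (by omega) (by simpa)⟩

/-- A major vertex that is not adjacent to `x` and not hit near the ends of the gap has exactly two
neighbours in the gap, and these are adjacent; its other neighbours are far from the gap. -/
structure IsHat (G : SimpleGraph V) (ℓ k : ℕ) (c : ℤ → V) (m : ℤ) (y : V) (p : ℤ) : Prop where
  notMem : y ∉ Set.range c
  unhit : Unhit G ℓ c m y
  le : ℓ - 4 ≤ p
  le' : p ≤ m - ℓ + 3
  adj_iff : ∀ i, 0 ≤ i → i ≤ m → (G.Adj y (c i) ↔ i = p ∨ i = p + 1)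
  exists_adj : ∃ i, m + 2 ≤ i ∧ i ≤ k - 2 ∧ G.Adj y (c i)

/-- If `y` has neighbours far from the gap, a path through this part of the hole joins `x` to `y`,
and unless `y` is a hat there is a theta. Otherwise there is an even hole through `x`, `y` and the
two ends of the gap. -/
theorem LargestGap.exists_isHat (H : ShortestHole G ℓ k c) (M : LargestGap G ℓ k c x m) {y : V}
    (hy : IsMajor G (Set.range c) y) (hxy : x ≠ y) (hna : ¬ G.Adj x y) (hun : Unhit G ℓ c m y) :
    ∃ p, IsHat G ℓ k c m y p := by
  have h6 := H.six_le
  have hk := H.lt_length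
  have := M.large
  have hlt := M.add_lt H
  have hodd := M.odd H
  have hke := H.even_length
  have hx := M.notMem
  obtain ⟨i, hi0, him, hi⟩ := M.exists_adj y hy
  obtain ⟨p, hp0, hpm, hp, hpmin⟩ := exists_min_int (P := fun i => G.Adj y (c i)) ⟨i, hi0, him, hi⟩
  obtain ⟨q, hq0, hqm, hq, hqmax⟩ := exists_max_int (P := fun i => G.Adj y (c i)) ⟨i, hi0, him, hi⟩
  have hpq : p ≤ q := by
    by_contra! hqp
    exact hpmin q hq0 hqp hq
  have hp' : ℓ - 4 ≤ p := by
    by_contra! h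
    exact hun.1 p (by omega) (by omega) hp
  have hq' : q ≤ m - ℓ + 4 := by
    by_contra! h
    exact hun.2 q (by omega) (by omega) hq
  have hkp : ∀ i, G.Adj y (c (k + i)) ↔ G.Adj y (c i) := fun i => by
    rw [add_comm, H.hole.add_period]
  have hlow : OnlyAt G c y 0 p p := by
    refine fun i h1 h2 => ⟨fun h => ?_, fun h => h ▸ hp⟩
    by_contra hne
    exact hpmin i h1 (by omega) h
  have hhigh : OnlyAt G c y q m q := by
    refine fun i h1 h2 => ⟨fun h => ?_, fun h => h ▸ hq⟩
    by_contra hne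
    exact hqmax i (by omega) h2 h
  have hxlow : OnlyAt G c x 0 p 0 := fun i h1 h2 => by
    rw [M.adj_iff i h1 (by omega)]; omega
  have hxhigh : OnlyAt G c x q m m := fun i h1 h2 => by
    rw [M.adj_iff i (by omega) h2]; omega
  obtain ⟨r, hr⟩ : ∃ r : ℕ, p = r + 1 := ⟨(p - 1).toNat, by omega⟩
  obtain ⟨s, hs⟩ : ∃ s : ℕ, m = q + 1 + s := ⟨(m - q - 1).toNat, by omega⟩
  by_cases hout : ∃ i, m + 2 ≤ i ∧ i ≤ k - 2 ∧ G.Adj y (c i)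
  · obtain ⟨f, n, hf, hfc⟩ := H.hole.exists_links hx hy.1 (a := m + 2) (b := k - 2) (by omega)
      (by
        obtain ⟨j, h1, h2, h3⟩ := M.exists_outer_adj H
        exact ⟨j, h1, by omega, h3⟩) hout
    have hfne : ∀ i ≤ n, ∀ j : ℤ, 0 ≤ j → j ≤ m → c j ≠ f i ∧ ¬ G.Adj (c j) (f i) := by
      intro i hi j h1 h2
      obtain ⟨j', h3, h4, e⟩ := hfc i hi
      rw [e]
      exact ⟨by rw [Ne, H.hole.eq_iff] <;> omega, by rw [H.hole.adj_iff] <;> omega⟩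
    rcases eq_or_ne p q with rfl | hqr
    · -- a single neighbour in the gap: a theta with ends `x` and this neighbour
      exfalso
      have hxr : ¬ G.Adj x (c p) := by
        rw [M.adj_iff _ (by omega) (by omega)]; omega
      have hw : Links G x (c p) (glue f n fun _ => y) (n + 0 + 1) := by
        refine ⟨hf.indPath.append (.const y) (fun i hi _ _ => (hf.right_ne i hi).symm)
          fun i hi j hj => ?_, fun i hi => ?_, fun i hi => ?_, fun i hi => ?_, fun i hi => ?_⟩
        · rw [G.adj_comm, hf.right_adj i hi]; omega
        all_goals
          rcases glue_cases (f := f) (g := fun _ => y) (n := n) (m := 0) hi with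
            ⟨hi, e⟩ | ⟨i, hi, rfl, e⟩ <;> rw [e]
        · exact hf.left_ne i hi
        · exact hxy
        · exact (hfne i hi p hp0 hpm).1
        · exact fun e => hy.1 ⟨_, e⟩
        · rw [hf.left_adj i hi]
        · exact iff_of_false hna (by omega)
        · exact iff_of_false (hfne i hi p hp0 hpm).2 (by omega)
        · exact iff_of_true hp.symm (by omega)
      refine H.no_theta (hasLongTheta_of_links (u := x) (v := c p) (n := r) (m := s)
        (fun e => hx ⟨_, e.symm⟩) hxr
        (f := fun i => c (0 + 1 * i)) (g := fun i => c (m + (-1) * i))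
        ⟨H.hole.indPath_arc (by omega) 0 (.inl rfl), ?_, ?_, ?_, ?_⟩
        ⟨H.hole.indPath_arc (by omega) m (.inr rfl), ?_, ?_, ?_, ?_⟩ hw ?_ ?_ ?_
        (by omega) (by omega) (by omega))
      any_goals intro i hi
      · exact fun e => hx ⟨_, e.symm⟩
      · rw [Ne, H.hole.eq_iff] <;> omega
      · rw [hxlow _ (by omega) (by omega)]; omega
      · rw [H.hole.adj_iff] <;> omega
      · exact fun e => hx ⟨_, e.symm⟩
      · rw [Ne, H.hole.eq_iff] <;> omega
      · rw [hxhigh _ (by omega) (by omega)]; omega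
      · rw [H.hole.adj_iff] <;> omega
      · exact fun j hj => ⟨by rw [Ne, H.hole.eq_iff] <;> omega,
          by rw [H.hole.adj_iff] <;> omega⟩
      · intro j hj
        rcases glue_cases (f := f) (g := fun _ => y) (n := n) (m := 0) hj with
          ⟨hj, e⟩ | ⟨j, hj, rfl, e⟩ <;> rw [e]
        · exact hfne j hj _ (by omega) (by omega)
        · refine ⟨fun e => hy.1 ⟨_, e⟩, ?_⟩
          rw [G.adj_comm, hlow _ (by omega) (by omega)]; omega
      · intro j hj
        rcases glue_cases (f := f) (g := fun _ => y) (n := n) (m := 0) hj with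
          ⟨hj, e⟩ | ⟨j, hj, rfl, e⟩ <;> rw [e]
        · exact hfne j hj _ (by omega) (by omega)
        · refine ⟨fun e => hy.1 ⟨_, e⟩, ?_⟩
          rw [G.adj_comm, hhigh _ (by omega) (by omega)]; omega
    rcases eq_or_ne q (p + 1) with rfl | hqp
    · refine ⟨p, hy.1, hun, hp', by omega, fun i h1 h2 => ?_, hout⟩
      rcases le_or_gt i p with h | h
      · rw [hlow i h1 h]; omega
      · rw [hhigh i (by omega) h2]; omega
    · -- two nonadjacent neighbours in the gap: a theta with ends `x` and `y`
      exfalso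
      refine H.no_theta (hasLongTheta_of_links hxy hna (H.hole.links_up (n := r + 1) (a := 0)
        (by omega) hx hy.1 ?_ ?_) (H.hole.links_down (n := s + 1) (b := m) (by omega) hx hy.1 ?_ ?_)
        hf ?_ ?_ ?_ (by omega) (by omega) (by omega))
      · exact fun i h1 h2 => hxlow i h1 (by omega)
      · exact fun i h1 h2 => by rw [hlow i h1 (by omega)]; omega
      · exact fun i h1 h2 => hxhigh i (by omega) h2
      · exact fun i h1 h2 => by rw [hhigh i (by omega) h2]; omega
      · exact fun i hi j hj => ⟨by rw [Ne, H.hole.eq_iff] <;> omega,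
          by rw [H.hole.adj_iff] <;> omega⟩
      · exact fun i hi j hj => hfne j hj _ (by omega) (by omega)
      · exact fun i hi j hj => hfne j hj _ (by omega) (by omega)
  · -- no neighbours far from the gap: an even hole through `x`, `y` and the ends of the gap
    exfalso
    have hno : ∀ i : ℤ, q < i → i < p + k → ¬ G.Adj y (c i) := by
      intro i h1 h2 h
      by_cases e1 : i ≤ m
      · exact hqmax i h1 e1 h
      by_cases e2 : i = m + 1
      · exact hun.2 i (by omega) (by omega) h
      by_cases e3 : i ≤ k - 2
      · exact hout ⟨i, by omega, e3, h⟩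
      rw [← sub_add_cancel i (k : ℤ), H.hole.add_period] at h
      by_cases e4 : i = k - 1
      · exact hun.1 _ (by omega) (by omega) h
      · exact hpmin _ (by omega) (by omega) h
    have hqp : p + 3 ≤ q := by
      obtain ⟨j, h1, h2, h3⟩ := (H.hole.isMajor_iff.1 hy).2 (p + 1)
      by_contra! hlt
      exact hno j (by omega) (by omega) h3
    have hodd' : ¬ Even (p + k - q) := by
      intro he
      refine H.min.of_arc H.hole (a := q) (b := p + k) (by omega) hy.1 (fun i h1 h2 => ?_) he
        (by omega) (by omega)
      refine ⟨fun h => ?_, ?_⟩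
      · by_contra hne
        exact hno i (by omega) (by omega) h
      · rintro (rfl | rfl)
        · exact hq
        · rwa [H.hole.add_period]
    rw [Int.not_even_iff] at hodd hodd'
    rw [Nat.even_iff] at hke
    exact H.min.of_arcs_opp H.hole hx hy.1 hxy hna hp0 (by omega) hqm (by omega) hxlow hlow hxhigh
      hhigh (by rw [Int.even_iff]; omega) (by omega) (by omega)

end Hats

section HatPairs

variable {V : Type*} {G : SimpleGraph V} {ℓ k : ℕ} {c : ℤ → V} {x y : V} {m p : ℤ}

/-- `c a` and `c b` are the first and the last neighbour of the hat `y` outside the gap. The arcs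
between them and the neighbours `c p` and `c (p + 1)` of `y` in the gap have odd length. -/
structure HatEnds (G : SimpleGraph V) (k : ℕ) (c : ℤ → V) (m : ℤ) (y : V) (p a b : ℤ) : Prop where
  le : m + 2 ≤ a
  le' : b ≤ k - 2
  add_le : a + 3 ≤ b
  left : G.Adj y (c a)
  right : G.Adj y (c b)
  lt_left : ∀ i, p + 1 < i → i < a → ¬ G.Adj y (c i)
  gt_right : ∀ i, b < i → i < k + p → ¬ G.Adj y (c i)
  parity : Even (a - p)
  parity' : Even (b - p - 1)

/-- The parities are such since `y` does not complete an arc to a shorter even hole; and if the two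
neighbours were close to each other, they would be adjacent, which leads to a near-prism. -/
theorem IsHat.exists_ends (H : ShortestHole G ℓ k c) (M : LargestGap G ℓ k c x m)
    (h : IsHat G ℓ k c m y p) : ∃ a b, HatEnds G k c m y p a b := by
  have h6 := H.six_le
  have hk := H.lt_length
  have := M.large
  have hlt := M.add_lt H
  have hke := H.even_length
  have hp := h.le
  have hp' := h.le'
  have hyp : G.Adj y (c p) := (h.adj_iff p (by omega) (by omega)).2 (.inl rfl)
  have hyp1 : G.Adj y (c (p + 1)) := (h.adj_iff _ (by omega) (by omega)).2 (.inr rfl)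
  obtain ⟨a, ha1, ha2, ha, hamin⟩ := exists_min_int (P := fun i => G.Adj y (c i)) h.exists_adj
  obtain ⟨b, hb1, hb2, hb, hbmax⟩ := exists_max_int (P := fun i => G.Adj y (c i)) h.exists_adj
  have hleft : ∀ i, p + 1 < i → i < a → ¬ G.Adj y (c i) := by
    intro i h1 h2 hi
    by_cases e1 : i ≤ m
    · have := (h.adj_iff i (by omega) e1).1 hi; omega
    by_cases e2 : i = m + 1
    · exact h.unhit.2 i (by omega) (by omega) hi
    exact hamin i (by omega) h2 hi
  have hright : ∀ i, b < i → i < k + p → ¬ G.Adj y (c i) := by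
    intro i h1 h2 hi
    by_cases e1 : i ≤ k - 2
    · exact hbmax i h1 e1 hi
    rw [← sub_add_cancel i (k : ℤ), H.hole.add_period] at hi
    by_cases e4 : i = k - 1
    · exact h.unhit.1 _ (by omega) (by omega) hi
    · have := (h.adj_iff _ (by omega) (by omega)).1 hi; omega
  have hpk : G.Adj y (c (p + k)) := by rwa [H.hole.add_period]
  have e1 : ¬ Even (a - (p + 1)) := fun he =>
    H.min.of_arc H.hole (a := p + 1) (b := a) (by omega) h.notMem (fun i h1 h2 =>
      ⟨fun hi => by by_contra hne; exact hleft i (by omega) (by omega) hi, by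
        rintro (rfl | rfl) <;> assumption⟩) he (by omega) (by omega)
  have e2 : ¬ Even (p + k - b) := fun he =>
    H.min.of_arc H.hole (a := b) (b := p + k) (by omega) h.notMem (fun i h1 h2 =>
      ⟨fun hi => by by_contra hne; exact hright i (by omega) (by omega) hi, by
        rintro (rfl | rfl) <;> assumption⟩) he (by omega) (by omega)
  have hab : a ≤ b := by
    by_contra! hlt
    exact hamin b hb1 hlt hb
  rw [Int.not_even_iff] at e1 e2
  rw [Nat.even_iff] at hke
  refine ⟨a, b, ha1, hb2, ?_, ha, hb, hleft, hright, by rw [Int.even_iff]; omega,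
    by rw [Int.even_iff]; omega⟩
  by_contra! hlt
  obtain rfl : b = a + 1 := by omega
  refine H.no_two_edges h.notMem (p := p) (q := a) (by omega) (by omega) fun i h1 h2 => ?_
  refine ⟨fun hi => ?_, ?_⟩
  · by_contra hne
    rcases lt_or_ge i a with hia | hia
    exacts [hleft i (by omega) hia hi, hright i (by omega) (by omega) hi]
  · rintro (rfl | rfl | rfl | rfl) <;> assumption

/-- Two nonadjacent hats `y` and `u`, the first neighbour outside the gap of `u` being no later than
that of `y`: the hat `u` has a neighbour close to the neighbours of `y` in the gap, or close to the
first neighbour of `y` outside it. Otherwise the arcs between the neighbours of `y` and those of `u`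
would have to satisfy contradictory parity conditions. -/
theorem IsHat.exists_adj_near (H : ShortestHole G ℓ k c) (M : LargestGap G ℓ k c x m)
    (hy : IsHat G ℓ k c m y p) {a b : ℤ} (hyE : HatEnds G k c m y p a b) {u : V} {v a' b' : ℤ}
    (hu : IsHat G ℓ k c m u v) (huE : HatEnds G k c m u v a' b') (ha : a' ≤ a) (hyu : y ≠ u)
    (hna : ¬ G.Adj y u) :
    (∃ i, p ≤ i ∧ i ≤ p + ℓ - 4 ∧ G.Adj u (c i)) ∨
      ∃ i, a - ℓ + 6 ≤ i ∧ i ≤ a + 1 ∧ G.Adj u (c i) := by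
  by_contra! hno
  obtain ⟨hno1, hno2⟩ := hno
  have h6 := H.six_le
  have hk := H.lt_length
  have := M.large
  have hlt := M.add_lt H
  have hke := H.even_length
  have hle := H.even_bound
  have hp := hy.le
  have hp' := hy.le'
  have hv := hu.le
  have hv' := hu.le'
  have hyp : G.Adj y (c p) := (hy.adj_iff p (by omega) (by omega)).2 (.inl rfl)
  have hyp1 : G.Adj y (c (p + 1)) := (hy.adj_iff _ (by omega) (by omega)).2 (.inr rfl)
  have huv : G.Adj u (c v) := (hu.adj_iff v (by omega) (by omega)).2 (.inl rfl)
  have huv1 : G.Adj u (c (v + 1)) := (hu.adj_iff _ (by omega) (by omega)).2 (.inr rfl)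
  have huvk : G.Adj u (c (k + v)) := by rwa [add_comm, H.hole.add_period]
  obtain ⟨ya1, yb1, yab, ya, yb, ylo, yhi, ypa, ypb⟩ := hyE
  obtain ⟨ua1, ub1, uab, ua, ub, ulo, uhi, upa, upb⟩ := huE
  have ha' : a' < a - ℓ + 6 := by
    by_contra! hlt
    exact hno2 a' hlt (by omega) ua
  have only : ∀ {z : V} {s t e : ℤ}, s ≤ e → e ≤ t → G.Adj z (c e) →
      (∀ i, s ≤ i → i < e → ¬ G.Adj z (c i)) → (∀ i, e < i → i ≤ t → ¬ G.Adj z (c i)) →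
      OnlyAt G c z s t e := by
    intro z s t e h1 h2 h3 h4 h5 i h6 h7
    refine ⟨fun hi => ?_, fun hi => hi ▸ h3⟩
    by_contra hne
    rcases lt_or_gt_of_ne hne with h | h
    exacts [h4 i h6 h hi, h5 i h h7 hi]
  -- the last neighbour of `u` before the first outer neighbour of `y`
  obtain ⟨h, hh1, hh2, hh, hhmax⟩ := exists_max_int (P := fun i => G.Adj u (c i)) (a := a')
    (b := a) ⟨a', le_rfl, ha, ua⟩
  have hha : h < a - ℓ + 6 := by
    by_contra! hlt
    exact hno2 h hlt (by omega) hh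
  have hb'a : b' ≤ a → h = b' := by
    intro hle
    have h1 : ¬ h < b' := fun hlt => hhmax b' hlt hle ub
    have h2 : ¬ b' < h := fun hlt => uhi h hlt (by omega) hh
    omega
  have hu1 : OnlyAt G c u h a h := only le_rfl hh2 hh (fun i _ _ => by omega) hhmax
  have hy1 : OnlyAt G c y h a a := only hh2 le_rfl ya (fun i h1 h2 => ylo i (by omega) h2)
    fun i _ _ => by omega
  have hvp : v ≤ p - 2 ∨ p + ℓ - 3 ≤ v := by
    by_contra! hcon
    by_cases e : v = p - 1
    · exact hno1 (v + 1) (by omega) (by omega) huv1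
    · exact hno1 v (by omega) (by omega) huv
  rw [Nat.even_iff] at hke hle
  rw [Int.even_iff] at ypa ypb upa upb
  have hmin := H.min
  have hhole := H.hole
  have hy0 := hy.notMem
  have hu0 := hu.notMem
  have hnua : ∀ g, b ≤ g → g ≤ k - 2 → G.Adj u (c g) → (∀ i, b ≤ i → i < g → ¬ G.Adj u (c i)) →
      OnlyAt G c u b g g ∧ OnlyAt G c y b g b := fun g h1 h2 h3 h4 =>
    ⟨only h1 le_rfl h3 h4 fun i _ _ => by omega,
      only le_rfl h1 yb (fun i _ _ => by omega) fun i h5 h6 => yhi i h5 (by omega)⟩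
  rcases hvp with hvp | hvp
  · -- the neighbours of `u` in the gap come before those of `y`
    have hyA : OnlyAt G c y (p + 1) a' (p + 1) := only le_rfl (by omega) hyp1
      (fun i _ _ => by omega) fun i h1 h2 => ylo i h1 (by omega)
    have huA : OnlyAt G c u (p + 1) a' a' := only (by omega) le_rfl ua
      (fun i h1 h2 => ulo i (by omega) h2) fun i _ _ => by omega
    rcases lt_or_ge b' b with hbb | hbb
    · refine hmin.of_arcs_same hhole hy0 hu0 hyu hna (a := p + 1) (b := a') (a' := b)
        (b' := k + v) (by omega) (by omega) (by omega) (by omega) hyA huA ?_ ?_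
        (by rw [Int.even_iff]; omega) (by omega) (by omega)
      · exact only le_rfl (by omega) yb (fun i _ _ => by omega) fun i h1 h2 => yhi i h1 (by omega)
      · exact only (by omega) le_rfl huvk (fun i h1 h2 => uhi i (by omega) h2)
          fun i _ _ => by omega
    obtain ⟨g, hg1, hg2, hg, hgmin⟩ := exists_min_int (P := fun i => G.Adj u (c i)) (a := b)
      (b := b') ⟨b', hbb, le_rfl, ub⟩
    obtain ⟨huR, hyR⟩ := hnua g hg1 (by omega) hg hgmin
    have hr : (a - h + p - v) % 2 = 0 := by
      by_contra hodd
      rcases eq_or_ne h (a' + 1) with rfl | hne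
      · refine hmin.of_arcs_same hhole hu0 hy0 hyu.symm (fun e => hna e.symm) (a := v + 1) (b := p)
          (a' := a' + 1) (b' := a) (by omega) (by omega) (by omega) (by omega) ?_ ?_ hu1 hy1
          (by rw [Int.even_iff]; omega) (by omega) (by omega)
        · intro i h1 h2
          rw [hu.adj_iff i (by omega) (by omega)]; omega
        · intro i h1 h2
          rw [hy.adj_iff i (by omega) (by omega)]; omega
      rcases eq_or_ne h a' with rfl | hne'
      · omega
      exact hmin.of_arcs_opp hhole hy0 hu0 hyu hna (a := p + 1) (b := a') (a' := h)
        (b' := a) (by omega) (by omega) (by omega) (by omega) hyA huA hy1 hu1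
        (by rw [Int.even_iff]; omega) (by omega) (by omega)
    have hr' : (a - h + g - b) % 2 = 1 := by
      by_contra hev
      exact hmin.of_arcs_opp hhole hu0 hy0 hyu.symm (fun e => hna e.symm)
        (a := h) (b := a) (a' := b) (b' := g) (by omega) (by omega) (by omega) (by omega)
        hu1 hy1 huR hyR
        (by rw [Int.even_iff]; omega) (by omega) (by omega)
    exact hmin.of_arcs_same hhole hy0 hu0 hyu hna (a := p + 1) (b := a') (a' := b)
        (b' := g) (by omega) (by omega) (by omega) (by omega) hyA huA hyR huR
        (by rw [Int.even_iff]; omega) (by omega) (by omega)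
  · -- the neighbours of `u` in the gap come after those of `y`
    have hy2 : OnlyAt G c y (p + 1) v (p + 1) := fun i h1 h2 => by
      rw [hy.adj_iff i (by omega) (by omega)]; omega
    have hu2 : OnlyAt G c u (p + 1) v v := fun i h1 h2 => by
      rw [hu.adj_iff i (by omega) (by omega)]; omega
    have hr : (a - h - v + p) % 2 = 0 := by
      by_contra hodd
      exact hmin.of_arcs_opp hhole hy0 hu0 hyu hna (a := p + 1) (b := v) (a' := h)
        (b' := a) (by omega) (by omega) (by omega) (by omega) hy2 hu2 hy1 hu1
        (by rw [Int.even_iff]; omega) (by omega) (by omega)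
    have hb'2 : a + 2 ≤ b' := by
      by_contra! hcon
      by_cases e : b' ≤ a
      · have := hb'a e; omega
      · exact hno2 b' (by omega) (by omega) ub
    rcases lt_or_ge b' b with hbb | hbb
    · obtain ⟨g, hg1, hg2, hg, hgmin⟩ := exists_min_int (P := fun i => G.Adj y (c i)) (a := b')
        (b := b) ⟨b, hbb.le, le_rfl, yb⟩
      have hyR : OnlyAt G c y b' g g := only hg1 le_rfl hg hgmin fun i _ _ => by omega
      have huR : OnlyAt G c u b' g b' := only le_rfl hg1 ub (fun i _ _ => by omega)
        fun i h1 h2 => uhi i h1 (by omega)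
      have hr' : (g - b' - v + p) % 2 = 0 := by
        by_contra hodd
        exact hmin.of_arcs_opp hhole hy0 hu0 hyu hna (a := p + 1) (b := v) (a' := b')
          (b' := g) (by omega) (by omega) (by omega) (by omega) hy2 hu2 hyR huR
          (by rw [Int.even_iff]; omega) (by omega) (by omega)
      exact hmin.of_arcs_same hhole hu0 hy0 hyu.symm (fun e => hna e.symm)
        (a := h) (b := a) (a' := b') (b' := g) (by omega) (by omega) (by omega) (by omega)
        hu1 hy1 huR hyR
        (by rw [Int.even_iff]; omega) (by omega) (by omega)
    · obtain ⟨g, hg1, hg2, hg, hgmin⟩ := exists_min_int (P := fun i => G.Adj u (c i)) (a := b)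
        (b := b') ⟨b', hbb, le_rfl, ub⟩
      obtain ⟨huR, hyR⟩ := hnua g hg1 (by omega) hg hgmin
      have hr' : (g - b - v + p) % 2 = 0 := by
        by_contra hodd
        exact hmin.of_arcs_same hhole hy0 hu0 hyu hna (a := p + 1) (b := v) (a' := b)
          (b' := g) (by omega) (by omega) (by omega) (by omega) hy2 hu2 hyR huR
          (by rw [Int.even_iff]; omega) (by omega) (by omega)
      exact hmin.of_arcs_opp hhole hu0 hy0 hyu.symm (fun e => hna e.symm)
        (a := h) (b := a) (a' := b) (b' := g) (by omega) (by omega) (by omega) (by omega)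
        hu1 hy1 huR hyR
        (by rw [Int.even_iff]; omega) (by omega) (by omega)

end HatPairs

/-! ### Paths that leave the gap for the rest of the hole -/

section Bridges

variable {V : Type*} {G : SimpleGraph V} {ℓ k : ℕ} {c : ℤ → V}

/-- An induced path `w 0, …, w n` off the hole whose only vertices with neighbours in the hole are
its ends. The neighbours of `w 0` lie between `c a` and `c b`, those of `w n` between `c a'` and
`c b'`, and the two windows are far from each other. -/
structure Bridge (G : SimpleGraph V) (ℓ k : ℕ) (c : ℤ → V) (w : ℕ → V) (n : ℕ) (a b a' b' : ℤ) :
    Prop where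
  six_le : 6 ≤ ℓ
  indPath : IndPath G w n
  pos : 0 < n
  notMem : ∀ i ≤ n, w i ∉ Set.range c
  not_adj : ∀ i, 0 < i → i < n → ∀ j, ¬ G.Adj (w i) (c j)
  left : G.Adj (w 0) (c a)
  left' : G.Adj (w 0) (c b)
  left_not : ∀ i, b < i → i < a + k → ¬ G.Adj (w 0) (c i)
  right : G.Adj (w n) (c a')
  right' : G.Adj (w n) (c b')
  right_not : ∀ i, b' < i → i < a' + k → ¬ G.Adj (w n) (c i)
  le : a ≤ b
  le_add : b ≤ a + 2
  le' : a' ≤ b'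
  le_add' : b' ≤ a' + 2
  dist : b + ℓ - 2 ≤ a'
  dist' : b' + ℓ - 2 ≤ a + k

namespace Bridge

variable {w : ℕ → V} {n : ℕ} {a b a' b' : ℤ}

theorem reverse (h : HoleMap G k c) (B : Bridge G ℓ k c w n a b a' b') :
    Bridge G ℓ k c (fun i => w (n - i)) n a' b' (a + k) (b + k) where
  six_le := B.six_le
  indPath := B.indPath.reverse
  pos := B.pos
  notMem i _ := B.notMem _ (by omega)
  not_adj i _ _ := B.not_adj _ (by omega) (by omega)
  left := by simpa using B.right
  left' := by simpa using B.right'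
  left_not := by simpa using B.right_not
  right := by simpa [h.add_period] using B.left
  right' := by simpa [h.add_period] using B.left'
  right_not i h1 h2 := by
    rw [Nat.sub_self, ← sub_add_cancel i (k : ℤ), h.add_period]
    exact B.left_not _ (by omega) (by omega)
  le := B.le'
  le_add := B.le_add'
  le' := by have := B.le; omega
  le_add' := by have := B.le_add; omega
  dist := by have := B.dist'; omega
  dist' := by have := B.dist; omega

theorem adj_left (B : Bridge G ℓ k c w n a b a' b') {i : ℤ} (h2 : i ≤ a + k)
    (hi : G.Adj (w 0) (c i)) : i ≤ b ∨ i = a + k := by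
  by_contra! hlt
  exact B.left_not i hlt.1 (by omega) hi

theorem adj_right (h : HoleMap G k c) (B : Bridge G ℓ k c w n a b a' b') {i : ℤ} (h1 : a ≤ i)
    (h2 : i ≤ a + k) (hi : G.Adj (w n) (c i)) : a' ≤ i ∧ i ≤ b' := by
  have := B.six_le
  have := B.dist
  have := B.dist'
  have := B.le
  have := B.le'
  by_contra! hlt
  rcases lt_or_ge i a' with h3 | h3
  · rw [← h.add_period] at hi
    exact B.right_not _ (by omega) (by omega) hi
  · exact B.right_not i (hlt h3) (by omega) hi

/-- The adjacencies between a bridge and the hole. -/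
theorem adj_cases (h : HoleMap G k c) (B : Bridge G ℓ k c w n a b a' b') {i : ℤ} (h1 : a ≤ i)
    (h2 : i ≤ a + k) {j : ℕ} (hj : j ≤ n) (hi : G.Adj (c i) (w j)) :
    j = 0 ∧ (i ≤ b ∨ i = a + k) ∨ j = n ∧ a' ≤ i ∧ i ≤ b' := by
  rcases Nat.eq_zero_or_pos j with rfl | hj0
  · exact .inl ⟨rfl, B.adj_left h2 hi.symm⟩
  rcases hj.eq_or_lt with rfl | hjn
  · exact .inr ⟨rfl, B.adj_right h h1 h2 hi.symm⟩
  · exact absurd hi.symm (B.not_adj j hj0 hjn i)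

theorem adj_ends (h : HoleMap G k c) (B : Bridge G ℓ k c w n a b a' b') :
    G.Adj (c a) (w 0) ∧ G.Adj (c b) (w 0) ∧ G.Adj (c (a + k)) (w 0) ∧ G.Adj (c a') (w n) ∧
      G.Adj (c b') (w n) :=
  ⟨B.left.symm, B.left'.symm, by rw [h.add_period]; exact B.left.symm, B.right.symm, B.right'.symm⟩

/-- The bridge and the two arcs of the hole form a theta. -/
theorem not_single_single (H : ShortestHole G ℓ k c) (B : Bridge G ℓ k c w n a b a' b')
    (hb : b = a) (hb' : b' = a') : False := by
  subst hb hb'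
  have h6 := H.six_le
  have hk := H.lt_length
  have hd := B.dist
  have hd' := B.dist'
  have hn := B.pos
  have hh := H.hole
  obtain ⟨j1, j2, j3, j4, j5⟩ := B.adj_ends hh
  have adj := fun i j h1 h2 h3 => B.adj_cases hh (i := i) (j := j) h1 h2 h3
  have hw := B.notMem
  obtain ⟨r, hr⟩ : ∃ r : ℕ, b' = b + 2 + r := ⟨(b' - b - 2).toNat, by omega⟩
  obtain ⟨s, hs⟩ : ∃ s : ℕ, b + k = b' + 2 + s := ⟨(b + k - b' - 2).toNat, by omega⟩
  refine H.no_theta (hasLongTheta_of_links (u := c b) (v := c b') (n := r) (m := s)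
    (f := fun i => c (b + 1 + 1 * i)) (g := fun i => c (b + k - 1 + (-1) * i)) (h := w)
    (by rw [Ne, hh.eq_iff] <;> omega) (by rw [hh.adj_iff] <;> omega)
    ⟨hh.indPath_arc (by omega) _ (.inl rfl), ?_, ?_, ?_, ?_⟩
    ⟨hh.indPath_arc (by omega) _ (.inr rfl), ?_, ?_, ?_, ?_⟩
    ⟨B.indPath, ?_, ?_, ?_, ?_⟩ ?_ ?_ ?_ (by omega) (by omega) (by omega))
  any_goals intro i hi
  any_goals first
    | exact fun e => hw i hi ⟨_, e⟩
    | (rw [Ne, hh.eq_iff] <;> omega)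
    | (rw [hh.adj_iff] <;> omega)
    | (intro j hj; exact ⟨fun e => hw j hj ⟨_, e⟩, fun e => by
        have := adj _ _ (by omega) (by omega) hj e; omega⟩)
    | (intro j hj; exact ⟨by rw [Ne, hh.eq_iff] <;> omega, by rw [hh.adj_iff] <;> omega⟩)
  · refine ⟨fun e => ?_, fun e => e ▸ j1⟩
    have := adj _ _ (by omega) (by omega) hi e; omega
  · refine ⟨fun e => ?_, fun e => e ▸ j4⟩
    have := adj _ _ (by omega) (by omega) hi e; omega

/-- The rest of the bridge and the two arcs of the hole form a theta with one end `w 0`. -/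
theorem not_span_single (H : ShortestHole G ℓ k c) (B : Bridge G ℓ k c w n a b a' b')
    (hb : b = a + 2) (hb' : b' = a') : False := by
  subst hb hb'
  have h6 := H.six_le
  have hk := H.lt_length
  have hd := B.dist
  have hd' := B.dist'
  have hn := B.pos
  have hh := H.hole
  obtain ⟨j1, j2, j3, j4, j5⟩ := B.adj_ends hh
  have adj := fun i j h1 h2 h3 => B.adj_cases hh (i := i) (j := j) h1 h2 h3
  have hw := B.notMem
  have h0 := hw 0 (by omega)
  obtain ⟨r, hr⟩ : ∃ r : ℕ, b' = a + 2 + 1 + r := ⟨(b' - (a + 2) - 1).toNat, by omega⟩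
  obtain ⟨s, hs⟩ : ∃ s : ℕ, a + k = b' + 1 + s := ⟨(a + k - b' - 1).toNat, by omega⟩
  obtain ⟨t, rfl⟩ : ∃ t, n = 1 + t := ⟨n - 1, by omega⟩
  refine H.no_theta (hasLongTheta_of_links (u := w 0) (v := c b') (n := r) (m := s) (k := t)
    (f := fun i => c (a + 2 + 1 * i)) (g := fun i => c (a + k + (-1) * i))
    (h := fun i => w (1 + i))
    (fun e => h0 ⟨_, e.symm⟩)
    (fun e => by have := adj _ _ (by omega) (by omega) (by omega) e.symm; omega)
    ⟨hh.indPath_arc (by omega) _ (.inl rfl), ?_, ?_, ?_, ?_⟩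
    ⟨hh.indPath_arc (by omega) _ (.inr rfl), ?_, ?_, ?_, ?_⟩
    ⟨B.indPath.shift 1 le_rfl, ?_, ?_, ?_, ?_⟩ ?_ ?_ ?_ (by omega) (by omega) (by omega))
  any_goals intro i hi
  any_goals first
    | exact fun e => hw _ (by omega) ⟨_, e⟩
    | exact fun e => h0 ⟨_, e.symm⟩
    | (rw [Ne, hh.eq_iff] <;> omega)
    | (rw [hh.adj_iff] <;> omega)
    | (intro j hj; exact ⟨fun e => hw _ (by omega) ⟨_, e⟩, fun e => by
        have := adj _ _ (by omega) (by omega) (by omega) e; omega⟩)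
    | (intro j hj; exact ⟨by rw [Ne, hh.eq_iff] <;> omega, by rw [hh.adj_iff] <;> omega⟩)
  · rw [G.adj_comm]
    refine ⟨fun e => ?_, fun e => by subst e; simpa using j2⟩
    have := adj _ _ (by omega) (by omega) (by omega) e; omega
  · rw [G.adj_comm]
    refine ⟨fun e => ?_, fun e => by subst e; simpa using j3⟩
    have := adj _ _ (by omega) (by omega) (by omega) e; omega
  · exact fun e => by have := (B.indPath 0 (1 + i) (by omega) (by omega)).1 e; omega
  · rw [(B.indPath 0 (1 + i) (by omega) (by omega)).2]; omega
  · refine ⟨fun e => ?_, fun e => e ▸ j4⟩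
    have := adj _ _ (by omega) (by omega) (by omega) e; omega

/-- The two arcs of the hole and the interior of the bridge form a theta with ends `w 0` and `w n`,
or, if there is no interior, the bridge and the hole form a ban-the-bomb. -/
theorem not_span_span (H : ShortestHole G ℓ k c) (B : Bridge G ℓ k c w n a b a' b')
    (hb : b = a + 2) (hb' : b' = a' + 2) : False := by
  subst hb hb'
  have h6 := H.six_le
  have hk := H.lt_length
  have hd := B.dist
  have hd' := B.dist'
  have hn := B.pos
  have hh := H.hole
  obtain ⟨j1, j2, j3, j4, j5⟩ := B.adj_ends hh
  have adj := fun i j h1 h2 h3 => B.adj_cases hh (i := i) (j := j) h1 h2 h3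
  have hw := B.notMem
  have h0 := hw 0 (by omega)
  have h1 := hw n le_rfl
  rcases Nat.lt_or_ge 1 n with hn1 | hn1
  · obtain ⟨t, rfl⟩ : ∃ t, n = 1 + t + 1 := ⟨n - 2, by omega⟩
    obtain ⟨r, hr⟩ : ∃ r : ℕ, a' = a + 2 + r := ⟨(a' - (a + 2)).toNat, by omega⟩
    obtain ⟨s, hs⟩ : ∃ s : ℕ, a + k = a' + 2 + s := ⟨(a + k - a' - 2).toNat, by omega⟩
    refine H.no_theta (hasLongTheta_of_links (u := w 0) (v := w (1 + t + 1)) (n := r) (m := s)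
      (k := t) (f := fun i => c (a + 2 + 1 * i)) (g := fun i => c (a + k + (-1) * i))
      (h := fun i => w (1 + i))
      (fun e => by have := (B.indPath 0 _ (by omega) le_rfl).1 e; omega)
      (by rw [(B.indPath 0 _ (by omega) le_rfl).2]; omega)
      ⟨hh.indPath_arc (by omega) _ (.inl rfl), ?_, ?_, ?_, ?_⟩
      ⟨hh.indPath_arc (by omega) _ (.inr rfl), ?_, ?_, ?_, ?_⟩
      ⟨B.indPath.shift 1 (by omega), ?_, ?_, ?_, ?_⟩ ?_ ?_ ?_ (by omega) (by omega) (by omega))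
    any_goals intro i hi
    any_goals first
      | exact fun e => h1 ⟨_, e.symm⟩
      | exact fun e => h0 ⟨_, e.symm⟩
      | (intro j hj; exact ⟨fun e => hw _ (by omega) ⟨_, e⟩, fun e => by
          have := adj _ _ (by omega) (by omega) (by omega) e; omega⟩)
      | (intro j hj; exact ⟨by rw [Ne, hh.eq_iff] <;> omega, by rw [hh.adj_iff] <;> omega⟩)
      | exact fun e => by have := (B.indPath 0 (1 + i) (by omega) (by omega)).1 e; omega
      | exact fun e => by have := (B.indPath _ (1 + i) le_rfl (by omega)).1 e; omega
      | (rw [(B.indPath _ (1 + i) (by omega) (by omega)).2]; omega)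
    all_goals rw [G.adj_comm]
    · refine ⟨fun e => ?_, fun e => by subst e; simpa using j2⟩
      have := adj _ _ (by omega) (by omega) (by omega) e; omega
    · refine ⟨fun e => ?_, fun e => by subst e; rwa [show a + 2 + 1 * (i : ℤ) = a' by omega]⟩
      have := adj _ _ (by omega) (by omega) (by omega) e; omega
    · refine ⟨fun e => ?_, fun e => by subst e; simpa using j3⟩
      have := adj _ _ (by omega) (by omega) (by omega) e; omega
    · refine ⟨fun e => ?_, fun e => by
        subst e; rwa [show a + k + -1 * (i : ℤ) = a' + 2 by omega]⟩
      have := adj _ _ (by omega) (by omega) (by omega) e; omega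
  · -- the ends of the bridge are adjacent: a ban-the-bomb
    obtain rfl : n = 1 := by omega
    obtain ⟨r, hr⟩ : ∃ r : ℕ, a' = a + 3 + r := ⟨(a' - (a + 3)).toNat, by omega⟩
    obtain ⟨s, hs⟩ : ∃ s : ℕ, a + k = a' + 3 + s := ⟨(a + k - a' - 3).toNat, by omega⟩
    have hne : w 0 ≠ w 1 := fun e => by have := (B.indPath 0 1 (by omega) le_rfl).1 e; omega
    have hadj : G.Adj (w 1) (w 0) := (B.indPath 1 0 le_rfl (by omega)).2.2 (.inr rfl)
    have hx : ∀ i, a ≤ i → i ≤ a + 2 → ¬ G.Adj (w 1) (c i) := fun i h2 h3 e => by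
      have := adj i 1 h2 (by omega) le_rfl e.symm; omega
    refine H.no_bomb (hasLongBanTheBomb_of_links (u := w 0) (v₁ := c a) (v₂ := c (a + 2))
      (w := c (a + 1)) (x := w 1) (n := s) (m := r)
      (f := fun i => c (a' + 2 + 1 * i)) (g := fun i => c (a' + (-1) * i))
      ?_ j1.symm (by rw [hh.adj_iff] <;> omega) (by rw [hh.adj_iff] <;> omega) j2
      (by rw [hh.adj_iff] <;> omega) hadj (hx _ (by omega) (by omega)) (hx _ (by omega) (by omega))
      (hx _ (by omega) (by omega))
      ⟨hh.indPath_arc (by omega) _ (.inl rfl), ?_, ?_, ?_, ?_⟩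
      ⟨hh.indPath_arc (by omega) _ (.inr rfl), ?_, ?_, ?_, ?_⟩
      ?_ ?_ ?_ ?_ ?_ ?_ ?_ (by omega) (by omega))
    · simp only [List.nodup_cons, List.mem_cons, List.not_mem_nil, or_false, not_or,
        not_false_eq_true, List.nodup_nil, and_true]
      refine ⟨⟨fun e => h0 ⟨_, e.symm⟩, fun e => h0 ⟨_, e.symm⟩, fun e => h0 ⟨_, e.symm⟩, hne⟩,
        ⟨?_, ?_, fun e => h1 ⟨_, e⟩⟩, ⟨?_, fun e => h1 ⟨_, e⟩⟩, fun e => h1 ⟨_, e⟩⟩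
      all_goals rw [hh.eq_iff] <;> omega
    all_goals intro i hi
    any_goals first
      | exact fun e => h1 ⟨_, e.symm⟩
      | exact ⟨fun e => h0 ⟨_, e⟩, fun e => by
          have := adj _ _ (by omega) (by omega) (by omega) e; omega⟩
      | (intro j hj; exact ⟨by rw [Ne, hh.eq_iff] <;> omega, by rw [hh.adj_iff] <;> omega⟩)
      | exact ⟨by rw [Ne, hh.eq_iff] <;> omega, by rw [hh.adj_iff] <;> omega⟩
      | (rw [Ne, hh.eq_iff] <;> omega)
      | (rw [hh.adj_iff] <;> omega)
    all_goals rw [G.adj_comm]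
    · refine ⟨fun e => ?_, fun e => by subst e; simpa using j5⟩
      have := adj _ _ (by omega) (by omega) (by omega) e; omega
    · refine ⟨fun e => ?_, fun e => by subst e; simpa using j4⟩
      have := adj _ _ (by omega) (by omega) (by omega) e; omega

/-- The bridge and the two arcs of the hole form a near-prism. -/
theorem not_edge_edge (H : ShortestHole G ℓ k c) (B : Bridge G ℓ k c w n a b a' b')
    (hb : b = a + 1) (hb' : b' = a' + 1) : False := by
  subst hb hb'
  have h6 := H.six_le
  have hk := H.lt_length
  have hd := B.dist
  have hd' := B.dist'
  have hn := B.pos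
  have hh := H.hole
  obtain ⟨j1, j2, j3, j4, j5⟩ := B.adj_ends hh
  have adj := fun i j h1 h2 h3 => B.adj_cases hh (i := i) (j := j) h1 h2 h3
  have hw := B.notMem
  obtain ⟨r, hr⟩ : ∃ r : ℕ, a' = a + 1 + r := ⟨(a' - (a + 1)).toNat, by omega⟩
  obtain ⟨s, hs⟩ : ∃ s : ℕ, a + k = a' + 1 + s := ⟨(a + k - a' - 1).toNat, by omega⟩
  refine H.no_prism (hasLongNearPrism_of_prismPair (n := r) (m := s)
    (hh.indPath_arc (n := r) (by omega) (a + 1) (.inl rfl))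
    (hh.indPath_arc (n := s) (by omega) (a + k) (.inr rfl)) B.indPath ?_ ?_ ?_ (by omega)
    (by omega) (by omega) (by omega) (by omega))
  all_goals intro i hi j hj
  · exact ⟨by rw [Ne, hh.eq_iff] <;> omega, by rw [hh.adj_iff] <;> omega⟩
  · refine ⟨fun e => hw j hj ⟨_, e⟩, fun e => ?_, ?_⟩
    · have := adj _ _ (by omega) (by omega) hj e; omega
    · rintro (⟨rfl, rfl⟩ | ⟨rfl, rfl⟩)
      · simpa using j2
      · show G.Adj (c (a + 1 + 1 * i)) _
        rwa [show a + 1 + 1 * (i : ℤ) = a' by omega]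
  · refine ⟨fun e => hw j hj ⟨_, e⟩, fun e => ?_, ?_⟩
    · have := adj _ _ (by omega) (by omega) hj e; omega
    · rintro (⟨rfl, rfl⟩ | ⟨rfl, rfl⟩)
      · simpa using j3
      · show G.Adj (c (a + k + -1 * i)) _
        rwa [show a + k + -1 * (i : ℤ) = a' + 1 by omega]

/-- A bridge and the arc from its first to its second window form a hole. -/
theorem exists_hole (h : HoleMap G k c) (B : Bridge G ℓ k c w n a b a' b') {r : ℕ}
    (hr : a' = b + r) : ∃ C, IsHoleOfLength G C (r + n + 2) := by
  have h6 := B.six_le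
  have hd := B.dist
  have hd' := B.dist'
  have hn := B.pos
  have hle := B.le
  have hle' := B.le'
  obtain ⟨j1, j2, j3, j4, j5⟩ := B.adj_ends h
  have adj := fun i j h1 h2 h3 => B.adj_cases h (i := i) (j := j) h1 h2 h3
  have hw := B.notMem
  have hp : IndPath G (glue (fun i => c (b + 1 * i)) r fun i => w (n - i)) (r + (n - 1) + 1) := by
    refine (h.indPath_arc (by omega) b (.inl rfl)).append (B.indPath.reverse.mono (by omega))
      (fun i hi j hj e => hw (n - j) (by omega) ⟨_, e⟩) fun i hi j hj => ?_
    constructor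
    · intro e
      have := adj _ _ (by omega) (by omega) (by omega) e; omega
    · rintro ⟨rfl, rfl⟩
      rwa [show b + 1 * (i : ℤ) = a' by omega]
  rw [show r + n + 2 = r + (n - 1) + 1 + 2 by omega]
  refine hp.exists_hole (s := w 0) (by omega) (fun i hi => ?_) fun i hi => ?_
  · rcases glue_cases (f := fun i : ℕ => c (b + 1 * i)) (g := fun i => w (n - i)) (n := r)
      (m := n - 1) hi with ⟨hi, e⟩ | ⟨i, hi, rfl, e⟩ <;> rw [e]
    · exact fun e => hw 0 (by omega) ⟨_, e.symm⟩
    · intro e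
      have := (B.indPath _ _ (by omega) (by omega)).1 e
      omega
  · rcases glue_cases (f := fun i : ℕ => c (b + 1 * i)) (g := fun i => w (n - i)) (n := r)
      (m := n - 1) hi with ⟨hi, e⟩ | ⟨i, hi, rfl, e⟩ <;> rw [e]
    · rw [G.adj_comm]
      refine ⟨fun e => ?_, fun e => ?_⟩
      · have := adj _ _ (by omega) (by omega) (by omega) e; omega
      · obtain rfl : i = 0 := by omega
        simpa using j2
    · rw [(B.indPath 0 _ (by omega) (by omega)).2]
      omega

/-- A bridge is long enough to be no shortcut, in one of the two directions around the hole. -/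
theorem le_length (H : ShortestHole G ℓ k c) (B : Bridge G ℓ k c w n a b a' b') :
    b' - a ≤ n + 2 ∨ k + b - a' ≤ n + 2 := by
  have h6 := H.six_le
  have hk := H.lt_length
  have hd := B.dist
  have hd' := B.dist'
  have h1 := B.le
  have h1' := B.le'
  have h2 := B.le_add
  have h2' := B.le_add'
  have hke := H.even_length
  have B' := B.reverse H.hole
  have hcases : b = a ∧ b' = a' ∨ b = a + 2 ∧ b' = a' ∨ b = a ∧ b' = a' + 2 ∨
      b = a + 2 ∧ b' = a' + 2 ∨ b = a + 1 ∧ b' = a' + 1 ∨ (b - a + (b' - a')) % 2 = 1 := by omega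
  rcases hcases with ⟨e, e'⟩ | ⟨e, e'⟩ | ⟨e, e'⟩ | ⟨e, e'⟩ | ⟨e, e'⟩ | hodd
  · exact (B.not_single_single H e e').elim
  · exact (B.not_span_single H e e').elim
  · exact (B'.not_span_single H e' (by omega)).elim
  · exact (B.not_span_span H e e').elim
  · exact (B.not_edge_edge H e e').elim
  -- exactly one of the two holes through the bridge is even
  obtain ⟨r, hr⟩ : ∃ r : ℕ, a' = b + r := ⟨(a' - b).toNat, by omega⟩
  obtain ⟨s, hs⟩ : ∃ s : ℕ, a + k = b' + s := ⟨(a + k - b').toNat, by omega⟩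
  rw [Nat.even_iff] at hke
  rcases Nat.even_or_odd (r + n + 2) with he | ho
  · obtain ⟨C, hC⟩ := B.exists_hole H.hole hr
    have := H.min C _ hC he (by omega)
    omega
  · obtain ⟨C, hC⟩ := B'.exists_hole H.hole hs
    rw [Nat.odd_iff] at ho
    have := H.min C _ hC (by rw [Nat.even_iff]; omega) (by omega)
    omega

end Bridge

end Bridges

/-! ### Walks inside a set of vertices -/

section Walks

variable {V : Type*} {G : SimpleGraph V} {S T : Set V}

/-- `f 0, …, f n` is a walk with all vertices in `S`. -/
structure WalkIn (G : SimpleGraph V) (S : Set V) (f : ℕ → V) (n : ℕ) : Prop where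
  adj : ∀ i < n, G.Adj (f i) (f (i + 1))
  mem : ∀ i ≤ n, f i ∈ S

/-- There is a walk of length `n` from `u` to `v` inside `S`. -/
def Reach (G : SimpleGraph V) (S : Set V) (n : ℕ) (u v : V) : Prop :=
  ∃ f, WalkIn G S f n ∧ f 0 = u ∧ f n = v

theorem WalkIn.mono {f : ℕ → V} {n m : ℕ} (h : WalkIn G S f n) (hm : m ≤ n)
    (hT : ∀ i ≤ m, f i ∈ T) : WalkIn G T f m :=
  ⟨fun i hi => h.adj i (by omega), hT⟩

theorem WalkIn.shift {f : ℕ → V} {n m : ℕ} (a : ℕ) (h : WalkIn G S f n) (hm : a + m ≤ n) :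
    WalkIn G S (fun i => f (a + i)) m :=
  ⟨fun i _ => h.adj (a + i) (by omega), fun i _ => h.mem _ (by omega)⟩

theorem WalkIn.reverse {f : ℕ → V} {n : ℕ} (h : WalkIn G S f n) :
    WalkIn G S (fun i => f (n - i)) n := by
  refine ⟨fun i hi => ?_, fun i _ => h.mem _ (by omega)⟩
  have := h.adj (n - (i + 1)) (by omega)
  rw [show n - (i + 1) + 1 = n - i by omega] at this
  exact this.symm

theorem WalkIn.reach {f : ℕ → V} {n : ℕ} (h : WalkIn G S f n) : Reach G S n (f 0) (f n) :=
  ⟨f, h, rfl, rfl⟩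

theorem Reach.refl {u : V} (hu : u ∈ S) : Reach G S 0 u u :=
  ⟨fun _ => u, ⟨fun _ _ => by omega, fun _ _ => hu⟩, rfl, rfl⟩

theorem Reach.symm {n : ℕ} {u v : V} (h : Reach G S n u v) : Reach G S n v u := by
  obtain ⟨f, hf, rfl, rfl⟩ := h
  exact ⟨_, hf.reverse, by simp, by simp⟩

theorem Reach.exists_through {n m : ℕ} {u v w : V} (h : Reach G S n u v) (h' : Reach G S m v w) :
    ∃ f, WalkIn G S f (n + m) ∧ f 0 = u ∧ f n = v ∧ f (n + m) = w := by
  obtain ⟨f, hf, rfl, rfl⟩ := h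
  obtain ⟨g, hg, hgf, rfl⟩ := h'
  refine ⟨fun i => if i ≤ n then f i else g (i - n), ⟨fun i hi => ?_, fun i hi => ?_⟩, by simp,
    by simp, ?_⟩
  · rcases lt_trichotomy i n with h | rfl | h
    · simpa [h.le, show i + 1 ≤ n by omega] using hf.adj i h
    · simpa [hgf] using hg.adj 0 (by omega)
    · have := hg.adj (i - n) (by omega)
      rw [show i - n + 1 = i + 1 - n by omega] at this
      simpa [h.not_ge, show ¬ i + 1 ≤ n by omega] using this
  · by_cases h : i ≤ n
    · simpa [h] using hf.mem i h
    · simpa [h] using hg.mem (i - n) (by omega)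
  · rcases Nat.eq_zero_or_pos m with rfl | hm
    · simp [hgf]
    · simp [show ¬ m = 0 by omega]

theorem Reach.trans {n m : ℕ} {u v w : V} (h : Reach G S n u v) (h' : Reach G S m v w) :
    Reach G S (n + m) u w := by
  obtain ⟨f, hf, h0, -, hn⟩ := h.exists_through h'
  exact ⟨f, hf, h0, hn⟩

theorem Reach.succ {n : ℕ} {u v w : V} (h : Reach G S n u v) (hvw : G.Adj v w) (hw : w ∈ S) :
    Reach G S (n + 1) u w := by
  refine h.trans ⟨fun i => if i = 0 then v else w, ⟨fun i hi => ?_, fun i hi => ?_⟩, by simp,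
    by simp⟩
  · obtain rfl : i = 0 := by omega
    simpa using hvw
  · obtain ⟨f, hf, -, rfl⟩ := h
    by_cases hi0 : i = 0
    · simpa [hi0] using hf.mem n le_rfl
    · simpa [hi0] using hw

/-- A shortest walk is an induced path. -/
theorem Reach.exists_indPath {n : ℕ} {u v : V} (h : Reach G S n u v) :
    ∃ g m, m ≤ n ∧ IndPath G g m ∧ (∀ i ≤ m, g i ∈ S) ∧ g 0 = u ∧ g m = v := by
  classical
  have hex : ∃ n, Reach G S n u v := ⟨n, h⟩
  obtain ⟨g, hg, h0, hm⟩ := Nat.find_spec hex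
  set m := Nat.find hex with hmdef
  have hmin : ∀ r, r < m → ¬ Reach G S r u v := fun r hr => Nat.find_min hex hr
  have cut : ∀ i j, i < j → j ≤ m → ¬ (g i = g j) ∧ (G.Adj (g i) (g j) → j = i + 1) := by
    intro i j hij hj
    have h1 : Reach G S i (g 0) (g i) := (hg.mono (m := i) (by omega)
      fun t _ => hg.mem t (by omega)).reach
    have h2 : Reach G S (m - j) (g j) (g m) := by
      have := (hg.shift j (m := m - j) (by omega)).reach
      rwa [show j + (m - j) = m by omega] at this
    constructor
    · intro e
      rw [e] at h1
      have := h1.trans h2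
      rw [h0, hm] at this
      exact hmin _ (by omega) this
    · intro e
      by_contra hne
      have := (h1.succ e (hg.mem j hj)).trans h2
      rw [h0, hm] at this
      exact hmin _ (by omega) this
  refine ⟨g, m, Nat.find_min' hex h, fun i j hi hj => ⟨fun e => ?_, fun e => ?_, ?_⟩,
    hg.mem, h0, hm⟩
  · rcases lt_trichotomy i j with hij | rfl | hij
    · exact absurd e (cut i j hij hj).1
    · rfl
    · exact absurd e.symm (cut j i hij hi).1
  · rcases lt_trichotomy i j with hij | rfl | hij
    · exact .inl ((cut i j hij hj).2 e).symm
    · exact absurd e G.irrefl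
    · exact .inr ((cut j i hij hi).2 e.symm).symm
  · rintro (rfl | rfl)
    · exact hg.adj _ (by omega)
    · exact (hg.adj _ (by omega)).symm

end Walks

/-! ### The zone around the middle of the gap -/

section Zones

variable {V : Type*} {G : SimpleGraph V} {ℓ k : ℕ} {c : ℤ → V} {x : V} {m : ℤ} {Z : Set V}

theorem HoleMap.close_of_not_isMajor (h : HoleMap G k c) {z : V} (hz : z ∉ Set.range c)
    (hmaj : ¬ IsMajor G (Set.range c) z) {i j : ℤ} (hij : i ≤ j) (hji : j < i + k)
    (hi : G.Adj z (c i)) (hj : G.Adj z (c j)) : j ≤ i + 2 ∨ i + k ≤ j + 2 := by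
  have h4 := h.four_le
  obtain ⟨n, hn⟩ := h.exists_window hz hmaj
  obtain ⟨i', h1, h2, hi'⟩ := h.exists_mem_Ico (n - 1) i
  obtain ⟨j', h3, h5, hj'⟩ := h.exists_mem_Ico (n - 1) j
  have h6 : i' ≤ n + 1 := by
    by_contra! hlt
    exact hn i' (by omega) (by omega) (hi' ▸ hi)
  have h7 : j' ≤ n + 1 := by
    by_contra! hlt
    exact hn j' (by omega) (by omega) (hj' ▸ hj)
  rw [h.eq_iff_dvd] at hi' hj'
  have := dvd_sub hi' hj'
  rw [dvd_iff_of_abs_lt (by omega) (by omega)] at this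
  omega

/-- `z` has a neighbour in the hole that is not near the gap. -/
def Touches (G : SimpleGraph V) (k : ℕ) (c : ℤ → V) (m : ℤ) (z : V) : Prop :=
  ∃ j, m + 2 ≤ j ∧ j ≤ k - 2 ∧ G.Adj z (c j)

/-- `Z` contains the middle part of the gap, but no vertices of the hole near the ends of the gap,
and its vertices off the hole are neither major nor adjacent to `x` nor to vertices of the hole
near the ends of the gap. -/
structure Zone (G : SimpleGraph V) (ℓ k : ℕ) (c : ℤ → V) (x : V) (m : ℤ) (Z : Set V) : Prop where
  arc_mem : ∀ i : ℤ, ℓ - 4 ≤ i → i ≤ m - ℓ + 4 → c i ∈ Z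
  hole_mem : ∀ i : ℤ, -2 ≤ i → i < k - 2 → c i ∈ Z →
    ℓ - 4 ≤ i ∧ i ≤ m - ℓ + 4 ∨ m + 3 ≤ i
  unhit : ∀ z ∈ Z, z ∉ Set.range c → Unhit G ℓ c m z
  not_adj : ∀ z ∈ Z, z ∉ Set.range c → ¬ G.Adj x z
  not_major : ∀ z ∈ Z, z ∉ Set.range c → ¬ IsMajor G (Set.range c) z

namespace Zone

theorem adj_cases (hZ : Zone G ℓ k c x m Z) {z : V} (hz : z ∈ Z)
    (hzc : z ∉ Set.range c) {i : ℤ} (h1 : -1 ≤ i) (h2 : i < k - 1) (hi : G.Adj z (c i)) :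
    ℓ - 4 ≤ i ∧ i ≤ m - ℓ + 4 ∨ m + 2 ≤ i ∧ i ≤ k - 2 := by
  have hu := hZ.unhit z hz hzc
  by_contra! hno
  by_cases e1 : i ≤ ℓ - 5
  · exact hu.1 i h1 e1 hi
  by_cases e2 : m + 2 ≤ i
  · have := hno.2 e2; omega
  · exact hu.2 i (by have := hno.1 (by omega); omega) (by omega) hi

/-- A vertex of the hole in a zone lies in the middle part of the gap or touches the rest of the
hole. -/
theorem mem_cases (h : HoleMap G k c) (hZ : Zone G ℓ k c x m Z) {z : V} (hz : z ∈ Z)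
    (hzc : z ∈ Set.range c) :
    (∃ i : ℤ, ℓ - 4 ≤ i ∧ i ≤ m - ℓ + 4 ∧ z = c i) ∨
      ∃ i : ℤ, m + 3 ≤ i ∧ i ≤ k - 3 ∧ z = c i := by
  obtain ⟨i, rfl⟩ := hzc
  obtain ⟨j, h1, h2, e⟩ := h.exists_mem_Ico (-2) i
  rw [← e] at hz ⊢
  rcases hZ.hole_mem j h1 (by omega) hz with h3 | h3
  exacts [.inl ⟨j, h3.1, h3.2, rfl⟩, .inr ⟨j, h3, by omega, rfl⟩]

theorem touches_of_mem (h : HoleMap G k c) {i : ℤ} (h1 : m + 3 ≤ i) (h2 : i ≤ k - 3) :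
    Touches G k c m (c i) :=
  ⟨i + 1, by omega, by omega, by rw [h.adj_iff] <;> have := h.four_le <;> omega⟩

/-- The part of a zone that does not touch the rest of the hole contains no shortcut from one end of
the middle part of the gap to the other: such a shortcut would form an even hole with `x` or with
the rest of the hole. -/
theorem le_of_reach_ends (H : ShortestHole G ℓ k c) (M : LargestGap G ℓ k c x m)
    (hZ : Zone G ℓ k c x m Z) {n : ℕ}
    (hn : Reach G {z | z ∈ Z ∧ ¬ Touches G k c m z} n (c (ℓ - 4)) (c (m - ℓ + 4))) :
    m - 2 * ℓ + 8 ≤ n := by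
  obtain ⟨g, n', hn', hg, hgS, hg0, hgn⟩ := hn.exists_indPath
  by_contra! hlt
  have h6 := H.six_le
  have hk := H.lt_length
  have hlarge := M.large
  have hmk := M.add_lt H
  have hodd := M.odd H
  have hke := H.even_length
  have hx := M.notMem
  have hh := H.hole
  have hpos : 0 < n' := by
    by_contra h0
    obtain rfl : n' = 0 := by omega
    rw [hg0, hh.eq_iff] at hgn <;> omega
  have hcases : ∀ j ≤ n', g j ∉ Set.range c ∨
      ∃ i : ℤ, ℓ - 4 ≤ i ∧ i ≤ m - ℓ + 4 ∧ g j = c i ∧ (i = ℓ - 4 ↔ j = 0) ∧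
        (i = m - ℓ + 4 ↔ j = n') := by
    intro j hj
    by_cases hjc : g j ∈ Set.range c
    · right
      rcases hZ.mem_cases hh (hgS j hj).1 hjc with ⟨i, h1, h2, e⟩ | ⟨i, h1, h2, e⟩
      · refine ⟨i, h1, h2, e, ⟨fun e' => ?_, fun e' => ?_⟩, fun e' => ?_, fun e' => ?_⟩
        · rw [e', ← hg0] at e
          exact (hg j 0 hj (by omega)).1 e
        · rw [e', hg0, hh.eq_iff] at e <;> omega
        · rw [e', ← hgn] at e
          exact (hg j n' hj le_rfl).1 e
        · rw [e', hgn, hh.eq_iff] at e <;> omega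
      · exact absurd (e ▸ touches_of_mem hh h1 h2) (hgS j hj).2
    · exact .inl hjc
  have key : ∀ j ≤ n', ∀ t : ℤ, m - ℓ + 4 < t → t < ℓ - 4 + k →
      g j ≠ c t ∧ (G.Adj (g j) (c t) ↔ j = 0 ∧ t = ℓ - 5 + k ∨ j = n' ∧ t = m - ℓ + 5) := by
    intro j hj t h1 h2
    rcases hcases j hj with hjc | ⟨i, h3, h4, e, e0, en⟩
    · refine ⟨fun e => hjc ⟨_, e.symm⟩, iff_of_false (fun hadj => ?_) ?_⟩
      · obtain ⟨s, hs1, hs2, hs⟩ := hh.exists_mem_Ico (-1) t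
        have hts := (hh.eq_iff (by omega) (by omega)).1 hs
        rw [← hs] at hadj
        rcases hZ.adj_cases (hgS j hj).1 hjc hs1 (by omega) hadj with h | h
        · omega
        · exact (hgS j hj).2 ⟨s, h.1, h.2, hadj⟩
      · rintro (⟨rfl, -⟩ | ⟨rfl, -⟩)
        exacts [hjc ⟨_, hg0.symm⟩, hjc ⟨_, hgn.symm⟩]
    · rw [e]
      refine ⟨by rw [Ne, hh.eq_iff] <;> omega, ?_⟩
      rw [hh.adj_iff] <;> omega
  have hxg : ∀ j ≤ n', x ≠ g j ∧ ¬ G.Adj x (g j) := by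
    intro j hj
    rcases hcases j hj with hjc | ⟨i, h3, h4, e, e0, en⟩
    · refine ⟨fun e => ?_, hZ.not_adj _ (hgS j hj).1 hjc⟩
      have := (hZ.unhit _ (hgS j hj).1 hjc).1 0 (by omega) (by omega)
      rw [← e, M.adj_iff 0 le_rfl (by omega)] at this
      simp at this
    · rw [e]
      exact ⟨fun e => hx ⟨_, e.symm⟩, by rw [M.adj_iff _ (by omega) (by omega)]; omega⟩
  obtain ⟨q, hq⟩ : ∃ q, ℓ = q + 5 := ⟨ℓ - 5, by omega⟩
  have hxl : ∀ i : ℕ, i ≤ q → (G.Adj x (c (k + 1 * i)) ↔ i = 0) := by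
    intro i hi
    rw [add_comm, hh.add_period, M.adj_iff _ (by omega) (by omega)]; omega
  rcases Nat.even_or_odd n' with he | ho
  · -- an even shortcut, the two outer parts of the gap, and `x`
    have h1 : IndPath G (glue g n' fun i => c (m - ℓ + 5 + 1 * i)) (n' + q + 1) :=
      hg.append (hh.indPath_arc (by omega) _ (.inl rfl))
        (fun j hj i hi => (key j hj _ (by omega) (by omega)).1)
        fun j hj i hi => by rw [(key j hj _ (by omega) (by omega)).2]; omega
    have h2 : IndPath G (glue (fun i => c (k + 1 * i)) q
        (glue g n' fun i => c (m - ℓ + 5 + 1 * i))) (q + (n' + q + 1) + 1) := by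
      refine (hh.indPath_arc (by omega) _ (.inl rfl)).append h1 (fun i hi j hj => ?_)
        fun i hi j hj => ?_
      · rcases glue_cases (f := g) (g := fun i : ℕ => c (m - ℓ + 5 + 1 * i)) (n := n') (m := q) hj
          with ⟨hj, e⟩ | ⟨j, hj, rfl, e⟩ <;> rw [e]
        · exact (key j hj _ (by omega) (by omega)).1.symm
        · rw [Ne, hh.eq_iff] <;> omega
      · rcases glue_cases (f := g) (g := fun i : ℕ => c (m - ℓ + 5 + 1 * i)) (n := n') (m := q) hj
          with ⟨hj, e⟩ | ⟨j, hj, rfl, e⟩ <;> rw [e]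
        · rw [G.adj_comm, (key j hj _ (by omega) (by omega)).2]; omega
        · rw [hh.adj_iff] <;> omega
    have hex := h2.exists_hole (s := x) (by omega) (fun i hi => ?_) fun i hi => ?_
    · obtain ⟨C, hC⟩ := hex
      have := H.min C _ hC (by rw [Nat.even_iff] at he ⊢; omega) (by omega)
      omega
    · rcases glue_cases (f := fun i : ℕ => c (k + 1 * i))
        (g := glue g n' fun i : ℕ => c (m - ℓ + 5 + 1 * i)) (n := q) (m := n' + q + 1) hi
          with ⟨hi, e⟩ | ⟨i', hi', rfl, e⟩ <;> rw [e]
      · exact fun e => hx ⟨_, e.symm⟩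
      · rcases glue_cases (f := g) (g := fun i : ℕ => c (m - ℓ + 5 + 1 * i)) (n := n') (m := q) hi'
          with ⟨hj, e⟩ | ⟨j, hj, rfl, e⟩ <;> rw [e]
        · exact (hxg _ hj).1
        · exact fun e => hx ⟨_, e.symm⟩
    · rcases glue_cases (f := fun i : ℕ => c (k + 1 * i))
        (g := glue g n' fun i : ℕ => c (m - ℓ + 5 + 1 * i)) (n := q) (m := n' + q + 1) hi
          with ⟨hi, e⟩ | ⟨i', hi', rfl, e⟩ <;> rw [e]
      · rw [hxl i hi]; omega
      · rcases glue_cases (f := g) (g := fun i : ℕ => c (m - ℓ + 5 + 1 * i)) (n := n') (m := q) hi'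
          with ⟨hj, e⟩ | ⟨j, hj, rfl, e⟩ <;> rw [e]
        · exact iff_of_false (hxg _ hj).2 (by omega)
        · rw [M.adj_iff _ (by omega) (by omega)]; omega
  · -- an odd shortcut and the rest of the hole
    obtain ⟨r, hr⟩ : ∃ r : ℕ, (k : ℤ) + 2 * ℓ - 11 - m = r :=
      ⟨((k : ℤ) + 2 * ℓ - 11 - m).toNat, by omega⟩
    have h1 : IndPath G (glue g n' fun i => c (m - ℓ + 5 + 1 * i)) (n' + r + 1) :=
      hg.append (hh.indPath_arc (by omega) _ (.inl rfl))
        (fun j hj i hi => (key j hj _ (by omega) (by omega)).1)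
        fun j hj i hi => by rw [(key j hj _ (by omega) (by omega)).2]; omega
    have hex := h1.exists_hole (s := c (ℓ - 5 + k)) (by omega) (fun i hi => ?_)
      fun i hi => ?_
    · obtain ⟨C, hC⟩ := hex
      rw [Nat.even_iff] at hke
      rw [Nat.odd_iff] at ho
      rw [Int.not_even_iff] at hodd
      have := H.min C _ hC (by rw [Nat.even_iff]; omega) (by omega)
      omega
    · rcases glue_cases (f := g) (g := fun i : ℕ => c (m - ℓ + 5 + 1 * i)) (n := n') (m := r) hi
          with ⟨hj, e⟩ | ⟨j, hj, rfl, e⟩ <;> rw [e]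
      · exact (key _ hj _ (by omega) (by omega)).1.symm
      · rw [Ne, hh.eq_iff] <;> omega
    · rcases glue_cases (f := g) (g := fun i : ℕ => c (m - ℓ + 5 + 1 * i)) (n := n') (m := r) hi
          with ⟨hj, e⟩ | ⟨j, hj, rfl, e⟩ <;> rw [e]
      · rw [G.adj_comm, (key _ hj _ (by omega) (by omega)).2]; omega
      · rw [hh.adj_iff] <;> omega

end Zone
end Zones

section Zones

variable {V : Type*} {G : SimpleGraph V} {ℓ k : ℕ} {c : ℤ → V} {x : V} {m : ℤ} {Z : Set V}

namespace Zone

theorem not_touches_arc (H : ShortestHole G ℓ k c) (M : LargestGap G ℓ k c x m) {i : ℤ}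
    (h1 : ℓ - 4 ≤ i) (h2 : i ≤ m - ℓ + 4) : ¬ Touches G k c m (c i) := by
  rintro ⟨j, h3, h4, h5⟩
  have h6 := H.six_le
  have := M.add_lt H
  rw [H.hole.adj_iff] at h5 <;> omega

theorem reach_arc (H : ShortestHole G ℓ k c) (M : LargestGap G ℓ k c x m)
    (hZ : Zone G ℓ k c x m Z) {i j : ℤ} {n : ℕ} (hn : j = i + n) (h1 : ℓ - 4 ≤ i)
    (h2 : j ≤ m - ℓ + 4) : Reach G {z | z ∈ Z ∧ ¬ Touches G k c m z} n (c i) (c j) := by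
  subst hn
  have h6 := H.six_le
  have := M.add_lt H
  refine ⟨fun t => c (i + t), ⟨fun t ht => ?_, fun t ht => ⟨hZ.arc_mem _ (by omega) (by omega),
    not_touches_arc H M (by omega) (by omega)⟩⟩, by simp, rfl⟩
  rw [H.hole.adj_iff] <;> omega

/-- Nor does it contain a shortcut between other vertices of the middle part of the gap. -/
theorem le_of_reach (H : ShortestHole G ℓ k c) (M : LargestGap G ℓ k c x m)
    (hZ : Zone G ℓ k c x m Z) {i j : ℤ} {n : ℕ} (hi : ℓ - 4 ≤ i) (hi' : i ≤ m - ℓ + 4)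
    (hj : ℓ - 4 ≤ j) (hj' : j ≤ m - ℓ + 4)
    (hn : Reach G {z | z ∈ Z ∧ ¬ Touches G k c m z} n (c i) (c j)) : j - i ≤ n := by
  have h1 := hZ.reach_arc H M (i := ℓ - 4) (j := i) (n := (i - (ℓ - 4)).toNat) (by omega)
    le_rfl hi'
  have h2 := hZ.reach_arc H M (i := j) (j := m - ℓ + 4) (n := (m - ℓ + 4 - j).toNat) (by omega)
    hj le_rfl
  have := hZ.le_of_reach_ends H M ((h1.trans hn).trans h2)
  omega

/-- A walk in the zone that starts in the middle part of the gap and touches the rest of the hole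
at its end is long, as it contains a bridge. -/
theorem le_of_touches (H : ShortestHole G ℓ k c) (M : LargestGap G ℓ k c x m)
    (hZ : Zone G ℓ k c x m Z) {f : ℕ → V} {r : ℕ} {s : ℤ} (hf : WalkIn G Z f r)
    (hs : ℓ - 4 ≤ s) (hs' : s ≤ m - ℓ + 4) (hf0 : f 0 = c s) (hr : Touches G k c m (f r))
    (hlt : ∀ i < r, ¬ Touches G k c m (f i)) : m - s ≤ r + 1 ∨ s ≤ r + 1 := by
  classical
  have h6 := H.six_le
  have hk := H.lt_length
  have hlarge := M.large
  have hmk := M.add_lt H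
  have hh := H.hole
  have hr0 : 0 < r := by
    by_contra h0
    obtain rfl : r = 0 := by omega
    exact not_touches_arc H M hs hs' (hf0 ▸ hr)
  have hrc : f r ∉ Set.range c := by
    intro hc
    rcases hZ.mem_cases hh (hf.mem r le_rfl) hc with ⟨i, h1, h2, e⟩ | ⟨i, h1, h2, e⟩
    · exact not_touches_arc H M h1 h2 (e ▸ hr)
    · have := hf.adj (r - 1) (by omega)
      rw [show r - 1 + 1 = r by omega, e] at this
      exact hlt (r - 1) (by omega) ⟨i, by omega, by omega, this⟩
  have htwo : ∀ z ∈ Z, z ∉ Set.range c → ∀ i j : ℤ, ℓ - 4 ≤ i → i ≤ m - ℓ + 4 → m + 2 ≤ j →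
      j ≤ k - 2 → G.Adj z (c i) → G.Adj z (c j) → False := by
    intro z hz hzc i j h1 h2 h3 h4 hi hj
    have := hh.close_of_not_isMajor hzc (hZ.not_major z hz hzc) (by omega) (by omega) hi hj
    omega
  -- the last vertex of the walk in the hole, and then the last vertex with a neighbour in the gap
  obtain ⟨r₀, h0, h1, ⟨h2, -⟩, h3⟩ := exists_max_int (a := 0) (b := r)
    (P := fun i => f i.toNat ∈ Set.range c ∧ i < r) ⟨0, le_rfl, by omega, ⟨_, hf0.symm⟩, by omega⟩
  obtain ⟨r₀, rfl⟩ := Int.eq_ofNat_of_zero_le h0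
  simp only [Int.toNat_natCast] at h2
  have hoff : ∀ i : ℕ, r₀ < i → i ≤ r → f i ∉ Set.range c := by
    intro i hi hir hc
    rcases hir.eq_or_lt with rfl | hir
    · exact hrc hc
    · exact h3 i (by omega) (by omega) ⟨by simpa using hc, by omega⟩
  have hr₀ : r₀ < r := by
    rcases Nat.lt_or_ge r₀ r with h | h
    · exact h
    · obtain rfl : r₀ = r := by omega
      exact absurd h2 hrc
  have hnear : ∃ i : ℤ, ℓ - 4 ≤ i ∧ i ≤ m - ℓ + 4 ∧ G.Adj (f (r₀ + 1)) (c i) := by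
    rcases hZ.mem_cases hh (hf.mem r₀ (by omega)) h2 with ⟨i, h4, h5, e⟩ | ⟨i, h4, h5, e⟩
    · exact ⟨i, h4, h5, e ▸ (hf.adj r₀ hr₀).symm⟩
    · exact absurd (e ▸ touches_of_mem hh h4 h5) (hlt r₀ hr₀)
  obtain ⟨r₁, h4, h5, ⟨i, hi1, hi2, hi⟩, h7⟩ := exists_max_int (a := (r₀ + 1 : ℕ)) (b := r)
    (P := fun i => ∃ j : ℤ, ℓ - 4 ≤ j ∧ j ≤ m - ℓ + 4 ∧ G.Adj (f i.toNat) (c j))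
    ⟨(r₀ + 1 : ℕ), le_rfl, by omega, by simpa using hnear⟩
  obtain ⟨r₁, rfl⟩ := Int.eq_ofNat_of_zero_le (by omega : 0 ≤ r₁)
  simp only [Int.toNat_natCast] at hi
  obtain ⟨t, ht1, ht2, ht⟩ := hr
  have hr₁ : r₁ < r := by
    rcases Nat.lt_or_ge r₁ r with h | h
    · exact h
    · obtain rfl : r₁ = r := by omega
      exact (htwo _ (hf.mem r₁ le_rfl) hrc i t hi1 hi2 ht1 ht2 hi ht).elim
  have hr₁c := hoff r₁ (by omega) (by omega)
  -- the windows of the two ends of the bridge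
  obtain ⟨a, ha1, ha2, ha, hamin⟩ := exists_min_int (P := fun i => G.Adj (f r₁) (c i))
    ⟨i, hi1, hi2, hi⟩
  obtain ⟨b, hb1, hb2, hb, hbmax⟩ := exists_max_int (P := fun i => G.Adj (f r₁) (c i))
    ⟨i, hi1, hi2, hi⟩
  obtain ⟨a', ha1', ha2', ha', hamin'⟩ := exists_min_int (P := fun i => G.Adj (f r) (c i))
    ⟨t, ht1, ht2, ht⟩
  obtain ⟨b', hb1', hb2', hb', hbmax'⟩ := exists_max_int (P := fun i => G.Adj (f r) (c i))
    ⟨t, ht1, ht2, ht⟩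
  have hab : a ≤ b := by
    by_contra! hlt
    exact hamin b hb1 hlt hb
  have hab' : a' ≤ b' := by
    by_contra! hlt
    exact hamin' b' hb1' hlt hb'
  have hw := hh.close_of_not_isMajor hr₁c (hZ.not_major _ (hf.mem _ (by omega)) hr₁c) hab
    (by omega) ha hb
  have hw' := hh.close_of_not_isMajor hrc (hZ.not_major _ (hf.mem _ le_rfl) hrc) hab'
    (by omega) ha' hb'
  have hwalk : Reach G {z | ∃ i, r₁ ≤ i ∧ i ≤ r ∧ z = f i} (r - r₁) (f r₁) (f r) :=
    ⟨fun i => f (r₁ + i), (hf.shift r₁ (m := r - r₁) (by omega)).mono le_rfl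
      fun i hi => ⟨_, by omega, by omega, rfl⟩, rfl, congrArg f (by omega)⟩
  obtain ⟨g, n, hn, hg, hgS, hg0, hgn⟩ := hwalk.exists_indPath
  have hpos : 0 < n := by
    by_contra h0
    obtain rfl : n = 0 := by omega
    rw [hg0] at hgn
    exact htwo _ (hf.mem r₁ (by omega)) hr₁c i t hi1 hi2 ht1 ht2 hi (hgn ▸ ht)
  have norm : ∀ z ∈ Z, z ∉ Set.range c → ∀ i : ℤ, G.Adj z (c i) → ∃ j : ℤ,
      (ℓ - 4 ≤ j ∧ j ≤ m - ℓ + 4 ∨ m + 2 ≤ j ∧ j ≤ k - 2) ∧ G.Adj z (c j) ∧ c j = c i := by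
    intro z hz hzc i hi
    obtain ⟨j, h1, h2, e⟩ := hh.exists_mem_Ico (-1) i
    exact ⟨j, hZ.adj_cases hz hzc h1 (by omega) (e ▸ hi), e ▸ hi, e⟩
  have B : Bridge G ℓ k c g n a b a' b' := by
    refine ⟨h6, hg, hpos, fun i hi => ?_, fun i hi hin j hj => ?_, hg0 ▸ ha, hg0 ▸ hb,
      fun i h1 h2 hi => ?_, hgn ▸ ha', hgn ▸ hb', fun i h1 h2 hi => ?_, hab, by omega, hab',
      by omega, by omega, by omega⟩
    · obtain ⟨j, h1, h2, e⟩ := hgS i hi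
      exact e ▸ hoff j (by omega) h2
    · obtain ⟨q, h1, h2, e⟩ := hgS i hin.le
      have hqr₁ : q ≠ r₁ := by
        rintro rfl
        have := (hg i 0 hin.le (by omega)).1 (e.trans hg0.symm)
        omega
      have hqr : q ≠ r := by
        rintro rfl
        have := (hg i n hin.le le_rfl).1 (e.trans hgn.symm)
        omega
      rw [e] at hj
      obtain ⟨j', h | h, hj', -⟩ := norm _ (hf.mem q h2) (hoff q (by omega) h2) j hj
      · exact h7 q (by omega) (by omega) ⟨j', h.1, h.2, by simpa using hj'⟩
      · exact hlt q (by omega) ⟨j', h.1, h.2, hj'⟩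
    · rw [hg0] at hi
      obtain ⟨j, h | h, hj, e⟩ := norm _ (hf.mem r₁ (by omega)) hr₁c i hi
      · rw [hh.eq_iff (by omega) (by omega)] at e
        have h8 : ¬ j < a := fun hja => hamin j h.1 hja hj
        have h9 : ¬ b < j := fun hja => hbmax j hja h.2 hj
        omega
      · exact hlt r₁ hr₁ ⟨j, h.1, h.2, hj⟩
    · rw [hgn] at hi
      obtain ⟨j, h | h, hj, e⟩ := norm _ (hf.mem r le_rfl) hrc i hi
      · exact htwo _ (hf.mem r le_rfl) hrc j t h.1 h.2 ht1 ht2 hj ht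
      · rw [hh.eq_iff (by omega) (by omega)] at e
        have h8 : ¬ j < a' := fun hja => hamin' j h.1 hja hj
        have h9 : ¬ b' < j := fun hja => hbmax' j hja h.2 hj
        omega
  have hstart : Reach G {z | z ∈ Z ∧ ¬ Touches G k c m z} (r₁ + 1) (c s) (c a) := by
    have := (hf.mono (T := {z | z ∈ Z ∧ ¬ Touches G k c m z}) (m := r₁) (by omega)
      fun i hi => ⟨hf.mem i (by omega), hlt i (by omega)⟩).reach
    rw [hf0] at this
    exact this.succ ha ⟨hZ.arc_mem a ha1 ha2, not_touches_arc H M ha1 ha2⟩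
  have h8 := hZ.le_of_reach H M hs hs' ha1 ha2 hstart
  have h9 := hZ.le_of_reach H M ha1 ha2 hs hs' hstart.symm
  have h10 := B.le_length H
  push_cast at h8 h9
  omega

/-- A walk in the zone between two vertices of the middle part of the gap that is not longer than
the segment between them, which is at most about half of the gap, touches nothing else. -/
theorem not_touches (H : ShortestHole G ℓ k c) (M : LargestGap G ℓ k c x m)
    (hZ : Zone G ℓ k c x m Z) {f : ℕ → V} {n : ℕ} {s s' : ℤ} (hf : WalkIn G Z f n)
    (hs : ℓ - 4 ≤ s) (hss : s ≤ s') (hs' : s' ≤ m - ℓ + 4) (hm : 2 * (s' - s) + 2 < m)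
    (hf0 : f 0 = c s) (hfn : f n = c s') (hn : n ≤ s' - s) {i : ℕ} (hi : i ≤ n) :
    ¬ Touches G k c m (f i) := by
  intro hti
  have h6 := H.six_le
  -- the walk up to its first vertex that touches, and the walk back to its last one
  obtain ⟨r, h1, h2, h3, h4⟩ := exists_min_int (a := 0) (b := n)
    (P := fun i => Touches G k c m (f i.toNat)) ⟨i, by omega, by omega, by simpa using hti⟩
  obtain ⟨r', h1', h2', h3', h4'⟩ := exists_max_int (a := 0) (b := n)
    (P := fun i => Touches G k c m (f i.toNat)) ⟨i, by omega, by omega, by simpa using hti⟩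
  obtain ⟨r, rfl⟩ := Int.eq_ofNat_of_zero_le h1
  obtain ⟨r', rfl⟩ := Int.eq_ofNat_of_zero_le h1'
  simp only [Int.toNat_natCast] at h3 h3'
  have hrr : r ≤ r' := by
    by_contra! hlt
    exact h4 r' h1' (by omega) (by simpa using h3')
  have e1 := hZ.le_of_touches H M (hf.mono (by omega) fun i hi => hf.mem i (by omega)) hs
    (by omega) hf0 h3 fun i hi h => h4 i (by omega) (by omega) (by simpa using h)
  have e2 := hZ.le_of_touches H M (f := fun i => f (n - i)) (r := n - r') (s := s')
    (hf.reverse.mono (by omega) fun i hi => hf.mem _ (by omega)) (by omega) hs'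
    (by simpa using hfn) (by rwa [show n - (n - r') = r' by omega])
    fun i hi h => h4' (n - i : ℕ) (by omega) (by omega) (by simpa using h)
  omega

/-- Distances in the whole zone agree with those along the gap, up to half of its length. -/
theorem le_of_reach_zone (H : ShortestHole G ℓ k c) (M : LargestGap G ℓ k c x m)
    (hZ : Zone G ℓ k c x m Z) {n : ℕ} {s s' : ℤ} (hs : ℓ - 4 ≤ s) (hss : s ≤ s')
    (hs' : s' ≤ m - ℓ + 4) (hm : 2 * (s' - s) + 2 < m) (hn : Reach G Z n (c s) (c s')) :
    s' - s ≤ n := by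
  by_contra! hlt
  obtain ⟨f, hf, hf0, hfn⟩ := hn
  have := hZ.le_of_reach H M hs (by omega) (by omega) hs'
    ⟨f, hf.mono le_rfl fun i hi => ⟨hf.mem i hi,
      hZ.not_touches H M hf hs hss hs' hm hf0 hfn hlt.le hi⟩, hf0, hfn⟩
  omega

/-- A vertex on a shortest path in the zone, between vertices of the gap that are not too far apart,
has no neighbours in the rest of the hole. -/
theorem not_touches_of_reach (H : ShortestHole G ℓ k c) (M : LargestGap G ℓ k c x m)
    (hZ : Zone G ℓ k c x m Z) {n n' : ℕ} {s s' : ℤ} (hs : ℓ - 4 ≤ s) (hss : s ≤ s')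
    (hs' : s' ≤ m - ℓ + 4) (hm : 2 * (s' - s) + 2 < m) {z : V} (hn : Reach G Z n (c s) z)
    (hn' : Reach G Z n' z (c s')) (hnn : (n + n' : ℕ) ≤ s' - s) : ¬ Touches G k c m z := by
  obtain ⟨f, hf, hf0, rfl, hfn⟩ := hn.exists_through hn'
  exact hZ.not_touches H M hf hs hss hs' hm hf0 hfn hnn (by omega)

end Zone
end Zones

/-! ### Tuples of vertices that mark the major vertices -/

section Marks

variable {V : Type*} {G : SimpleGraph V} {ℓ k : ℕ} {c : ℤ → V} {x y : V} {m p L : ℤ} {N : ℕ}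

/-- The tuple `τ` of `4ℓ - 2` vertices assigns roles to vertices by their index: below `4ℓ - 4`
there are vertices of the hole, of which those from `4` to `4ℓ - 10` are hitters and those from
`3ℓ - 6` are vertices allowed in the zone (the last three of them are sources for distances). The
last two entries are the excluders. The zone of `τ` consists of the allowed vertices and of all
vertices outside the first `4ℓ - 4` entries that are adjacent to no hitter and no excluder. -/
def zone (G : SimpleGraph V) (ℓ : ℕ) (τ : ℕ → V) : Set V :=
  {v | ((∀ j < 4 * ℓ - 4, v ≠ τ j) ∧ (∀ j, 4 ≤ j → j < 4 * ℓ - 9 → ¬ G.Adj v (τ j)) ∧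
    ¬ G.Adj v (τ (4 * ℓ - 4)) ∧ ¬ G.Adj v (τ (4 * ℓ - 3))) ∨
    ∃ j, 3 * ℓ - 6 ≤ j ∧ j < 4 * ℓ - 4 ∧ v = τ j}

/-- `v` is not among the first `4ℓ - 4` entries of `τ`, and it is adjacent to a hitter, or to an
excluder and a vertex of `D`. -/
def Marked (G : SimpleGraph V) (ℓ : ℕ) (τ : ℕ → V) (D : V → Prop) (v : V) : Prop :=
  (∀ j < 4 * ℓ - 4, v ≠ τ j) ∧ ((∃ j, 4 ≤ j ∧ j < 4 * ℓ - 9 ∧ G.Adj v (τ j)) ∨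
    (∃ z, D z ∧ G.Adj v z) ∧ (G.Adj v (τ (4 * ℓ - 4)) ∨ G.Adj v (τ (4 * ℓ - 3))))

/-- `d` is the distance from `u` inside `Z`, cut off at `N`. -/
structure IsDist (G : SimpleGraph V) (Z : Set V) (N : ℕ) (u : V) (d : V → ℕ) : Prop where
  reach : ∀ v, d v < N → Reach G Z (d v) u v
  le_of_reach : ∀ v n, Reach G Z n u v → d v ≤ n

/-- `z` lies on a shortest path between the first and the second or between the second and the third
source of `τ`, according to the distances `d₁, d₂, d₃` from these sources. -/
def Between (ℓ : ℕ) (τ : ℕ → V) (d₁ d₂ d₃ : V → ℕ) (z : V) : Prop :=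
  d₁ z + d₂ z ≤ d₁ (τ (4 * ℓ - 6)) ∨ d₂ z + d₃ z ≤ d₂ (τ (4 * ℓ - 5))

/-- The vertices marked by `τ` comprise all major vertices and no vertices of the hole. -/
def MarksMajors (G : SimpleGraph V) (ℓ : ℕ) (C : Set V) (N : ℕ) (τ : ℕ → V) : Prop :=
  ∀ d₁ d₂ d₃, IsDist G (zone G ℓ τ) N (τ (4 * ℓ - 7)) d₁ →
    IsDist G (zone G ℓ τ) N (τ (4 * ℓ - 6)) d₂ → IsDist G (zone G ℓ τ) N (τ (4 * ℓ - 5)) d₃ →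
    (∀ v, IsMajor G C v → Marked G ℓ τ (Between ℓ τ d₁ d₂ d₃) v) ∧
      ∀ v ∈ C, ¬ Marked G ℓ τ (Between ℓ τ d₁ d₂ d₃) v

/-- If all major vertices have neighbours in a short arc, its vertices can be used as hitters. -/
theorem ShortestHole.exists_marksMajors_of_short (H : ShortestHole G ℓ k c) {m : ℤ} (h0 : 0 ≤ m)
    (hm : m ≤ 2 * ℓ - 6)
    (hall : ∀ v, IsMajor G (Set.range c) v → ∃ i, 0 ≤ i ∧ i ≤ m ∧ G.Adj v (c i)) :
    ∃ τ, MarksMajors G ℓ (Set.range c) N τ := by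
  have h6 := H.six_le
  have hk := H.lt_length
  let τ : ℕ → V := fun j =>
    if j = 0 then c (-1) else if j = 1 then c (m + 1) else c (Min.min (j - 4 : ℕ) m)
  have hτ : ∀ j, 2 ≤ j → ∃ i, 0 ≤ i ∧ i ≤ m ∧ τ j = c i := fun j hj =>
    ⟨Min.min (j - 4 : ℕ) m, by omega, by omega, by
      simp only [τ, if_neg (show j ≠ 0 by omega), if_neg (show j ≠ 1 by omega)]⟩
  have hball : ∀ i, -1 ≤ i → i ≤ m + 1 → ∃ j < 4 * ℓ - 4, τ j = c i := by
    intro i h1 h2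
    by_cases e1 : i = -1
    · exact ⟨0, by omega, by simp [τ, e1]⟩
    by_cases e2 : i = m + 1
    · exact ⟨1, by omega, by simp [τ, e2]⟩
    refine ⟨4 + i.toNat, by omega, ?_⟩
    simp only [τ, if_neg (show 4 + i.toNat ≠ 0 by omega), if_neg (show 4 + i.toNat ≠ 1 by omega)]
    congr 1
    omega
  have hadj : ∀ v ∈ Set.range c, ∀ j, 2 ≤ j → G.Adj v (τ j) → ∃ j < 4 * ℓ - 4, v = τ j := by
    rintro _ ⟨i, rfl⟩ j hj hadj
    obtain ⟨i', h1, h2, e⟩ := hτ j hj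
    obtain ⟨i₀, h3, h4, e₀⟩ := H.hole.exists_mem_Ico (-1) i
    rw [← e₀] at hadj ⊢
    rw [e, H.hole.adj_iff (by omega) (by omega)] at hadj
    rcases le_or_gt i₀ (m + 1) with h5 | h5
    · obtain ⟨j, hj, e⟩ := hball i₀ h3 h5
      exact ⟨j, hj, e.symm⟩
    · omega
  refine ⟨τ, fun d₁ d₂ d₃ _ _ _ => ⟨fun v hv => ⟨fun j _ e => ?_, .inl ?_⟩, ?_⟩⟩
  · refine hv.1 (e ▸ ?_)
    simp only [τ]
    split_ifs <;> exact ⟨_, rfl⟩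
  · obtain ⟨i, h1, h2, hi⟩ := hall v hv
    refine ⟨4 + i.toNat, by omega, by omega, ?_⟩
    simp only [τ, if_neg (show 4 + i.toNat ≠ 0 by omega), if_neg (show 4 + i.toNat ≠ 1 by omega)]
    rwa [show Min.min ((4 + i.toNat - 4 : ℕ) : ℤ) m = i by omega]
  · rintro v hv ⟨h1, ⟨j, h2, -, h3⟩ | ⟨-, h3 | h3⟩⟩
    all_goals
      obtain ⟨j, hj, e⟩ := hadj v hv _ (by omega) h3
      exact h1 j hj e

/-- The positions in the hole of the first `4ℓ - 4` vertices of a tuple. -/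
def position (ℓ : ℕ) (m p L : ℤ) (j : ℕ) : ℤ :=
  if j = 0 then -2
  else if j = 1 then m + 2
  else if j = 2 then L - ℓ + 5
  else if j = 3 then L + 2
  else if j < ℓ + 1 then j - 5
  else if j < 2 * ℓ - 2 then m - 2 * ℓ + 4 + j
  else if j < 3 * ℓ - 6 then L - 3 * ℓ + 8 + j
  else if j < 4 * ℓ - 9 then min (p + j - 3 * ℓ + 6) (m - ℓ + 4)
  else if j = 4 * ℓ - 9 then max (p - 1) (ℓ - 4)
  else if j = 4 * ℓ - 8 then min (p + ℓ - 3) (m - ℓ + 4)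
  else if j = 4 * ℓ - 7 then ℓ - 4
  else if j = 4 * ℓ - 6 then m / 2
  else m - ℓ + 4

/-- The tuple for the largest gap. -/
def tuple (ℓ : ℕ) (c : ℤ → V) (x y : V) (m p L : ℤ) (j : ℕ) : V :=
  if j < 4 * ℓ - 4 then c (position ℓ m p L j) else if j = 4 * ℓ - 4 then x else y

theorem position_allowed (h6 : 6 ≤ ℓ) (hm : 2 * (ℓ : ℤ) - 5 ≤ m) (hp : ℓ - 4 ≤ p)
    (hp' : p ≤ m - ℓ + 3) {j : ℕ} (h1 : 3 * ℓ - 6 ≤ j) :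
    ℓ - 4 ≤ position ℓ m p L j ∧ position ℓ m p L j ≤ m - ℓ + 4 := by
  unfold position
  omega

theorem position_hitter (h6 : 6 ≤ ℓ) (hm : 2 * (ℓ : ℤ) - 5 ≤ m) (hp : ℓ - 4 ≤ p)
    (hp' : p ≤ m - ℓ + 3) {j : ℕ} (h1 : 4 ≤ j) (h2 : j < 4 * ℓ - 9) :
    (-1 ≤ position ℓ m p L j ∧ position ℓ m p L j ≤ ℓ - 5) ∨
    (m - ℓ + 5 ≤ position ℓ m p L j ∧ position ℓ m p L j ≤ m + 1) ∨
    (L - ℓ + 6 ≤ position ℓ m p L j ∧ position ℓ m p L j ≤ L + 1) ∨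
    (p ≤ position ℓ m p L j ∧ position ℓ m p L j ≤ p + ℓ - 4 ∧
      position ℓ m p L j ≤ m - ℓ + 4) := by
  unfold position
  omega

theorem position_not_allowed (h6 : 6 ≤ ℓ) (hm : 2 * (ℓ : ℤ) - 5 ≤ m) {j : ℕ} (h1 : j < 3 * ℓ - 6) :
    (-2 ≤ position ℓ m p L j ∧ position ℓ m p L j ≤ ℓ - 5) ∨
    (m - ℓ + 5 ≤ position ℓ m p L j ∧ position ℓ m p L j ≤ m + 2) ∨
    (L - ℓ + 5 ≤ position ℓ m p L j ∧ position ℓ m p L j ≤ L + 2) := by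
  unfold position
  omega

theorem exists_hitter (h6 : 6 ≤ ℓ) (hm : 2 * (ℓ : ℤ) - 5 ≤ m) (hp : ℓ - 4 ≤ p)
    (hp' : p ≤ m - ℓ + 3) {i : ℤ} (hi : (-1 ≤ i ∧ i ≤ ℓ - 5) ∨ (m - ℓ + 5 ≤ i ∧ i ≤ m + 1) ∨
    (L - ℓ + 6 ≤ i ∧ i ≤ L + 1) ∨ (p ≤ i ∧ i ≤ p + ℓ - 4 ∧ i ≤ m - ℓ + 4)) :
    ∃ j, 4 ≤ j ∧ j < 4 * ℓ - 9 ∧ position ℓ m p L j = i := by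
  unfold position
  rcases hi with hi | hi | hi | hi
  · refine ⟨(i + 5).toNat, by omega, by omega, ?_⟩
    omega
  · refine ⟨(i - m + 2 * ℓ - 4).toNat, by omega, by omega, ?_⟩
    omega
  · refine ⟨(i - L + 3 * ℓ - 8).toNat, by omega, by omega, ?_⟩
    omega
  · refine ⟨(i - p + 3 * ℓ - 6).toNat, by omega, by omega, ?_⟩
    omega

theorem exists_allowed (h6 : 6 ≤ ℓ) (hm : 2 * (ℓ : ℤ) - 5 ≤ m) (hp : ℓ - 4 ≤ p)
    (hp' : p ≤ m - ℓ + 3) {i : ℤ} (hi : (p - 1 ≤ i ∧ i ≤ p + ℓ - 3 ∧ ℓ - 4 ≤ i ∧ i ≤ m - ℓ + 4) ∨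
    i = ℓ - 4 ∨ i = m / 2 ∨ i = m - ℓ + 4) :
    ∃ j, 3 * ℓ - 6 ≤ j ∧ j < 4 * ℓ - 4 ∧ position ℓ m p L j = i := by
  unfold position
  rcases hi with hi | rfl | rfl | rfl
  · by_cases e1 : i = p - 1
    · refine ⟨4 * ℓ - 9, by omega, by omega, ?_⟩
      omega
    by_cases e2 : i = p + ℓ - 3
    · refine ⟨4 * ℓ - 8, by omega, by omega, ?_⟩
      omega
    refine ⟨(i - p + 3 * ℓ - 6).toNat, by omega, by omega, ?_⟩
    omega
  · refine ⟨4 * ℓ - 7, by omega, by omega, ?_⟩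
    omega
  · refine ⟨4 * ℓ - 6, by omega, by omega, ?_⟩
    omega
  · refine ⟨4 * ℓ - 5, by omega, by omega, ?_⟩
    omega

theorem exists_ball (h6 : 6 ≤ ℓ) (hm : 2 * (ℓ : ℤ) - 5 ≤ m) (hp : ℓ - 4 ≤ p)
    (hp' : p ≤ m - ℓ + 3) {i : ℤ} (hi : (-2 ≤ i ∧ i ≤ ℓ - 5) ∨ (m - ℓ + 5 ≤ i ∧ i ≤ m + 2) ∨
    (L - ℓ + 5 ≤ i ∧ i ≤ L + 2) ∨ (p - 1 ≤ i ∧ i ≤ p + ℓ - 3 ∧ ℓ - 4 ≤ i ∧ i ≤ m - ℓ + 4) ∨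
    i = ℓ - 4 ∨ i = m - ℓ + 4) : ∃ j < 4 * ℓ - 4, position ℓ m p L j = i := by
  by_cases e0 : i = -2
  · exact ⟨0, by omega, by simp [position, e0]⟩
  by_cases e1 : i = m + 2
  · exact ⟨1, by omega, by simp [position, e1]⟩
  by_cases e2 : i = L - ℓ + 5
  · exact ⟨2, by omega, by simp [position, e2]⟩
  by_cases e3 : i = L + 2
  · exact ⟨3, by omega, by simp [position, e3]⟩
  by_cases e4 : (p - 1 ≤ i ∧ i ≤ p + ℓ - 3 ∧ ℓ - 4 ≤ i ∧ i ≤ m - ℓ + 4) ∨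
      i = ℓ - 4 ∨ i = m / 2 ∨ i = m - ℓ + 4
  · obtain ⟨j, -, h2, h3⟩ := exists_allowed (L := L) h6 hm hp hp' e4
    exact ⟨j, h2, h3⟩
  · obtain ⟨j, -, h2, h3⟩ := exists_hitter (L := L) (i := i) h6 hm hp hp' (by omega)
    exact ⟨j, by omega, h3⟩

end Marks

section Marks

variable {V : Type*} {G : SimpleGraph V} {ℓ k : ℕ} {c : ℤ → V} {x y : V} {m p L : ℤ} {N : ℕ}

/-- With hitters around the ends of the gap, around the neighbours of `y` in the gap and around
`c L`, the tuple marks all major vertices, provided that `x`, `y` and the hitters together are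
adjacent to all of them. -/
theorem LargestGap.marksMajors_tuple (H : ShortestHole G ℓ k c) (M : LargestGap G ℓ k c x m)
    (hN : k ≤ N) (hp : ℓ - 4 ≤ p) (hp' : p ≤ m - ℓ + 3) (hL : m + 2 ≤ L) (hL' : L + 5 ≤ k)
    (hy : IsMajor G (Set.range c) y)
    (hyp : ∀ i : ℤ, ℓ - 4 ≤ i → i ≤ m - ℓ + 4 → G.Adj y (c i) → i = p ∨ i = p + 1)
    (hy0 : G.Adj y (c 0) ∨ G.Adj y (c p))
    (hdom : ∀ u, IsMajor G (Set.range c) u → u ≠ x → u ≠ y → ¬ G.Adj x u → ¬ G.Adj y u →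
      Unhit G ℓ c m u → (∃ i, p ≤ i ∧ i ≤ p + ℓ - 4 ∧ i ≤ m - ℓ + 4 ∧ G.Adj u (c i)) ∨
        ∃ i, L - ℓ + 6 ≤ i ∧ i ≤ L + 1 ∧ G.Adj u (c i)) :
    MarksMajors G ℓ (Set.range c) N (tuple ℓ c x y m p L) := by
  have h6 := H.six_le
  have hk := H.lt_length
  have hm := M.large
  have hmk := M.add_lt H
  have hh := H.hole
  have hx := M.notMem
  set τ := tuple ℓ c x y m p L with hτdef
  have hτ : ∀ j < 4 * ℓ - 4, τ j = c (position ℓ m p L j) := fun j hj => if_pos hj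
  have hτx : τ (4 * ℓ - 4) = x := by simp [hτdef, tuple]
  have hτy : τ (4 * ℓ - 3) = y := by
    simp only [hτdef, tuple]
    rw [if_neg (by omega), if_neg (by omega)]
  have hτ1 : τ (4 * ℓ - 7) = c (ℓ - 4) := by
    rw [hτ _ (by omega)]; congr 1; unfold position; omega
  have hτ2 : τ (4 * ℓ - 6) = c (m / 2) := by
    rw [hτ _ (by omega)]; congr 1; unfold position; omega
  have hτ3 : τ (4 * ℓ - 5) = c (m - ℓ + 4) := by
    rw [hτ _ (by omega)]; congr 1; unfold position; omega
  have hxI : ∀ i : ℤ, ℓ - 4 ≤ i → i ≤ m - ℓ + 4 → ¬ G.Adj x (c i) := fun i h1 h2 => by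
    rw [M.adj_iff i (by omega) (by omega)]; omega
  have hball : ∀ v ∉ Set.range c, ∀ j < 4 * ℓ - 4, v ≠ τ j := fun v hv j hj e =>
    hv ⟨_, ((hτ j hj).symm.trans e.symm)⟩
  have hhit : ∀ i : ℤ, ((-1 ≤ i ∧ i ≤ ℓ - 5) ∨ (m - ℓ + 5 ≤ i ∧ i ≤ m + 1) ∨
      (L - ℓ + 6 ≤ i ∧ i ≤ L + 1) ∨ (p ≤ i ∧ i ≤ p + ℓ - 4 ∧ i ≤ m - ℓ + 4)) →
      ∀ v, G.Adj v (c i) → ∃ j, 4 ≤ j ∧ j < 4 * ℓ - 9 ∧ G.Adj v (τ j) := by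
    intro i hi v hv
    obtain ⟨j, h1, h2, e⟩ := exists_hitter (L := L) h6 hm hp hp' hi
    exact ⟨j, h1, h2, by rwa [hτ j (by omega), e]⟩
  -- the vertices off the hole in the zone are adjacent neither to hitters nor to excluders
  have hoff : ∀ z ∈ zone G ℓ τ, z ∉ Set.range c →
      (∀ j, 4 ≤ j → j < 4 * ℓ - 9 → ¬ G.Adj z (τ j)) ∧ ¬ G.Adj z x ∧ ¬ G.Adj z y := by
    rintro z (⟨-, h1, h2, h3⟩ | ⟨j, -, h2, e⟩) hz
    · exact ⟨h1, hτx ▸ h2, hτy ▸ h3⟩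
    · exact absurd e (hball z hz j h2)
  have hunhit : ∀ z, (∀ j, 4 ≤ j → j < 4 * ℓ - 9 → ¬ G.Adj z (τ j)) → Unhit G ℓ c m z := by
    refine fun z hz => ⟨fun i h1 h2 hi => ?_, fun i h1 h2 hi => ?_⟩
    · obtain ⟨j, h3, h4, h5⟩ := hhit i (by omega) z hi
      exact hz j h3 h4 h5
    · obtain ⟨j, h3, h4, h5⟩ := hhit i (by omega) z hi
      exact hz j h3 h4 h5
  -- every major vertex is adjacent to a hitter or to an excluder
  have hmajor : ∀ u, IsMajor G (Set.range c) u → (∀ j, 4 ≤ j → j < 4 * ℓ - 9 → ¬ G.Adj u (τ j)) →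
      G.Adj u x ∨ G.Adj u y := by
    intro u hu hno
    by_contra! hxy
    have hux : u ≠ x := by
      rintro rfl
      obtain ⟨j, h1, h2, h3⟩ := hhit 0 (by omega) u
        ((M.adj_iff 0 le_rfl (by omega)).2 (.inl rfl))
      exact hno j h1 h2 h3
    have huy : u ≠ y := by
      rintro rfl
      rcases hy0 with h | h
      · obtain ⟨j, h1, h2, h3⟩ := hhit 0 (by omega) u h
        exact hno j h1 h2 h3
      · obtain ⟨j, h1, h2, h3⟩ := hhit p (by omega) u h
        exact hno j h1 h2 h3
    rcases hdom u hu hux huy (fun e => hxy.1 e.symm) (fun e => hxy.2 e.symm) (hunhit u hno) with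
      ⟨i, h1, h2, h3, h4⟩ | ⟨i, h1, h2, h4⟩
    all_goals
      obtain ⟨j, h5, h7, h8⟩ := hhit i (by omega) u h4
      exact hno j h5 h7 h8
  have hZ : Zone G ℓ k c x m (zone G ℓ τ) := by
    refine ⟨fun i h1 h2 => ?_, fun i h1 h2 hi => ?_, fun z hz hzc => hunhit z (hoff z hz hzc).1,
      fun z hz hzc e => (hoff z hz hzc).2.1 e.symm, fun z hz hzc hmaj => ?_⟩
    · by_cases hal : ∃ j, 3 * ℓ - 6 ≤ j ∧ j < 4 * ℓ - 4 ∧ c i = τ j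
      · exact .inr hal
      have hal' : ¬ ((p - 1 ≤ i ∧ i ≤ p + ℓ - 3 ∧ ℓ - 4 ≤ i ∧ i ≤ m - ℓ + 4) ∨
          i = ℓ - 4 ∨ i = m / 2 ∨ i = m - ℓ + 4) := by
        intro hi
        obtain ⟨j, h3, h4, e⟩ := exists_allowed (L := L) h6 hm hp hp' hi
        exact hal ⟨j, h3, h4, by rw [hτ j h4, e]⟩
      refine .inl ⟨fun j hj e => ?_, fun j hj hj' e => ?_, ?_, ?_⟩
      · by_cases hj' : 3 * ℓ - 6 ≤ j
        · exact hal ⟨j, hj', hj, e⟩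
        have := position_not_allowed (L := L) (m := m) (p := p) h6 hm (j := j) (by omega)
        rw [hτ j hj, hh.eq_iff] at e <;> omega
      · have := position_hitter (L := L) h6 hm hp hp' hj hj'
        rw [hτ j (by omega), hh.adj_iff] at e <;> omega
      · rw [hτx, G.adj_comm]
        exact hxI i h1 h2
      · rw [hτy, G.adj_comm]
        intro e
        have := hyp i h1 h2 e
        omega
    · rcases hi with ⟨hi, -⟩ | ⟨j, h3, h4, e⟩
      · by_contra hno
        obtain ⟨j, hj, e⟩ := exists_ball (L := L) (i := i) h6 hm hp hp' (by omega)
        exact hi j hj (by rw [hτ j hj, e])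
      · have := position_allowed (L := L) h6 hm hp hp' h3
        rw [hτ j h4, hh.eq_iff] at e <;> omega
    · obtain ⟨h1, h2, h3⟩ := hoff z hz hzc
      exact (hmajor z hmaj h1).elim h2 h3
  intro d₁ d₂ d₃ hd₁ hd₂ hd₃
  rw [hτ1] at hd₁
  rw [hτ2] at hd₂
  rw [hτ3] at hd₃
  have arc : ∀ {i j : ℤ}, ℓ - 4 ≤ i → i ≤ j → j ≤ m - ℓ + 4 →
      Reach G (zone G ℓ τ) (j - i).toNat (c i) (c j) := by
    intro i j h1 h2 h3
    obtain ⟨f, hf, e1, e2⟩ := hZ.reach_arc H M (n := (j - i).toNat) (by omega) h1 h3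
    exact ⟨f, hf.mono le_rfl fun t ht => (hf.mem t ht).1, e1, e2⟩
  have hB : ∀ i : ℤ, ℓ - 4 ≤ i → i ≤ m - ℓ + 4 → Between ℓ τ d₁ d₂ d₃ (c i) := by
    intro i h1 h2
    unfold Between
    rw [hτ2, hτ3]
    rcases le_total i (m / 2) with h3 | h3
    · left
      have e1 := hd₁.le_of_reach _ _ (arc le_rfl h1 h2)
      have e2 := hd₂.le_of_reach _ _ (arc h1 h3 (by omega)).symm
      by_contra! hlt
      have e3 := hZ.le_of_reach_zone H M (s := ℓ - 4) (s' := m / 2) le_rfl (by omega) (by omega)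
        (by omega) (hd₁.reach _ (by omega))
      omega
    · right
      have e1 := hd₂.le_of_reach _ _ (arc (by omega) h3 h2)
      have e2 := hd₃.le_of_reach _ _ (arc h1 h2 le_rfl).symm
      by_contra! hlt
      have e3 := hZ.le_of_reach_zone H M (s := m / 2) (s' := m - ℓ + 4) (by omega) (by omega)
        le_rfl (by omega) (hd₂.reach _ (by omega))
      omega
  have hnt : ∀ z, Between ℓ τ d₁ d₂ d₃ z → ¬ Touches G k c m z := by
    unfold Between
    rw [hτ2, hτ3]
    rintro z (hz | hz)
    · have e1 := hd₁.le_of_reach _ _ (arc (i := ℓ - 4) (j := m / 2) le_rfl (by omega) (by omega))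
      exact hZ.not_touches_of_reach H M (s := ℓ - 4) (s' := m / 2) le_rfl (by omega) (by omega)
        (by omega) (hd₁.reach z (by omega)) (hd₂.reach z (by omega)).symm (by omega)
    · have e1 := hd₂.le_of_reach _ _ (arc (i := m / 2) (j := m - ℓ + 4) (by omega) (by omega)
        le_rfl)
      exact hZ.not_touches_of_reach H M (s := m / 2) (s' := m - ℓ + 4) (by omega) (by omega)
        le_rfl (by omega) (hd₂.reach z (by omega)) (hd₃.reach z (by omega)).symm (by omega)
  refine ⟨fun v hv => ⟨hball v hv.1, ?_⟩, ?_⟩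
  · by_cases hno : ∃ j, 4 ≤ j ∧ j < 4 * ℓ - 9 ∧ G.Adj v (τ j)
    · exact .inl hno
    right
    push Not at hno
    obtain ⟨i, h1, h2, hi⟩ := M.exists_adj v hv
    have hu := hunhit v hno
    refine ⟨⟨c i, hB i ?_ ?_, hi⟩, by rw [hτx, hτy]; exact hmajor v hv hno⟩
    · by_contra! hlt
      exact hu.1 i (by omega) (by omega) hi
    · by_contra! hlt
      exact hu.2 i (by omega) (by omega) hi
  · rintro _ ⟨i, rfl⟩ ⟨h1, h2⟩
    obtain ⟨i₀, h3, h4, e₀⟩ := hh.exists_mem_Ico (-2) i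
    rw [← e₀] at h1 h2
    have hnb : ¬ ((-2 ≤ i₀ ∧ i₀ ≤ ℓ - 5) ∨ (m - ℓ + 5 ≤ i₀ ∧ i₀ ≤ m + 2) ∨
        (L - ℓ + 5 ≤ i₀ ∧ i₀ ≤ L + 2) ∨
        (p - 1 ≤ i₀ ∧ i₀ ≤ p + ℓ - 3 ∧ ℓ - 4 ≤ i₀ ∧ i₀ ≤ m - ℓ + 4) ∨
        i₀ = ℓ - 4 ∨ i₀ = m - ℓ + 4) := by
      intro hi
      obtain ⟨j, hj, e⟩ := exists_ball (L := L) h6 hm hp hp' hi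
      exact h1 j hj (by rw [hτ j hj, e])
    rcases h2 with ⟨j, h5, h7, h8⟩ | ⟨⟨z, hz, hadj⟩, hex⟩
    · have := position_hitter (L := L) h6 hm hp hp' h5 h7
      rw [hτ j (by omega), hh.adj_iff] at h8 <;> omega
    · by_cases hI : i₀ ≤ m - ℓ + 4
      · rw [hτx, hτy] at hex
        rcases hex with hex | hex
        · exact hxI i₀ (by omega) hI hex.symm
        · have := hyp i₀ (by omega) hI hex.symm
          omega
      · exact hnt z hz ⟨i₀, by omega, by omega, hadj.symm⟩

/-- For every shortest long even hole there is a tuple that marks its major vertices. -/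
theorem LargestGap.exists_marksMajors (H : ShortestHole G ℓ k c) (M : LargestGap G ℓ k c x m)
    (hN : k ≤ N) : ∃ τ, MarksMajors G ℓ (Set.range c) N τ := by
  classical
  have h6 := H.six_le
  have hm := M.large
  have hmk := M.add_lt H
  by_cases hhat : ∃ u p a b, IsMajor G (Set.range c) u ∧ IsHat G ℓ k c m u p ∧
      HatEnds G k c m u p a b
  · -- the hat whose first neighbour outside the gap is as late as possible
    obtain ⟨a, ha1, ha2, ⟨y, p, b, hy, hyH, hyE⟩, hmax⟩ := exists_max_int (a := m) (b := k)
      (P := fun a => ∃ u p b, IsMajor G (Set.range c) u ∧ IsHat G ℓ k c m u p ∧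
        HatEnds G k c m u p a b) (by
        obtain ⟨u, p, a, b, h1, h2, h3⟩ := hhat
        have := h3.le
        have := h3.le'
        have := h3.add_le
        exact ⟨a, by omega, by omega, u, p, b, h1, h2, h3⟩)
    have hp := hyH.le
    have hp' := hyH.le'
    have hb := hyE.add_le
    have hb' := hyE.le'
    refine ⟨_, M.marksMajors_tuple H hN (y := y) (p := p) (L := a) hp hp' hyE.le (by omega) hy
      (fun i h1 h2 h3 => (hyH.adj_iff i (by omega) (by omega)).1 h3)
      (.inr ((hyH.adj_iff p (by omega) (by omega)).2 (.inl rfl))) ?_⟩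
    intro u hu hux huy hxu hyu hun
    obtain ⟨v, hv⟩ := M.exists_isHat H hu hux.symm hxu hun
    obtain ⟨a', b', huE⟩ := hv.exists_ends H M
    have ha' : a' ≤ a := by
      by_contra! hlt
      have := huE.add_le
      have := huE.le'
      exact hmax a' hlt (by omega) ⟨u, v, b', hu, hv, huE⟩
    rcases hyH.exists_adj_near H M hyE hv huE ha' huy.symm hyu with ⟨i, h1, h2, h3⟩ | h
    · refine .inl ⟨i, h1, h2, ?_, h3⟩
      by_contra! hlt
      exact hun.2 i (by omega) (by omega) h3
    · exact .inr h
  · refine ⟨_, M.marksMajors_tuple H hN (y := x) (p := ℓ - 4) (L := m + 2) le_rfl (by omega) le_rfl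
      (by omega) M.major (fun i h1 h2 h3 => ?_)
      (.inl ((M.adj_iff 0 le_rfl (by omega)).2 (.inl rfl))) ?_⟩
    · have := (M.adj_iff i (by omega) (by omega)).1 h3
      omega
    · intro u hu hux _ hxu _ hun
      obtain ⟨v, hv⟩ := M.exists_isHat H hu hux.symm hxu hun
      obtain ⟨a, b, hE⟩ := hv.exists_ends H M
      exact absurd ⟨u, v, a, b, hu, hv, hE⟩ hhat

theorem MarksMajors.of_comp_add {a : ℤ} {τ : ℕ → V}
    (h : MarksMajors G ℓ (Set.range fun i => c (i + a)) N τ) :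
    MarksMajors G ℓ (Set.range c) N τ := by
  have : (Set.range fun i => c (i + a)) = Set.range c :=
    (Equiv.addRight a).surjective.range_comp c
  rwa [this] at h

theorem ShortestHole.exists_marksMajors (H : ShortestHole G ℓ k c) (hN : k ≤ N) :
    ∃ τ, MarksMajors G ℓ (Set.range c) N τ := by
  have h6 := H.six_le
  have hk := H.lt_length
  have hh := H.hole
  by_cases hex : ∃ x, IsMajor G (Set.range c) x
  swap
  · exact H.exists_marksMajors_of_short (m := 0) le_rfl (by omega)
      fun v hv => absurd ⟨v, hv⟩ hex
  -- the largest gap of a major vertex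
  obtain ⟨m, hm1, hmk, ⟨x, a, hx, hxa, hxm, hgap⟩, hmax⟩ := exists_max_int (a := 1) (b := k)
    (P := fun m => ∃ x a, IsMajor G (Set.range c) x ∧ G.Adj x (c a) ∧ G.Adj x (c (a + m)) ∧
      ∀ i, a < i → i < a + m → ¬ G.Adj x (c i)) (by
    obtain ⟨x, hx⟩ := hex
    obtain ⟨a, -, -, ha⟩ := (hh.isMajor_iff.1 hx).2 0
    obtain ⟨b, h1, h2, hb⟩ := (hh.isMajor_iff.1 hx).2 a
    obtain ⟨i, h3, h4, hi, hmin⟩ := exists_min_int (P := fun i => G.Adj x (c i)) (a := a + 1)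
      (b := b) ⟨b, by omega, le_rfl, hb⟩
    exact ⟨i - a, by omega, by omega, x, a, hx, ha, by simpa using hi,
      fun j h5 h7 => hmin j (by omega) (by omega)⟩)
  have hmk' : m < k := by
    obtain ⟨b, h1, h2, hb⟩ := (hh.isMajor_iff.1 hx).2 a
    by_contra! hle
    exact hgap b (by omega) (by omega) hb
  have H' := H.comp_add a
  have hrange : (Set.range fun i => c (i + a)) = Set.range c :=
    (Equiv.addRight a).surjective.range_comp c
  have hall : ∀ v, IsMajor G (Set.range fun i => c (i + a)) v →
      ∃ i, 0 ≤ i ∧ i ≤ m ∧ G.Adj v (c (i + a)) := by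
    intro v hv
    rw [hrange] at hv
    by_contra! hno
    have hno' : ∀ i, a ≤ i → i ≤ a + m → ¬ G.Adj v (c i) := fun i h1 h2 h => by
      have := hno (i - a) (by omega) (by omega)
      rw [sub_add_cancel] at this
      exact this h
    -- otherwise the gap of `v` around this gap would be larger
    obtain ⟨t, ht1, ht2, ht⟩ := (hh.isMajor_iff.1 hv).2 a
    obtain ⟨i, h1, h2, hi, himin⟩ := exists_min_int (P := fun i => G.Adj v (c i)) (a := a + 1)
      (b := a + k) ⟨t, by omega, by omega, ht⟩
    have ht' : G.Adj v (c (t - k)) := by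
      rwa [← hh.add_period, sub_add_cancel]
    obtain ⟨j, h3, h4, hj, hjmax⟩ := exists_max_int (P := fun i => G.Adj v (c i)) (a := t - k)
      (b := a) ⟨t - k, by omega, by omega, ht'⟩
    have him : a + m < i := by
      by_contra! hlt
      exact hno' i (by omega) hlt hi
    have hja : j < a := by
      by_contra! hlt
      exact hno' j hlt (by omega) hj
    have hij : i - j ≤ k := by
      by_contra! hlt
      have hjk : G.Adj v (c (j + k)) := by rwa [hh.add_period]
      rcases le_or_gt (j + k) a with h | h
      · exact hjmax _ (by omega) h hjk
      · exact himin _ (by omega) (by omega) hjk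
    refine hmax (i - j) (by omega) hij ⟨v, j, hv, hj, by simpa using hi, fun q h5 h7 => ?_⟩
    rcases le_or_gt q a with h | h
    · exact hjmax q h5 h
    · exact himin q (by omega) (by omega)
  rcases le_or_gt m (2 * ℓ - 6) with hsmall | hlarge
  · obtain ⟨τ, hτ⟩ := H'.exists_marksMajors_of_short (N := N) (by omega) hsmall hall
    exact ⟨τ, hτ.of_comp_add⟩
  · have M : LargestGap G ℓ k (fun i => c (i + a)) x m := by
      refine ⟨hrange ▸ hx, fun i h1 h2 => ⟨fun h => ?_, ?_⟩, hall, by omega, hmk'⟩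
      · by_contra hno
        exact hgap (i + a) (by omega) (by omega) h
      · rintro (rfl | rfl)
        · simpa using hxa
        · rwa [add_comm]
    obtain ⟨τ, hτ⟩ := M.exists_marksMajors H' hN
    exact ⟨τ, hτ.of_comp_add⟩

end Marks

/-! ### Lightest long even holes are shortest -/

section Lightest

variable {V : Type*} {G : SimpleGraph V} {ℓ k : ℕ} {c : ℤ → V}

/-- A hole has as many edges as vertices, so that a lightest long even hole is a shortest one. -/
theorem HoleMap.ncard_edgesOn (h : HoleMap G k c) : (edgesOn G (Set.range c)).ncard = k := by
  have h4 := h.four_le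
  have himg : edgesOn G (Set.range c) =
      (fun i : ℤ => s(c i, c (i + 1))) '' (Set.Ico (0 : ℤ) k) := by
    ext e
    induction e using Sym2.ind with
    | _ u v =>
      simp only [edgesOn, Set.mem_ofPred_eq, mem_edgeSet, Sym2.mem_iff, Set.mem_image, Set.mem_Ico]
      constructor
      · rintro ⟨hadj, hmem⟩
        obtain ⟨i, hi⟩ := hmem u (.inl rfl)
        obtain ⟨j, hj⟩ := hmem v (.inr rfl)
        obtain ⟨i, hi1, hi2, ei⟩ := h.exists_mem_Ico 0 i
        obtain ⟨j, hj1, hj2, ej⟩ := h.exists_mem_Ico 0 j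
        rw [← hi, ← hj, ← ei, ← ej] at hadj ⊢
        rw [h.adj_iff_dvd] at hadj
        rcases hadj with hd | hd
        · refine ⟨j, ⟨hj1, by omega⟩, ?_⟩
          rw [Sym2.eq_swap, (h.eq_iff_dvd (j + 1) i).2]
          rwa [← dvd_neg, show -(j + 1 - i) = i - j - 1 by ring]
        · refine ⟨i, ⟨hi1, by omega⟩, ?_⟩
          rw [(h.eq_iff_dvd (i + 1) j).2]
          rwa [← dvd_neg, show -(i + 1 - j) = j - i - 1 by ring]
      · rintro ⟨i, -, e⟩
        rw [← mem_edgeSet, ← e, mem_edgeSet]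
        refine ⟨by rw [h.adj_iff] <;> omega, fun w hw => ?_⟩
        have : w ∈ s(u, v) := Sym2.mem_iff.2 hw
        rw [← e, Sym2.mem_iff] at this
        rcases this with rfl | rfl <;> exact ⟨_, rfl⟩
  rw [himg, Set.InjOn.ncard_image, ← Finset.coe_Ico, Set.ncard_coe_finset, Int.card_Ico]
  · omega
  · rintro i ⟨hi1, hi2⟩ j ⟨hj1, hj2⟩ e
    rw [Sym2.eq_iff, h.eq_iff (by omega) (by omega), h.eq_iff (by omega) (by omega),
      h.eq_iff (by omega) (by omega), h.eq_iff (by omega) (by omega)] at e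
    omega

theorem IsCandidate.exists_marksMajors {n : ℕ} {G : SimpleGraph (Fin n)} (hℓ : 6 ≤ ℓ)
    (heven : Even ℓ) (hG : IsCandidate G ℓ) {es : List (Fin n × Fin n)} {C : Set (Fin n)}
    (hC : IsLightestLongEvenHole G ℓ es C) : ∃ τ, MarksMajors G ℓ C n τ := by
  obtain ⟨⟨k, hk, hℓk, hke⟩, hmin⟩ := hC
  obtain ⟨hshort, h1, h2, h3, h4⟩ := hG
  obtain ⟨c, hc, rfl⟩ := hk.exists_holeMap
  have H : ShortestHole G ℓ k c := by
    refine ⟨hℓ, heven, hc, hke, ?_, fun D q hD hq hℓq => ?_, h1, h2, h3, h4⟩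
    · by_contra! hle
      exact hshort ⟨_, k, hk, hℓk, hke, hle⟩
    · by_contra! hlt
      refine hmin D ⟨q, hD, hℓq, hq⟩ (.inl ?_)
      obtain ⟨d, hd, rfl⟩ := hD.exists_holeMap
      rwa [hd.ncard_edgesOn, hc.ncard_edgesOn]
  refine H.exists_marksMajors ?_
  have : Function.Injective fun i : Fin k => c i := fun i j e => by
    have hi := i.2
    have hj := j.2
    rw [hc.eq_iff (by omega) (by omega)] at e
    exact Fin.ext (by omega)
  simpa using Fintype.card_le_of_injective _ this

end Lightest

/-! ### A language of loops over arrays, and its implementation on the machine -/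

section Language

/-- The memory from address `F` on holds sixteen interleaved arrays; below, it holds `I`. -/
def layout (F : ℕ) (I : ℕ → ℕ) (A : Fin 16 → ℕ → ℕ) (a : ℕ) : ℕ :=
  if a < F then I a else A ⟨(a - F) % 16, Nat.mod_lt _ (by norm_num)⟩ ((a - F) / 16)

theorem layout_of_lt {F : ℕ} {I : ℕ → ℕ} {A : Fin 16 → ℕ → ℕ} {a : ℕ} (h : a < F) :
    layout F I A a = I a := if_pos h

theorem layout_array (F : ℕ) (I : ℕ → ℕ) (A : Fin 16 → ℕ → ℕ) (q : Fin 16) (v : ℕ) :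
    layout F I A (v * 16 + q + F) = A q v := by
  have hq := q.2
  rw [layout, if_neg (by omega)]
  refine congrArg₂ A (Fin.ext ?_) (by omega)
  show (v * 16 + q + F - F) % 16 = q
  omega

/-- The arrays after the assignment `A[q][v] := x`. -/
def put (A : Fin 16 → ℕ → ℕ) (q : Fin 16) (v x : ℕ) : Fin 16 → ℕ → ℕ :=
  Function.update A q (Function.update (A q) v x)

theorem put_apply (A : Fin 16 → ℕ → ℕ) (q : Fin 16) (v x : ℕ) (q' : Fin 16) (v' : ℕ) :
    put A q v x q' v' = if q' = q ∧ v' = v then x else A q' v' := by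
  unfold put
  by_cases hq : q' = q
  · subst hq
    simp [Function.update_apply]
  · simp [hq]

theorem update_layout (F : ℕ) (I : ℕ → ℕ) (A : Fin 16 → ℕ → ℕ) (q : Fin 16) (v x : ℕ) :
    Function.update (layout F I A) (v * 16 + q + F) x = layout F I (put A q v x) := by
  have hq := q.2
  ext a
  rw [Function.update_apply]
  split_ifs with h
  · rw [h, layout_array, put_apply, if_pos ⟨rfl, rfl⟩]
  · unfold layout
    split_ifs with ha
    · rfl
    · rw [put_apply, if_neg]
      rintro ⟨h1, h2⟩
      have := congrArg Fin.val h1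
      simp only at this
      omega

/-- Arithmetic expressions over the first nine registers, the arrays and the input. Register `2`
holds the address at which the arrays start. -/
inductive Expr
  | reg (r : Fin 9)
  | const (k : ℕ)
  | op (o : Op) (a b : Expr)
  | arr (q : Fin 16) (e : Expr)
  | inp (e : Expr)

namespace Expr

/-- The value of an expression. -/
def eval (I : ℕ → ℕ) (A : Fin 16 → ℕ → ℕ) (ρ : Fin 9 → ℕ) : Expr → ℕ
  | reg r => ρ r
  | const k => k
  | op o a b => o.eval (eval I A ρ a) (eval I A ρ b)
  | arr q e => A q (eval I A ρ e)
  | inp e => layout (ρ 2) I A (eval I A ρ e)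

/-- Given in register `d` an index in the array `q`, this computes its address in register `d`. -/
def addressProg (q : Fin 16) (d : ℕ) : Prog :=
  .seq (.const (d + 1) 16) (.seq (.arith .mul d d (d + 1)) (.seq (.const (d + 1) q)
    (.seq (.arith .add d d (d + 1)) (.arith .add d d 2))))

/-- A program that computes the value of an expression in register `d`, without changing the
registers below. -/
def compile (d : ℕ) : Expr → Prog
  | reg r => .copy d r
  | const k => .const d k
  | op o a b => .seq (compile d a) (.seq (compile (d + 1) b) (.arith o d d (d + 1)))
  | arr q e => .seq (compile d e) (.seq (addressProg q d) (.load d d))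
  | inp e => .seq (compile d e) (.load d d)

/-- The running time of `compile`. -/
def cost : Expr → ℕ
  | reg _ => 1
  | const _ => 1
  | op _ a b => a.cost + (b.cost + 1)
  | arr _ e => e.cost + (5 + 1)
  | inp e => e.cost + 1

/-- All numbers in the evaluation of an expression are at most `X ^ deg`, where `X ≥ 2` bounds the
contents of the registers and of the memory. -/
def deg : Expr → ℕ
  | reg _ => 1
  | const k => k + 1
  | op _ a b => a.deg + b.deg + 1
  | arr _ e => e.deg + 6
  | inp e => e.deg + 1

end Expr

theorem Op.eval_le {X a b m n : ℕ} (hX : 2 ≤ X) (o : Op) (ha : a ≤ X ^ m) (hb : b ≤ X ^ n) :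
    o.eval a b ≤ X ^ (m + n + 1) := by
  have hm : X ^ m ≤ X ^ (m + n) := Nat.pow_le_pow_right (by omega) (by omega)
  have hn : X ^ n ≤ X ^ (m + n) := Nat.pow_le_pow_right (by omega) (by omega)
  have h2 : X ^ (m + n) * 2 ≤ X ^ (m + n + 1) := by
    rw [pow_succ]; exact Nat.mul_le_mul_left _ hX
  have hab : a * b ≤ X ^ (m + n) := by
    rw [pow_add]; exact Nat.mul_le_mul ha hb
  cases o
  · show a + b ≤ _; omega
  · show a - b ≤ _; omega
  · show a * b ≤ _; omega
  · show a / b ≤ _; have := Nat.div_le_self a b; omega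
  · show a % b ≤ _; have := Nat.mod_le a b; omega

theorem address_le {X v F m : ℕ} (hX : 2 ≤ X) (hv : v ≤ X ^ m) (hF : F ≤ X) (q : Fin 16) :
    v * 16 + q + F ≤ X ^ (m + 6) := by
  have hq := q.2
  have h1 : 2 ^ 6 ≤ X ^ 6 := Nat.pow_le_pow_left hX 6
  have h2 : X ≤ X ^ 6 := Nat.le_self_pow (by norm_num) X
  have h3 : 0 < X ^ m := by positivity
  have h4 : X ≤ X ^ 6 / 32 := by
    rw [Nat.le_div_iff_mul_le (by norm_num)]
    calc X * 32 = X * 2 ^ 5 := by norm_num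
      _ ≤ X * X ^ 5 := Nat.mul_le_mul_left _ (Nat.pow_le_pow_left hX 5)
      _ = X ^ 6 := by ring
  have h5 : X ^ m * 64 ≤ X ^ m * X ^ 6 := Nat.mul_le_mul_left _ h1
  have h6 : 1 * X ^ 6 ≤ X ^ m * X ^ 6 := Nat.mul_le_mul_right _ h3
  rw [pow_add]
  generalize X ^ m * X ^ 6 = Y at *
  omega

section Exec

variable {W U X : ℕ} {I : ℕ → ℕ} {A : Fin 16 → ℕ → ℕ} {ρ : Fin 9 → ℕ}

/-- The state `s` holds `ρ` in the first nine registers, and the memory is as described by `layout`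
for `I` and `A`. -/
structure Holds (I : ℕ → ℕ) (ρ : Fin 9 → ℕ) (A : Fin 16 → ℕ → ℕ) (s : State) : Prop where
  reg : ∀ r : Fin 9, s.reg r = ρ r
  mem : s.mem = layout (ρ 2) I A

theorem Holds.of_eq {s s' : State} (h : Holds I ρ A s) (hreg : ∀ r < 9, s'.reg r = s.reg r)
    (hmem : s'.mem = s.mem) : Holds I ρ A s' :=
  ⟨fun r => (hreg r r.2).trans (h.reg r), hmem.trans h.mem⟩

theorem exec_addressProg {s : State} {d v m : ℕ} (hX : 2 ≤ X) (hW : X ^ (m + 6) < W)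
    (hv : s.reg d = v) (hvX : v ≤ X ^ m) (hF : s.reg 2 ≤ X) (hd : 9 ≤ d) (q : Fin 16) :
    ∃ s', Exec W (Expr.addressProg q d) s 5 s' ∧ s'.reg d = v * 16 + q + s.reg 2 ∧
      (∀ r < d, s'.reg r = s.reg r) ∧ s'.mem = s.mem ∧ s'.out = s.out := by
  have h := address_le hX hvX hF q
  have h16 : 16 < W := by
    have h1 : 2 ^ 6 ≤ X ^ 6 := Nat.pow_le_pow_left hX 6
    have h2 : X ^ 6 ≤ X ^ (m + 6) := Nat.pow_le_pow_right (by omega) (by omega)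
    omega
  refine ⟨_, .seq (.const _ _ _ h16) (.seq (.arith _ _ _ _ _ ?_) (.seq (.const _ _ _ ?_)
    (.seq (.arith _ _ _ _ _ ?_) (.arith _ _ _ _ _ ?_)))), ?_, fun r hr => ?_, rfl, rfl⟩
  · simp [Op.eval, hv]; omega
  · have := q.2; omega
  · simp [Op.eval, hv]; omega
  · simp [Op.eval, hv, show 2 ≠ d by omega, show 2 ≠ d + 1 by omega]; omega
  · simp [Op.eval, hv, show 2 ≠ d by omega, show 2 ≠ d + 1 by omega]
  · simp [hr.ne, show r ≠ d + 1 by omega]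

theorem Expr.exec (hX : 2 ≤ X) (hρ : ∀ r, ρ r ≤ X) (hmem : ∀ a, layout (ρ 2) I A a ≤ X) (e : Expr)
    (hW : X ^ e.deg < W) (d : ℕ) (hd : 9 ≤ d) (s : State) (hs : Holds I ρ A s) :
    e.eval I A ρ ≤ X ^ e.deg ∧
    ∃ s', Exec W (e.compile d) s e.cost s' ∧ s'.reg d = e.eval I A ρ ∧
      (∀ r < d, s'.reg r = s.reg r) ∧ s'.mem = s.mem ∧ s'.out = s.out := by
  have hpow : ∀ {i j}, i ≤ j → X ^ i ≤ X ^ j := fun h => Nat.pow_le_pow_right (by omega) h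
  have hself : ∀ {i}, X ≤ X ^ (i + 1) := fun {i} => Nat.le_self_pow (by omega) X
  induction e generalizing d s with
  | reg r =>
    refine ⟨(hρ r).trans (by simp [deg]), _, .copy _ _ _, ?_, fun r hr => ?_, rfl, rfl⟩
    · simp [hs.reg, eval]
    · simp [hr.ne]
  | const k =>
    have hk : k ≤ X ^ (k + 1) := by
      have h1 : k < 2 ^ k := Nat.lt_two_pow_self
      have h2 : 2 ^ k ≤ X ^ k := Nat.pow_le_pow_left hX k
      have h3 : X ^ k ≤ X ^ (k + 1) := hpow (by omega)
      omega
    refine ⟨hk, _, .const _ _ _ (hk.trans_lt hW), ?_, fun r hr => ?_, rfl, rfl⟩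
    · simp [eval]
    · simp [hr.ne]
  | op o a b iha ihb =>
    simp only [deg] at hW
    obtain ⟨ha, s₁, e1, r1, k1, m1, o1⟩ := iha ((hpow (by omega)).trans_lt hW) d hd s hs
    obtain ⟨hb, s₂, e2, r2, k2, m2, o2⟩ := ihb ((hpow (by omega)).trans_lt hW) (d + 1) (by omega)
      s₁ (hs.of_eq (fun r hr => k1 r (by omega)) m1)
    have hle := Op.eval_le hX o ha hb
    have hrd : s₂.reg d = a.eval I A ρ := (k2 d (by omega)).trans r1
    refine ⟨hle, _, .seq e1 (.seq e2 (.arith _ _ _ _ _ ?_)), ?_, fun r hr => ?_, m2.trans m1,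
      o2.trans o1⟩
    · rw [hrd, r2]; exact hle.trans_lt hW
    · simp [hrd, r2, eval]
    · simp [hr.ne, k2 r (by omega), k1 r hr]
  | arr q e ih =>
    simp only [deg] at hW
    obtain ⟨he, s₁, e1, r1, k1, m1, o1⟩ := ih ((hpow (by omega)).trans_lt hW) d hd s hs
    have h2 : s₁.reg 2 = ρ 2 := (k1 2 (by omega)).trans (hs.reg 2)
    obtain ⟨s₂, e2, r2, k2, m2, o2⟩ := exec_addressProg hX hW r1 he (h2 ▸ hρ 2) hd q
    have hval : s₂.mem (s₂.reg d) = (arr q e).eval I A ρ := by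
      rw [r2, h2, m2, m1, hs.mem, layout_array]; rfl
    refine ⟨?_, _, .seq e1 (.seq e2 (.load _ _ _)), ?_, fun r hr => ?_, m2.trans m1,
      o2.trans o1⟩
    · rw [← hval, m2, m1, hs.mem]
      exact (hmem _).trans hself
    · simp [hval]
    · simp [hr.ne, k2 r hr, k1 r hr]
  | inp e ih =>
    simp only [deg] at hW
    obtain ⟨he, s₁, e1, r1, k1, m1, o1⟩ := ih ((hpow (by omega)).trans_lt hW) d hd s hs
    have hval : s₁.mem (s₁.reg d) = (inp e).eval I A ρ := by
      rw [r1, m1, hs.mem]; rfl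
    refine ⟨?_, _, .seq e1 (.load _ _ _), ?_, fun r hr => ?_, m1, o1⟩
    · rw [← hval, m1, hs.mem]
      exact (hmem _).trans hself
    · simp [hval]
    · simp [hr.ne, k1 r hr]

/-- The `n`-fold iteration of `f`, which is told the number of the round. -/
def iter {α : Type*} (f : ℕ → α → α) : ℕ → α → α
  | 0, x => x
  | n + 1, x => f n (iter f n x)

/-- Commands: assignments to entries of arrays, output, and loops in which register `i` runs through
the numbers below the contents of register `a`. -/
inductive Cmd
  | store (q : Fin 16) (i e : Expr)
  | write (e : Expr)
  | seq (c c' : Cmd)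
  | loop (i a : Fin 9) (c : Cmd)

namespace Cmd

/-- The effect of a command on the arrays and the output tape. -/
def run (I : ℕ → ℕ) : Cmd → (Fin 9 → ℕ) → (Fin 16 → ℕ → ℕ) × List ℕ →
    (Fin 16 → ℕ → ℕ) × List ℕ
  | store q i e, ρ, x => (put x.1 q (i.eval I x.1 ρ) (e.eval I x.1 ρ), x.2)
  | write e, ρ, x => (x.1, x.2 ++ [e.eval I x.1 ρ])
  | seq c c', ρ, x => run I c' ρ (run I c ρ x)
  | loop i a c, ρ, x => iter (fun j => run I c (Function.update ρ i j)) (ρ a) x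

/-- The program for a command. Register `4` holds the number one. -/
def compile : Cmd → Prog
  | store q i e => .seq (i.compile 9) (.seq (Expr.addressProg q 9)
      (.seq (e.compile 10) (.store 9 10)))
  | write e => .seq (e.compile 9) (.write 9)
  | seq c c' => .seq c.compile c'.compile
  | loop i a c => .seq (.whileLt i a (.seq c.compile (.arith .add i i 4))) (.const i 0)

/-- A bound on the running time of a command. -/
def time (ρ : Fin 9 → ℕ) : Cmd → ℕ
  | store _ i e => i.cost + (5 + (e.cost + 1))
  | write e => e.cost + 1
  | seq c c' => c.time ρ + c'.time ρ
  | loop _ a c => ρ a * (c.time ρ + 2) + 2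

/-- All numbers in the execution of a command are at most `X ^ deg`, where `X ≥ 2` bounds the
contents of the registers and of the memory. -/
def deg : Cmd → ℕ
  | store _ i e => i.deg + 6 + e.deg
  | write e => e.deg
  | seq c c' => c.deg + c'.deg
  | loop _ _ c => c.deg + 1

/-- The variable of a loop is not in use, and no number stored in an array exceeds `U`. -/
def Ok (I : ℕ → ℕ) (U : ℕ) : (Fin 9 → ℕ) → Cmd → Prop
  | ρ, store _ _ e => ∀ A : Fin 16 → ℕ → ℕ, (∀ q v, A q v ≤ U) → e.eval I A ρ ≤ U
  | _, write _ => True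
  | ρ, seq c c' => Ok I U ρ c ∧ Ok I U ρ c'
  | ρ, loop i a c => 5 ≤ i ∧ a < 5 ∧ ρ i = 0 ∧ ∀ j < ρ a, Ok I U (Function.update ρ i j) c

theorem time_congr {c : Cmd} (hc : Ok I U ρ c) {ρ' : Fin 9 → ℕ} (hρ : ∀ r < 5, ρ r = ρ' r) :
    c.time ρ = c.time ρ' := by
  induction c generalizing ρ ρ' with
  | store => rfl
  | write => rfl
  | seq c c' ih ih' =>
    simp only [time]
    rw [ih hc.1 hρ, ih' hc.2 hρ]
  | loop i a c ih =>
    obtain ⟨h1, h2, -, h3⟩ := hc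
    simp only [time]
    rcases Nat.eq_zero_or_pos (ρ a) with h0 | h0
    · rw [← hρ a h2, h0]; simp
    · have key : ∀ r < 5, Function.update ρ i 0 r = ρ r := fun r hr =>
        Function.update_of_ne
        (fun e => by subst e; exact absurd h1 (not_le.2 hr)) _ _
      rw [hρ a h2, ← ih (h3 0 h0) key, ih (h3 0 h0) fun r hr => (key r hr).trans (hρ r hr)]

/-- The program for a command has the effect of the command, within its time bound. -/
theorem exec (hX : 2 ≤ X) (hUX : U ≤ X) (hI : ∀ a, I a ≤ U) (c : Cmd) (hW : X ^ c.deg < W)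
    (hc : Ok I U ρ c) (hρ : ∀ r, ρ r ≤ U) (h1 : ρ 4 = 1) (hA : ∀ q v, A q v ≤ U) (s : State)
    (hs : Holds I ρ A s) :
    (∀ q v, (c.run I ρ (A, s.out)).1 q v ≤ U) ∧ ∃ t s', Exec W c.compile s t s' ∧ t ≤ c.time ρ ∧
      Holds I ρ (c.run I ρ (A, s.out)).1 s' ∧ s'.out = (c.run I ρ (A, s.out)).2 := by
  have hpow : ∀ {i j}, i ≤ j → X ^ i ≤ X ^ j := fun h => Nat.pow_le_pow_right (by omega) h
  have hlay : ∀ (F : ℕ) (A : Fin 16 → ℕ → ℕ), (∀ q v, A q v ≤ U) → ∀ a, layout F I A a ≤ X := by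
    intro F A hA a
    unfold layout
    split_ifs
    exacts [(hI a).trans hUX, (hA _ _).trans hUX]
  induction c generalizing ρ A s with
  | store q i e =>
    simp only [deg] at hW
    have hρX := fun r => (hρ r).trans hUX
    obtain ⟨hi, s₁, e1, r1, k1, m1, o1⟩ := i.exec hX hρX (hlay _ A hA)
      ((hpow (by omega)).trans_lt hW) 9 le_rfl s hs
    have h2 : s₁.reg 2 = ρ 2 := (k1 2 (by omega)).trans (hs.reg 2)
    obtain ⟨s₂, e2, r2, k2, m2, o2⟩ := exec_addressProg hX ((hpow (by omega)).trans_lt hW) r1 hi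
      (h2 ▸ hρX 2) le_rfl q
    obtain ⟨he, s₃, e3, r3, k3, m3, o3⟩ := e.exec hX hρX (hlay _ A hA)
      ((hpow (by omega)).trans_lt hW) 10 (by omega) s₂
      (hs.of_eq (fun r hr => (k2 r hr).trans (k1 r hr)) (m2.trans m1))
    have r9 := k3 9 (by omega)
    rw [r2, h2] at r9
    refine ⟨fun q' v' => ?_, _, _, .seq e1 (.seq e2 (.seq e3 (.store _ _ _))), le_rfl,
      ⟨fun r => ?_, ?_⟩, o3.trans (o2.trans o1)⟩
    · show put A q _ _ q' v' ≤ U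
      rw [put_apply]
      split_ifs
      exacts [hc A hA, hA _ _]
    · have hr := r.2
      exact (k3 r (by omega)).trans ((k2 r hr).trans ((k1 r hr).trans (hs.reg r)))
    · show Function.update s₃.mem (s₃.reg 9) (s₃.reg 10) = _
      rw [m3, m2, m1, hs.mem, r9, r3, update_layout]
      rfl
  | write e =>
    obtain ⟨he, s₁, e1, r1, k1, m1, o1⟩ := e.exec hX (fun r => (hρ r).trans hUX) (hlay _ A hA)
      hW 9 le_rfl s hs
    refine ⟨hA, _, _, .seq e1 (.write _ _), le_rfl,
      ⟨fun r => (k1 r r.2).trans (hs.reg r), m1.trans hs.mem⟩, ?_⟩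
    show s₁.out ++ [s₁.reg 9] = s.out ++ [_]
    rw [o1, r1]
  | seq c c' ih ih' =>
    simp only [deg] at hW
    obtain ⟨b1, t₁, s₁, e1, l1, g1, o1⟩ := ih ((hpow (by omega)).trans_lt hW) hc.1 hρ h1 hA s hs
    obtain ⟨b2, t₂, s₂, e2, l2, g2, o2⟩ := ih' ((hpow (by omega)).trans_lt hW) hc.2 hρ h1 b1 s₁ g1
    have hrun : c'.run I ρ ((c.run I ρ (A, s.out)).1, s₁.out) =
        (seq c c').run I ρ (A, s.out) := by
      rw [o1]; rfl
    rw [hrun] at b2 g2 o2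
    exact ⟨b2, _, _, .seq e1 e2, Nat.add_le_add l1 l2, g2, o2⟩
  | loop i a c ih =>
    obtain ⟨hi5, ha5, hi0, hbody⟩ := hc
    have hi9 := i.2
    have hai : a ≠ i := fun e => absurd hi5 (not_le.2 (e ▸ ha5))
    have h4i : (4 : Fin 9) ≠ i := fun e => absurd hi5 (not_le.2 (e ▸ by decide))
    have h2i : (2 : Fin 9) ≠ i := fun e => absurd hi5 (not_le.2 (e ▸ by decide))
    have hUW : U < W := by
      have : X ^ 1 ≤ X ^ (loop i a c).deg := hpow (by simp [deg])
      rw [pow_one] at this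
      omega
    set f := fun j => run I c (Function.update ρ i j) with hf
    have hval : ∀ {r r' : Fin 9}, r ≠ r' → (r : ℕ) ≠ r' := fun h e => h (Fin.ext e)
    -- the last `ρ a - j` rounds of the loop
    have main : ∀ d j, j + d = ρ a → ∀ s₁ : State, (∀ q v, (iter f j (A, s.out)).1 q v ≤ U) →
        Holds I (Function.update ρ i j) (iter f j (A, s.out)).1 s₁ →
        s₁.out = (iter f j (A, s.out)).2 →
        (∀ q v, (iter f (ρ a) (A, s.out)).1 q v ≤ U) ∧
        ∃ t s', Exec W (.whileLt i a (.seq c.compile (.arith .add i i 4))) s₁ t s' ∧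
          t ≤ d * (c.time ρ + 2) + 1 ∧
          Holds I (Function.update ρ i (ρ a)) (iter f (ρ a) (A, s.out)).1 s' ∧
          s'.out = (iter f (ρ a) (A, s.out)).2 := by
      intro d
      induction d with
      | zero =>
        intro j hj s₁ hb hh ho
        obtain rfl : j = ρ a := hj
        refine ⟨hb, 1, s₁, .whileFalse ?_, by omega, hh, ho⟩
        rw [hh.reg, hh.reg, Function.update_self, Function.update_of_ne hai]
        exact lt_irrefl _
      | succ d ihd =>
        intro j hj s₁ hb hh ho
        have hja : j < ρ a := by omega
        have hlt : s₁.reg i < s₁.reg a := by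
          rwa [hh.reg, hh.reg, Function.update_self, Function.update_of_ne hai]
        have hρ' : ∀ r, Function.update ρ i j r ≤ U := by
          intro r
          rw [Function.update_apply]
          split_ifs
          exacts [hja.le.trans (hρ a), hρ r]
        obtain ⟨b1, t₁, s₂, e1, l1, g1, o1⟩ := ih
          ((hpow (by simp [deg])).trans_lt hW) (hbody j hja) hρ'
          (by rw [Function.update_of_ne h4i, h1]) hb s₁ hh
        have hit : c.run I (Function.update ρ i j) ((iter f j (A, s.out)).1, s₁.out) =
            iter f (j + 1) (A, s.out) := by
          rw [ho]; rfl
        rw [hit] at b1 g1 o1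
        have hsum : Op.add.eval (s₂.reg i) (s₂.reg 4) = j + 1 := by
          have e4 := g1.reg 4
          rw [Function.update_of_ne h4i, h1] at e4
          have ei := g1.reg i
          rw [Function.update_self] at ei
          rw [ei]
          exact congrArg (j + ·) e4
        have htime : c.time (Function.update ρ i j) = c.time ρ :=
          time_congr (hbody j hja) fun r hr => Function.update_of_ne
            (fun e => by subst e; exact absurd hi5 (not_le.2 hr)) _ _
        obtain ⟨b3, t₃, s₃, e3, l3, g3, o3⟩ := ihd (j + 1) (by omega)
          { s₂ with reg := Function.update s₂.reg i (Op.add.eval (s₂.reg i) (s₂.reg 4)) } b1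
          ⟨fun r => by
            by_cases hri : r = i
            · subst hri; simp [hsum]
            · simp only [Function.update_of_ne hri, Function.update_of_ne (hval hri)]
              rw [g1.reg, Function.update_of_ne hri],
            by
              rw [Function.update_of_ne h2i]
              have := g1.mem
              rwa [Function.update_of_ne h2i] at this⟩ o1
        refine ⟨b3, _, _, .whileTrue hlt (.seq e1 (.arith _ _ _ _ _ ?_)) e3, ?_, g3, o3⟩
        · rw [hsum]
          have := hρ a
          omega
        · rw [htime] at l1
          rw [add_mul]
          omega
    obtain ⟨b, t, s', e, l, g, o⟩ := main (ρ a) 0 (by omega) s hA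
      (by
        have h0 : Function.update ρ i 0 = ρ := by
          conv_lhs => rw [← hi0]
          exact Function.update_eq_self i ρ
        rw [h0]
        exact hs) rfl
    refine ⟨b, _, { s' with reg := Function.update s'.reg i 0 },
      .seq e (.const _ _ _ (by omega)), ?_, ⟨fun r => ?_, ?_⟩, o⟩
    · simp only [time]; omega
    · by_cases hri : r = i
      · subst hri; simp [hi0]
      · simp only [Function.update_of_ne (hval hri)]
        rw [g.reg, Function.update_of_ne hri]
    · have := g.mem
      rwa [Function.update_of_ne h2i] at this

end Cmd
end Exec
end Language

/-! ### Building blocks of the program -/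

section Blocks

theorem iter_induction {α : Type*} {f : ℕ → α → α} (P : ℕ → α → Prop) {x : α} {n : ℕ} (h0 : P 0 x)
    (h : ∀ j < n, ∀ y, P j y → P (j + 1) (f j y)) : P n (iter f n x) := by
  induction n with
  | zero => exact h0
  | succ n ih => exact h n (by omega) _ (ih fun j hj => h j (by omega))

namespace Expr

/-- `1` if the values are equal, and `0` otherwise. -/
def eq (a b : Expr) : Expr := op .sub (const 1) (op .add (op .sub a b) (op .sub b a))

/-- `1` if the value is positive, and `0` otherwise. -/
def pos (a : Expr) : Expr := op .sub (const 1) (op .sub (const 1) a)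

/-- `1` if `a ≤ b`, and `0` otherwise. -/
def le (a b : Expr) : Expr := op .sub (const 1) (op .sub a b)

/-- The smaller of two values. -/
def min (a b : Expr) : Expr := op .sub a (op .sub a b)

/-- The `j`-th power of the number of vertices. -/
def pow : ℕ → Expr
  | 0 => const 1
  | j + 1 => op .mul (pow j) (reg 0)

/-- The `j`-th entry of the current tuple: a digit, to the base of the number of vertices, of
register `5`. -/
def digit (j : ℕ) : Expr := op .mod (op .div (reg 5) (pow j)) (reg 0)

/-- The number of `j` with `a ≤ j < a + b` for which register `6` holds the `j`-th entry of the
current tuple. -/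
def count (a : ℕ) : ℕ → Expr
  | 0 => const 0
  | b + 1 => op .add (count a b) (eq (reg 6) (digit (a + b)))

/-- The first end of the current edge, whose number is held by register `8`. -/
def fst : Expr := inp (op .add (const 2) (op .mul (const 2) (reg 8)))

/-- The second end of the current edge. -/
def snd : Expr := inp (op .add (const 3) (op .mul (const 2) (reg 8)))

variable {I : ℕ → ℕ} {A : Fin 16 → ℕ → ℕ} {ρ : Fin 9 → ℕ}

theorem eval_eq (a b : Expr) :
    (eq a b).eval I A ρ = if a.eval I A ρ = b.eval I A ρ then 1 else 0 := by
  simp only [eq, eval, Op.eval]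
  split_ifs <;> omega

theorem eval_pos (a : Expr) : (pos a).eval I A ρ = if a.eval I A ρ = 0 then 0 else 1 := by
  simp only [pos, eval, Op.eval]
  split_ifs <;> omega

theorem eval_le (a b : Expr) :
    (le a b).eval I A ρ = if a.eval I A ρ ≤ b.eval I A ρ then 1 else 0 := by
  simp only [le, eval, Op.eval]
  split_ifs <;> omega

theorem eval_min (a b : Expr) :
    (min a b).eval I A ρ = Min.min (a.eval I A ρ) (b.eval I A ρ) := by
  simp only [min, eval, Op.eval]
  omega

theorem eval_pow (j : ℕ) : (pow j).eval I A ρ = ρ 0 ^ j := by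
  induction j with
  | zero => rfl
  | succ j ih =>
    show (pow j).eval I A ρ * ρ 0 = _
    rw [ih, pow_succ]

theorem eval_digit (j : ℕ) : (digit j).eval I A ρ = ρ 5 / ρ 0 ^ j % ρ 0 := by
  rw [← eval_pow (I := I) (A := A)]
  rfl

theorem eval_count (a b : ℕ) :
    (count a b).eval I A ρ ≠ 0 ↔ ∃ j, a ≤ j ∧ j < a + b ∧ ρ 6 = ρ 5 / ρ 0 ^ j % ρ 0 := by
  induction b with
  | zero => simpa [count, eval] using fun j h1 h2 => absurd h2 (by omega)
  | succ b ih =>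
    have h : (count a (b + 1)).eval I A ρ =
        (count a b).eval I A ρ + (eq (reg 6) (digit (a + b))).eval I A ρ := rfl
    rw [h, eval_eq, eval_digit, Ne, Nat.add_eq_zero_iff, not_and_or, ← Ne, ih]
    show _ ∨ ¬ (if ρ 6 = _ then 1 else 0) = 0 ↔ _
    constructor
    · rintro (⟨j, h1, h2, h3⟩ | h1)
      · exact ⟨j, h1, by omega, h3⟩
      · refine ⟨a + b, by omega, by omega, ?_⟩
        by_contra hne
        simp [hne] at h1
    · rintro ⟨j, h1, h2, h3⟩
      rcases Nat.lt_or_ge j (a + b) with h4 | h4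
      · exact .inl ⟨j, h1, h4, h3⟩
      · obtain rfl : j = a + b := by omega
        exact .inr (by simp [h3])

end Expr

namespace Cmd

/-- Fill the array `q`, up to the number of vertices. -/
def fill (q : Fin 16) (e : Expr) : Cmd := loop 6 0 (store q (.reg 6) e)

/-- For both directions of every edge, replace the value of the array `q` at the second end `b` by
`f a b`. -/
def sweep (q : Fin 16) (f : Expr → Expr → Expr) : Cmd :=
  loop 8 1 (seq (store q .snd (f .fst .snd)) (store q .fst (f .snd .fst)))

/-- Mark in the array `q` the neighbours of the vertices that are marked in the array `s`. -/
def gather (q s : Fin 16) : Cmd := sweep q fun a b => .pos (.op .add (.arr q b) (.arr s a))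

/-- One round of the algorithm of Bellman and Ford, for the array `q` of distances. The array `6`
holds the costs of entering the vertices. -/
def relax (q : Fin 16) : Cmd :=
  sweep q fun a b => .min (.arr q b) (.op .add (.arr q a) (.arr 6 b))

/-- The algorithm of Bellman and Ford, from the `j`-th entry of the current tuple. -/
def distances (q : Fin 16) (j : ℕ) : Cmd :=
  seq (fill q (.op .mul (.reg 0) (.op .sub (.const 1) (.eq (.reg 6) (.digit j)))))
    (loop 7 0 (relax q))

end Cmd

/-- The registers and the input while the program runs for a graph with `n` vertices and edges
`es`. -/
structure Setting {n : ℕ} (es : List (Fin n × Fin n)) (I : ℕ → ℕ) (ρ : Fin 9 → ℕ) : Prop where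
  vertices : ρ 0 = n
  edges : ρ 1 = es.length
  start : ρ 2 = 2 + 2 * es.length
  fst : ∀ (e : ℕ) (he : e < es.length), I (2 + 2 * e) = (es[e].1 : ℕ)
  snd : ∀ (e : ℕ) (he : e < es.length), I (3 + 2 * e) = (es[e].2 : ℕ)

section Specs

variable {n : ℕ} {es : List (Fin n × Fin n)} {I : ℕ → ℕ} {ρ : Fin 9 → ℕ}
  {A : Fin 16 → ℕ → ℕ} {o : List ℕ}

theorem Setting.update (S : Setting es I ρ) {i : Fin 9} (hi : 5 ≤ i) (j : ℕ) :
    Setting es I (Function.update ρ i j) := by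
  have h : ∀ r : Fin 9, r < 5 → Function.update ρ i j r = ρ r := fun r hr =>
    Function.update_of_ne (fun e => by subst e; exact absurd hi (not_le.2 hr)) _ _
  exact ⟨(h 0 (by decide)).trans S.vertices, (h 1 (by decide)).trans S.edges,
    (h 2 (by decide)).trans S.start, S.fst, S.snd⟩

theorem Setting.eval_fst (S : Setting es I ρ) (A : Fin 16 → ℕ → ℕ) {e : ℕ} (he : e < es.length) :
    Expr.fst.eval I A (Function.update ρ 8 e) = (es[e].1 : ℕ) := by
  have h2 : Function.update ρ 8 e 2 = 2 + 2 * es.length := by simp [S.start]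
  show layout (Function.update ρ 8 e 2) I A (2 + 2 * Function.update ρ 8 e 8) = _
  rw [h2, Function.update_self, layout_of_lt (by omega), S.fst e he]

theorem Setting.eval_snd (S : Setting es I ρ) (A : Fin 16 → ℕ → ℕ) {e : ℕ} (he : e < es.length) :
    Expr.snd.eval I A (Function.update ρ 8 e) = (es[e].2 : ℕ) := by
  have h2 : Function.update ρ 8 e 2 = 2 + 2 * es.length := by simp [S.start]
  show layout (Function.update ρ 8 e 2) I A (3 + 2 * Function.update ρ 8 e 8) = _
  rw [h2, Function.update_self, layout_of_lt (by omega), S.snd e he]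

/-- An expression that does not read the array that is being filled. -/
theorem Setting.run_fill (S : Setting es I ρ) {q : Fin 16} {e : Expr} {g : Fin n → ℕ}
    (he : ∀ B : Fin 16 → ℕ → ℕ, (∀ q' ≠ q, B q' = A q') → ∀ v : Fin n,
      e.eval I B (Function.update ρ 6 v) = g v) :
    ∃ B : Fin 16 → ℕ → ℕ, (Cmd.fill q e).run I ρ (A, o) = (B, o) ∧ (∀ q' ≠ q, B q' = A q') ∧
      ∀ v : Fin n, B q v = g v := by
  have key := iter_induction (f := fun j => Cmd.run I (.store q (.reg 6) e)
    (Function.update ρ 6 j)) (x := (A, o)) (n := n)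
    (fun j y => y.2 = o ∧ (∀ q' ≠ q, y.1 q' = A q') ∧ ∀ v : Fin n, (v : ℕ) < j → y.1 q v = g v)
    ⟨rfl, fun _ _ => rfl, fun v hv => by omega⟩ (by
    rintro j hj ⟨B, o'⟩ ⟨h1, h2, h3⟩
    have hrun : Cmd.run I (.store q (.reg 6) e) (Function.update ρ 6 j) (B, o') =
        (put B q j (g ⟨j, hj⟩), o') := by
      show (put B q (Function.update ρ 6 j 6) (e.eval I B (Function.update ρ 6 j)), o') = _
      rw [Function.update_self, ← he B h2 ⟨j, hj⟩]
    rw [hrun]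
    refine ⟨h1, fun q' hq' => ?_, fun v hv => ?_⟩
    · funext v
      show put B q j _ q' v = _
      rw [put_apply, if_neg (fun h => hq' h.1), show B q' = A q' from h2 q' hq']
    · show put B q j _ q v = _
      rw [put_apply]
      split_ifs with h
      · congr 1
        exact Fin.ext h.2.symm
      · exact h3 v (by have : (v : ℕ) ≠ j := fun e => h ⟨rfl, e⟩
                       omega))
  have hrun : (Cmd.fill q e).run I ρ (A, o) = iter (fun j => Cmd.run I (.store q (.reg 6) e)
      (Function.update ρ 6 j)) n (A, o) := by
    rw [← S.vertices]; rfl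
  rw [hrun]
  exact ⟨_, Prod.ext rfl key.1, key.2.1, fun v => key.2.2 v v.2⟩

variable {G : SimpleGraph (Fin n)}

theorem IsEdgeOrder.adj_iff (h : IsEdgeOrder G es) {u v : Fin n} :
    G.Adj u v ↔ ∃ (e : ℕ) (he : e < es.length), es[e] = (u, v) ∨ es[e] = (v, u) := by
  rw [h.2, List.mem_map]
  constructor
  · rintro ⟨a, ha, e⟩
    obtain ⟨i, hi, rfl⟩ := List.getElem_of_mem ha
    refine ⟨i, hi, ?_⟩
    rw [Sym2.eq_iff] at e
    rcases e with ⟨h1, h2⟩ | ⟨h1, h2⟩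
    exacts [.inl (Prod.ext h1 h2), .inr (Prod.ext h1 h2)]
  · rintro ⟨i, hi, e | e⟩
    · exact ⟨_, List.getElem_mem hi, by rw [e]⟩
    · exact ⟨_, List.getElem_mem hi, by rw [e, Sym2.eq_swap]⟩

/-- An invariant of the array `q` during a sweep, in terms of the set of pairs of adjacent vertices
that have been processed. -/
theorem Setting.run_sweep (S : Setting es I ρ) (hes : IsEdgeOrder G es) {q : Fin 16}
    {f : Expr → Expr → Expr} {φ : (Fin n → ℕ) → Fin n → Fin n → ℕ}
    (hf : ∀ B : Fin 16 → ℕ → ℕ, (∀ q' ≠ q, B q' = A q') → ∀ (ρ' : Fin 9 → ℕ) (x y : Expr)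
      (a b : Fin n), x.eval I B ρ' = a → y.eval I B ρ' = b →
      (f x y).eval I B ρ' = φ (fun v => B q v) a b)
    {P : Set (Fin n × Fin n) → (Fin n → ℕ) → Prop} (h0 : P ∅ fun v => A q v)
    (hP : ∀ D T a b, G.Adj a b → P D T → P (insert (a, b) D) (Function.update T b (φ T a b))) :
    ∃ B : Fin 16 → ℕ → ℕ, (Cmd.sweep q f).run I ρ (A, o) = (B, o) ∧ (∀ q' ≠ q, B q' = A q') ∧
      P {p | G.Adj p.1 p.2} fun v => B q v := by
  set F := fun j => Cmd.run I (.seq (.store q .snd (f .fst .snd)) (.store q .fst (f .snd .fst)))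
    (Function.update ρ 8 j) with hF
  have hput : ∀ (B : Fin 16 → ℕ → ℕ) (b : Fin n) (x : ℕ),
      (fun v : Fin n => put B q b x q v) = Function.update (fun v : Fin n => B q v) b x := by
    intro B b x
    funext v
    rw [put_apply, Function.update_apply]
    simp only [true_and, Fin.val_inj]
  have key := iter_induction (f := F) (x := (A, o)) (n := es.length)
    (fun j y => y.2 = o ∧ (∀ q' ≠ q, y.1 q' = A q') ∧
      P {p | ∃ (e : ℕ) (he : e < es.length), e < j ∧ (es[e] = p ∨ es[e] = p.swap)}
        fun v => y.1 q v)
    ⟨rfl, fun _ _ => rfl, by convert h0; simp⟩ (by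
    rintro j hj ⟨B, o'⟩ ⟨h1, h2, h3⟩
    simp only at h1 h2 h3
    have hadj : G.Adj es[j].1 es[j].2 := hes.adj_iff.2 ⟨j, hj, .inl rfl⟩
    set B₁ := put B q es[j].2 (φ (fun v => B q v) es[j].1 es[j].2) with hB₁
    have hB₁q : ∀ q' ≠ q, B₁ q' = A q' := fun q' hq' => by
      funext v
      rw [hB₁, put_apply, if_neg fun h => hq' h.1, h2 q' hq']
    have e1 : Cmd.run I (.store q .snd (f .fst .snd)) (Function.update ρ 8 j) (B, o') =
        (B₁, o') := by
      rw [hB₁, ← hf B h2 (Function.update ρ 8 j) .fst .snd _ _ (S.eval_fst B hj) (S.eval_snd B hj),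
        ← S.eval_snd B hj]
      rfl
    have e2 : Cmd.run I (.store q .fst (f .snd .fst)) (Function.update ρ 8 j) (B₁, o') =
        (put B₁ q es[j].1 (φ (fun v => B₁ q v) es[j].2 es[j].1), o') := by
      rw [← hf B₁ hB₁q (Function.update ρ 8 j) .snd .fst _ _ (S.eval_snd B₁ hj) (S.eval_fst B₁ hj),
        ← S.eval_fst B₁ hj]
      rfl
    have e3 : F j (B, o') = (put B₁ q es[j].1 (φ (fun v => B₁ q v) es[j].2 es[j].1), o') := by
      rw [← e2, ← e1]
      rfl
    rw [e3]
    refine ⟨h1, fun q' hq' => ?_, ?_⟩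
    · funext v
      show put B₁ q _ _ q' v = _
      rw [put_apply, if_neg fun h => hq' h.1, hB₁q q' hq']
    · have h4 := hP _ _ _ _ hadj h3
      rw [← hput] at h4
      have h5 := hP _ _ _ _ hadj.symm h4
      rw [← hput] at h5
      convert h5 using 1
      ext ⟨u, w⟩
      simp only [Set.mem_ofPred_eq, Set.mem_insert_iff, Prod.swap_prod_mk, Prod.mk.injEq]
      constructor
      · rintro ⟨e, he, hej, h⟩
        rcases Nat.lt_or_ge e j with hlt | hge
        · exact .inr (.inr ⟨e, he, hlt, h⟩)
        · obtain rfl : e = j := by omega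
          rcases h with h | h
          · exact .inr (.inl ⟨by rw [h], by rw [h]⟩)
          · exact .inl ⟨by rw [h], by rw [h]⟩
      · rintro (⟨rfl, rfl⟩ | ⟨rfl, rfl⟩ | ⟨e, he, hlt, h⟩)
        exacts [⟨j, hj, by omega, .inr rfl⟩, ⟨j, hj, by omega, .inl rfl⟩,
          ⟨e, he, by omega, h⟩])
  have hrun : (Cmd.sweep q f).run I ρ (A, o) = iter F es.length (A, o) := by
    rw [← S.edges]; rfl
  rw [hrun]
  refine ⟨_, Prod.ext rfl key.1, key.2.1, ?_⟩
  convert key.2.2 using 1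
  ext ⟨u, w⟩
  simp only [Set.mem_ofPred_eq, Prod.swap_prod_mk]
  rw [hes.adj_iff]
  exact exists_congr fun e => ⟨fun ⟨h1, h2⟩ => ⟨h1, h1, h2⟩, fun ⟨h1, _, h2⟩ => ⟨h1, h2⟩⟩

theorem Setting.run_gather (S : Setting es I ρ) (hes : IsEdgeOrder G es) {q s : Fin 16}
    (hqs : s ≠ q) (h0 : ∀ v : Fin n, A q v = 0) :
    ∃ B : Fin 16 → ℕ → ℕ, (Cmd.gather q s).run I ρ (A, o) = (B, o) ∧ (∀ q' ≠ q, B q' = A q') ∧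
      ∀ v : Fin n, B q v = 0 ↔ ∀ w : Fin n, G.Adj v w → A s w = 0 := by
  obtain ⟨B, h1, h2, h3⟩ := S.run_sweep (A := A) (o := o) hes (q := q)
    (f := fun a b => .pos (.op .add (.arr q b) (.arr s a)))
    (φ := fun T a b => if T b + A s a = 0 then 0 else 1)
    (P := fun D T => ∀ v, T v = 0 ↔ ∀ w : Fin n, (w, v) ∈ D → A s w = 0)
    (fun B hB ρ' x y a b hx hy => by
      rw [Expr.eval_pos]
      simp only [Expr.eval, Op.eval, hx, hy, hB s hqs])
    (fun v => by simp [h0]) (fun D T a b _ hT v => by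
      rw [Function.update_apply]
      by_cases hvb : v = b
      · subst hvb
        have hTv := hT v
        simp only [if_true, Set.mem_insert_iff, Prod.mk.injEq, and_true]
        constructor
        · intro h w hw
          have h4 : T v + A s a = 0 := by
            by_contra hne
            rw [if_neg hne] at h
            exact one_ne_zero h
          rcases hw with rfl | hw
          · omega
          · exact hTv.1 (by omega) w hw
        · intro h
          rw [if_pos]
          rw [h a (.inl rfl), hTv.2 fun w hw => h w (.inr hw)]
      · simp [hvb, hT v])
  refine ⟨B, h1, h2, fun v => (h3 v).trans ?_⟩
  simp only [Set.mem_ofPred_eq, G.adj_comm]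

theorem Reach.exists_of_succ {V : Type*} {G : SimpleGraph V} {S : Set V} {m : ℕ} {u v : V}
    (h : Reach G S (m + 1) u v) : ∃ w, Reach G S m u w ∧ G.Adj w v ∧ v ∈ S := by
  obtain ⟨f, hf, h0, rfl⟩ := h
  exact ⟨f m, ⟨f, hf.mono (by omega) fun i hi => hf.mem i (by omega), h0, rfl⟩, hf.adj m (by omega),
    hf.mem _ le_rfl⟩

theorem Setting.run_relax (S : Setting es I ρ) (hes : IsEdgeOrder G es) {q : Fin 16} (hq : 6 ≠ q)
    {Z : Set (Fin n)} {u : Fin n} (hZ : ∀ v : Fin n, v ∈ Z → A 6 v = 1)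
    (hZ' : ∀ v : Fin n, v ∉ Z → n ≤ A 6 v)
    (hr : ∀ v : Fin n, A q v < n → Reach G Z (A q v) u v) {r : ℕ}
    (hc : ∀ v : Fin n, ∀ m ≤ r, Reach G Z m u v → A q v ≤ m) :
    ∃ B : Fin 16 → ℕ → ℕ, (Cmd.relax q).run I ρ (A, o) = (B, o) ∧ (∀ q' ≠ q, B q' = A q') ∧
      (∀ v : Fin n, B q v ≤ A q v) ∧ (∀ v : Fin n, B q v < n → Reach G Z (B q v) u v) ∧
      ∀ v : Fin n, ∀ m ≤ r + 1, Reach G Z m u v → B q v ≤ m := by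
  obtain ⟨B, h1, h2, h3, h4, h5⟩ := S.run_sweep (A := A) (o := o) hes (q := q)
    (f := fun a b => .min (.arr q b) (.op .add (.arr q a) (.arr 6 b)))
    (φ := fun T a b => Min.min (T b) (T a + A 6 b))
    (P := fun D T => (∀ v, T v < n → Reach G Z (T v) u v) ∧ (∀ v : Fin n, T v ≤ A q v) ∧
      ∀ p ∈ D, T p.2 ≤ A q p.1 + A 6 p.2)
    (fun B hB ρ' x y a b hx hy => by
      rw [Expr.eval_min]
      simp only [Expr.eval, Op.eval, hx, hy, hB 6 hq])
    ⟨hr, fun _ => le_rfl, by simp⟩ (fun D T a b hab hT => by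
      obtain ⟨i1, i2, i3⟩ := hT
      have hle : ∀ v, Function.update T b (Min.min (T b) (T a + A 6 b)) v ≤ T v := fun v => by
        rw [Function.update_apply]
        split_ifs with h
        · rw [h]; exact min_le_left _ _
        · exact le_rfl
      refine ⟨fun v => ?_, fun v => (hle v).trans (i2 v), fun p hp => ?_⟩
      · rw [Function.update_apply]
        split_ifs with h
        · subst h
          rcases min_choice (T v) (T a + A 6 v) with e | e
          · rw [e]; exact i1 v
          · rw [e]
            intro hlt
            by_cases hv : v ∈ Z
            · rw [hZ v hv] at hlt ⊢
              exact (i1 a (by omega)).succ hab hv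
            · have := hZ' v hv
              omega
        · exact i1 v
      · rcases hp with rfl | hp
        · simp only [Function.update_self]
          exact (min_le_right _ _).trans (Nat.add_le_add_right (i2 a) _)
        · exact (hle _).trans (i3 p hp))
  refine ⟨B, h1, h2, h4, h3, fun v m hm hreach => ?_⟩
  rcases Nat.eq_zero_or_pos m with rfl | hpos
  · exact (h4 v).trans (hc v 0 (by omega) hreach)
  · obtain ⟨m, rfl⟩ : ∃ m', m = m' + 1 := ⟨m - 1, by omega⟩
    obtain ⟨w, hw, hwv, hv⟩ := hreach.exists_of_succ
    have : B q v ≤ A q w + A 6 v := h5 (w, v) hwv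
    rw [hZ v hv] at this
    have := hc w m (by omega) hw
    omega

/-- The distances inside a set `Z` from a vertex of `Z`. -/
theorem Setting.run_distances (S : Setting es I ρ) (hes : IsEdgeOrder G es) {q : Fin 16}
    (hq : 6 ≠ q) {j : ℕ} {Z : Set (Fin n)} {u : Fin n} (hu : u ∈ Z)
    (hju : (u : ℕ) = ρ 5 / n ^ j % n) (hZ : ∀ v : Fin n, v ∈ Z → A 6 v = 1)
    (hZ' : ∀ v : Fin n, v ∉ Z → n ≤ A 6 v) :
    ∃ B : Fin 16 → ℕ → ℕ, (Cmd.distances q j).run I ρ (A, o) = (B, o) ∧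
      (∀ q' ≠ q, B q' = A q') ∧ IsDist G Z n u fun v => B q v := by
  obtain ⟨A₁, e1, h1, h2⟩ := S.run_fill (A := A) (o := o) (q := q)
    (e := .op .mul (.reg 0) (.op .sub (.const 1) (.eq (.reg 6) (.digit j))))
    (g := fun v => if v = u then 0 else n) (fun B _ v => by
      have h0 : Function.update ρ 6 (v : ℕ) 0 = n := by simp [S.vertices]
      have h5 : Function.update ρ 6 (v : ℕ) 5 = ρ 5 := by simp
      simp only [Expr.eval, Op.eval, Expr.eval_eq, Expr.eval_digit, h0, h5, Function.update_self,
        ← hju, Fin.val_inj]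
      split_ifs <;> simp)
  have key := iter_induction (f := fun j => Cmd.run I (Cmd.relax q) (Function.update ρ 7 j))
    (x := (A₁, o)) (n := n)
    (fun r y => y.2 = o ∧ (∀ q' ≠ q, y.1 q' = A q') ∧ (∀ v : Fin n, y.1 q v ≤ n) ∧
      (∀ v : Fin n, y.1 q v < n → Reach G Z (y.1 q v) u v) ∧
      ∀ v : Fin n, ∀ m ≤ r, Reach G Z m u v → y.1 q v ≤ m)
    ⟨rfl, h1, fun v => by show A₁ q v ≤ n; rw [h2]; split_ifs <;> simp, fun v => by
      show A₁ q v < n → Reach G Z (A₁ q v) u v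
      rw [h2]
      split_ifs with h
      · subst h
        exact fun _ => Reach.refl hu
      · exact fun h => absurd h (lt_irrefl _), fun v m hm hr => by
      obtain rfl : m = 0 := by omega
      obtain ⟨f, hf, h3, h4⟩ := hr
      show A₁ q v ≤ 0
      rw [h2, if_pos (h4.symm.trans h3)]⟩ (by
    rintro j hj ⟨B, o'⟩ ⟨i1, i2, i3, i4, i5⟩
    simp only at i1 i2 i3 i4 i5
    obtain ⟨B', e', k1, k2, k3, k4⟩ := (S.update (i := 7) (by decide) j).run_relax (A := B)
      (o := o') hes hq (Z := Z) (u := u) (r := j) (by rwa [i2 6 hq]) (by rwa [i2 6 hq]) i4 i5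
    simp only [e']
    exact ⟨i1, fun q' hq' => (k1 q' hq').trans (i2 q' hq'), fun v => (k2 v).trans (i3 v), k3, k4⟩)
  have hrun : (Cmd.distances q j).run I ρ (A, o) =
      iter (fun j => Cmd.run I (Cmd.relax q) (Function.update ρ 7 j)) n (A₁, o) := by
    rw [← S.vertices, ← e1]; rfl
  rw [hrun]
  refine ⟨_, Prod.ext rfl key.1, key.2.1, key.2.2.2.1, fun v m hm => ?_⟩
  rcases le_total m n with h | h
  · exact key.2.2.2.2 v m h hm
  · exact (key.2.2.1 v).trans h

end Specs
end Blocks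

/-! ### The set marked by a tuple -/

section Tuple

namespace Cmd

/-- Set the entries of the array `q` to one at the vertices among the entries of the current tuple
with indices from `a` to `a + b - 1`, and to zero at all others. -/
def role (q : Fin 16) (a b : ℕ) : Cmd := fill q (.pos (.count a b))

/-- Mark in the array `q`, which need not be empty before, the neighbours of the vertices that are
marked in the array `s`. -/
def neighbors (q s : Fin 16) : Cmd := seq (fill q (.const 0)) (gather q s)

/-- Set the array `6` to the costs of entering the vertices: one in the zone of the current tuple,
and more than the number of vertices outside. -/
def costs : Cmd :=
  fill 6 (.op .add (.const 1) (.op .mul (.reg 0) (.op .sub (.const 1)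
    (.op .add (.op .sub (.op .sub (.const 1) (.arr 0 (.reg 6)))
      (.op .add (.arr 4 (.reg 6)) (.arr 5 (.reg 6)))) (.arr 3 (.reg 6))))))

/-- Mark in the array `10` the vertices on shortest paths between consecutive sources. -/
def between (ℓ : ℕ) : Cmd :=
  fill 10 (.op .add
    (.le (.op .add (.arr 7 (.reg 6)) (.arr 8 (.reg 6))) (.arr 7 (.digit (4 * ℓ - 6))))
    (.le (.op .add (.arr 8 (.reg 6)) (.arr 9 (.reg 6))) (.arr 8 (.digit (4 * ℓ - 5)))))

/-- Write the characteristic vector of the set of vertices that are marked by the current tuple. -/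
def output : Cmd :=
  loop 6 0 (write (.op .mul (.op .sub (.const 1) (.arr 0 (.reg 6)))
    (.pos (.op .add (.arr 4 (.reg 6)) (.op .mul (.arr 11 (.reg 6)) (.arr 5 (.reg 6)))))))

/-- Compute the set of vertices that are marked by the current tuple. The arrays hold: the entries
of the tuple other than the excluders (`0`), the hitters (`1`), the excluders (`2`), the allowed
vertices (`3`), the neighbours of hitters (`4`) and of excluders (`5`), the costs of entering the
vertices (`6`), the distances from the sources (`7`, `8`, `9`), the vertices on shortest paths
between the sources (`10`), and their neighbours (`11`). -/
def mark (ℓ : ℕ) : Cmd :=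
  seq (role 0 0 (4 * ℓ - 4)) <| seq (role 1 4 (4 * ℓ - 13)) <| seq (role 2 (4 * ℓ - 4) 2) <|
  seq (role 3 (3 * ℓ - 6) (ℓ + 2)) <| seq (neighbors 4 1) <| seq (neighbors 5 2) <| seq costs <|
  seq (distances 7 (4 * ℓ - 7)) <| seq (distances 8 (4 * ℓ - 6)) <|
  seq (distances 9 (4 * ℓ - 5)) <| seq (between ℓ) <| seq (neighbors 11 10) output

/-- Run through all tuples, whose number is held by register `3`. -/
def markAll (ℓ : ℕ) : Cmd := loop 5 3 (mark ℓ)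

end Cmd

variable {n : ℕ} {es : List (Fin n × Fin n)} {I : ℕ → ℕ} {ρ : Fin 9 → ℕ}
  {A : Fin 16 → ℕ → ℕ} {o : List ℕ} {τ : ℕ → Fin n} {G : SimpleGraph (Fin n)} {ℓ : ℕ}

theorem Setting.run_role (S : Setting es I ρ) (hτ : ∀ j, (τ j : ℕ) = ρ 5 / n ^ j % n) (q : Fin 16)
    (a b : ℕ) :
    ∃ B : Fin 16 → ℕ → ℕ, (Cmd.role q a b).run I ρ (A, o) = (B, o) ∧ (∀ q' ≠ q, B q' = A q') ∧
      ∀ v : Fin n, B q v ≤ 1 ∧ (B q v = 0 ↔ ∀ j, a ≤ j → j < a + b → v ≠ τ j) := by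
  classical
  obtain ⟨B, h1, h2, h3⟩ := S.run_fill (A := A) (o := o) (q := q) (e := .pos (.count a b))
    (g := fun v => if ∀ j, a ≤ j → j < a + b → v ≠ τ j then 0 else 1) (fun B _ v => by
      have h0 : Function.update ρ 6 (v : ℕ) 0 = n := by simp [S.vertices]
      have h5 : Function.update ρ 6 (v : ℕ) 5 = ρ 5 := by simp
      rw [Expr.eval_pos]
      refine if_congr ?_ rfl rfl
      rw [← not_iff_not, ← Ne, Expr.eval_count, h0, h5, Function.update_self]
      simp only [← hτ, Fin.val_inj]
      push Not
      rfl)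
  refine ⟨B, h1, h2, fun v => ?_⟩
  rw [h3]
  split_ifs with h
  exacts [⟨zero_le_one, iff_of_true rfl h⟩, ⟨le_rfl, iff_of_false (by simp) h⟩]

theorem Setting.run_neighbors (S : Setting es I ρ) (hes : IsEdgeOrder G es) {q s : Fin 16}
    (hqs : s ≠ q) :
    ∃ B : Fin 16 → ℕ → ℕ, (Cmd.neighbors q s).run I ρ (A, o) = (B, o) ∧
      (∀ q' ≠ q, B q' = A q') ∧ ∀ v : Fin n, B q v = 0 ↔ ∀ w : Fin n, G.Adj v w → A s w = 0 := by
  obtain ⟨A₁, e1, h1, h2⟩ := S.run_fill (A := A) (o := o) (q := q) (e := .const 0)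
    (g := fun _ => 0) (fun _ _ _ => rfl)
  obtain ⟨B, e2, h3, h4⟩ := S.run_gather (A := A₁) (o := o) hes hqs h2
  refine ⟨B, ?_, fun q' hq' => (h3 q' hq').trans (h1 q' hq'), by rwa [h1 s hqs] at h4⟩
  rw [← e2, ← e1]
  rfl

theorem Setting.run_output (S : Setting es I ρ) {g : Fin n → ℕ} {e : Expr}
    (hg : ∀ v : Fin n, e.eval I A (Function.update ρ 6 v) = g v) :
    (Cmd.loop 6 0 (.write e)).run I ρ (A, o) = (A, o ++ List.ofFn g) := by
  have key := iter_induction (f := fun j => Cmd.run I (.write e) (Function.update ρ 6 j))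
    (x := (A, o)) (n := n) (fun j y => y = (A, o ++ (List.ofFn g).take j)) (by simp) (by
    rintro j hj _ rfl
    show (A, o ++ (List.ofFn g).take j ++ [e.eval I A (Function.update ρ 6 j)]) = _
    rw [show e.eval I A (Function.update ρ 6 j) = g ⟨j, hj⟩ from hg ⟨j, hj⟩, List.append_assoc,
      List.take_add_one]
    simp [hj])
  have hrun : (Cmd.loop 6 0 (.write e)).run I ρ (A, o) =
      iter (fun j => Cmd.run I (.write e) (Function.update ρ 6 j)) n (A, o) := by
    rw [← S.vertices]; rfl
  rw [hrun, key]
  simp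

theorem Setting.run_mark (S : Setting es I ρ) (hes : IsEdgeOrder G es) (h6 : 6 ≤ ℓ)
    (hτ : ∀ j, (τ j : ℕ) = ρ 5 / n ^ j % n) :
    ∃ (B : Fin 16 → ℕ → ℕ) (X : Finset (Fin n)), (Cmd.mark ℓ).run I ρ (A, o) =
        (B, o ++ List.ofFn fun v => if v ∈ X then 1 else 0) ∧
      ∃ d₁ d₂ d₃, IsDist G (zone G ℓ τ) n (τ (4 * ℓ - 7)) d₁ ∧
        IsDist G (zone G ℓ τ) n (τ (4 * ℓ - 6)) d₂ ∧ IsDist G (zone G ℓ τ) n (τ (4 * ℓ - 5)) d₃ ∧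
        ∀ v, v ∈ X ↔ Marked G ℓ τ (Between ℓ τ d₁ d₂ d₃) v := by
  classical
  have hu : ∀ {i : Fin 9}, 6 ≤ i → ∀ v : ℕ, ∀ r < 6, Function.update ρ i v r = ρ r :=
    fun hi v r hr => Function.update_of_ne
      (fun e => by subst e; exact absurd hi (not_le.2 hr)) _ _
  obtain ⟨A₀, e0, k0, f0⟩ := S.run_role (A := A) (o := o) hτ 0 0 (4 * ℓ - 4)
  obtain ⟨A₁, e1, k1, f1⟩ := S.run_role (A := A₀) (o := o) hτ 1 4 (4 * ℓ - 13)
  obtain ⟨A₂, e2, k2, f2⟩ := S.run_role (A := A₁) (o := o) hτ 2 (4 * ℓ - 4) 2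
  obtain ⟨A₃, e3, k3, f3⟩ := S.run_role (A := A₂) (o := o) hτ 3 (3 * ℓ - 6) (ℓ + 2)
  obtain ⟨A₄, e4, k4, f4⟩ := S.run_neighbors (A := A₃) (o := o) hes (q := 4) (s := 1) (by decide)
  obtain ⟨A₅, e5, k5, f5⟩ := S.run_neighbors (A := A₄) (o := o) hes (q := 5) (s := 2) (by decide)
  -- the roles of the vertices
  have ball : ∀ v : Fin n, A₅ 0 v ≤ 1 ∧ (A₅ 0 v = 0 ↔ ∀ j < 4 * ℓ - 4, v ≠ τ j) := fun v => by
    rw [k5 0 (by decide), k4 0 (by decide), k3 0 (by decide), k2 0 (by decide), k1 0 (by decide)]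
    refine ⟨(f0 v).1, (f0 v).2.trans ?_⟩
    simp
  have allowed : ∀ v : Fin n,
      A₅ 3 v = 0 ↔ ∀ j, 3 * ℓ - 6 ≤ j → j < 4 * ℓ - 4 → v ≠ τ j := fun v => by
    rw [k5 3 (by decide), k4 3 (by decide)]
    rw [(f3 v).2, show 3 * ℓ - 6 + (ℓ + 2) = 4 * ℓ - 4 by omega]
  have hit : ∀ v : Fin n, A₅ 4 v = 0 ↔ ∀ j, 4 ≤ j → j < 4 * ℓ - 9 → ¬ G.Adj v (τ j) := fun v => by
    rw [k5 4 (by decide), f4]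
    have h1 : ∀ w : Fin n, A₃ 1 w = 0 ↔ ∀ j, 4 ≤ j → j < 4 * ℓ - 9 → w ≠ τ j := fun w => by
      rw [k3 1 (by decide), k2 1 (by decide), (f1 w).2,
        show 4 + (4 * ℓ - 13) = 4 * ℓ - 9 by omega]
    simp only [h1]
    exact ⟨fun h j h1 h2 h3 => h _ h3 j h1 h2 rfl, fun h w hw j h1 h2 e => h j h1 h2 (e ▸ hw)⟩
  have excl : ∀ v : Fin n,
      A₅ 5 v = 0 ↔ ¬ G.Adj v (τ (4 * ℓ - 4)) ∧ ¬ G.Adj v (τ (4 * ℓ - 3)) := fun v => by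
    rw [f5]
    have h1 : ∀ w : Fin n, A₄ 2 w = 0 ↔ w ≠ τ (4 * ℓ - 4) ∧ w ≠ τ (4 * ℓ - 3) := fun w => by
      rw [k4 2 (by decide), k3 2 (by decide), (f2 w).2]
      refine ⟨fun h => ⟨h _ (by omega) (by omega), h _ (by omega) (by omega)⟩, fun h j h1 h2 => ?_⟩
      rcases (show j = 4 * ℓ - 4 ∨ j = 4 * ℓ - 3 by omega) with rfl | rfl
      exacts [h.1, h.2]
    simp only [h1]
    exact ⟨fun h => ⟨fun h3 => (h _ h3).1 rfl, fun h3 => (h _ h3).2 rfl⟩,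
      fun h w hw => ⟨fun e => h.1 (e ▸ hw), fun e => h.2 (e ▸ hw)⟩⟩
  have mem_zone : ∀ v : Fin n, v ∈ zone G ℓ τ ↔
      (A₅ 0 v = 0 ∧ A₅ 4 v = 0 ∧ A₅ 5 v = 0) ∨ A₅ 3 v ≠ 0 := fun v => by
    rw [(ball v).2, hit, excl, Ne, allowed]
    push Not
    rfl
  obtain ⟨A₆, e6, k6, f6⟩ := S.run_fill (A := A₅) (o := o) (q := 6)
    (e := .op .add (.const 1) (.op .mul (.reg 0) (.op .sub (.const 1)
      (.op .add (.op .sub (.op .sub (.const 1) (.arr 0 (.reg 6)))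
      (.op .add (.arr 4 (.reg 6)) (.arr 5 (.reg 6)))) (.arr 3 (.reg 6))))))
    (g := fun v => 1 + n * (1 - (1 - A₅ 0 v - (A₅ 4 v + A₅ 5 v) + A₅ 3 v))) (fun B hB v => by
      simp only [Expr.eval, Op.eval, hu le_rfl v 0 (by decide), S.vertices, Function.update_self,
        hB 0 (by decide), hB 4 (by decide), hB 5 (by decide), hB 3 (by decide)])
  have inside : ∀ v : Fin n, v ∈ zone G ℓ τ → A₆ 6 v = 1 := fun v hv => by
    rw [mem_zone] at hv
    rw [f6, show 1 - (1 - A₅ 0 v - (A₅ 4 v + A₅ 5 v) + A₅ 3 v) = 0 by omega]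
    simp
  have outside : ∀ v : Fin n, v ∉ zone G ℓ τ → n ≤ A₆ 6 v := fun v hv => by
    rw [mem_zone] at hv
    have := (ball v).1
    rw [f6, show 1 - (1 - A₅ 0 v - (A₅ 4 v + A₅ 5 v) + A₅ 3 v) = 1 by omega]
    omega
  have source : ∀ j, 3 * ℓ - 6 ≤ j → j < 4 * ℓ - 4 → τ j ∈ zone G ℓ τ :=
    fun j h1 h2 => .inr ⟨j, h1, h2, rfl⟩
  obtain ⟨A₇, e7, k7, f7⟩ := S.run_distances (A := A₆) (o := o) hes (q := 7) (by decide)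
    (source (4 * ℓ - 7) (by omega) (by omega)) (hτ _) inside outside
  obtain ⟨A₈, e8, k8, f8⟩ := S.run_distances (A := A₇) (o := o) hes (q := 8) (by decide)
    (source (4 * ℓ - 6) (by omega) (by omega)) (hτ _)
    (by rwa [k7 6 (by decide)]) (by rwa [k7 6 (by decide)])
  obtain ⟨A₉, e9, k9, f9⟩ := S.run_distances (A := A₈) (o := o) hes (q := 9) (by decide)
    (source (4 * ℓ - 5) (by omega) (by omega)) (hτ _)
    (by rwa [k8 6 (by decide), k7 6 (by decide)]) (by rwa [k8 6 (by decide), k7 6 (by decide)])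
  have g7 : A₉ 7 = A₇ 7 := (k9 7 (by decide)).trans (k8 7 (by decide))
  have g8 : A₉ 8 = A₈ 8 := k9 8 (by decide)
  rw [← g7] at f7
  rw [← g8] at f8
  obtain ⟨A', e10, k10, f10⟩ := S.run_fill (A := A₉) (o := o) (q := 10)
    (e := .op .add
      (.le (.op .add (.arr 7 (.reg 6)) (.arr 8 (.reg 6))) (.arr 7 (.digit (4 * ℓ - 6))))
      (.le (.op .add (.arr 8 (.reg 6)) (.arr 9 (.reg 6))) (.arr 8 (.digit (4 * ℓ - 5)))))
    (g := fun v => (if A₉ 7 v + A₉ 8 v ≤ A₉ 7 (τ (4 * ℓ - 6)) then 1 else 0) +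
      (if A₉ 8 v + A₉ 9 v ≤ A₉ 8 (τ (4 * ℓ - 5)) then 1 else 0)) (fun B hB v => by
      simp only [Expr.eval_le, Expr.eval_digit, Expr.eval, Op.eval, hu le_rfl v 0 (by decide),
        hu le_rfl v 5 (by decide), S.vertices, ← hτ, Function.update_self, hB 7 (by decide),
        hB 8 (by decide), hB 9 (by decide)])
  obtain ⟨B, e11, k11, f11⟩ := S.run_neighbors (A := A') (o := o) hes (q := 11) (s := 10)
    (by decide)
  have hB : ∀ q, q < 6 → B q = A₅ q := fun q hq => by
    rw [k11 q (by rintro rfl; exact absurd hq (by decide)),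
      k10 q (by rintro rfl; exact absurd hq (by decide)),
      k9 q (by rintro rfl; exact absurd hq (by decide)),
      k8 q (by rintro rfl; exact absurd hq (by decide)),
      k7 q (by rintro rfl; exact absurd hq (by decide)),
      k6 q (by rintro rfl; exact absurd hq (by decide))]
  set D := Between ℓ τ (fun v => A₉ 7 v) (fun v => A₉ 8 v) (fun v => A₉ 9 v) with hD
  have near : ∀ v : Fin n, B 11 v = 0 ↔ ∀ z, D z → ¬ G.Adj v z := fun v => by
    rw [f11]
    refine forall_congr' fun z => ?_
    have h1 : A' 10 z = 0 ↔ ¬ D z := by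
      rw [f10, hD]
      unfold Between
      split_ifs with a b b <;> simp [a, b]
    rw [h1]
    tauto
  have e12 := S.run_output (A := B) (o := o)
    (e := .op .mul (.op .sub (.const 1) (.arr 0 (.reg 6)))
      (.pos (.op .add (.arr 4 (.reg 6)) (.op .mul (.arr 11 (.reg 6)) (.arr 5 (.reg 6))))))
    (g := fun v => if v ∈ Finset.univ.filter (Marked G ℓ τ D) then 1 else 0) (fun v => by
      simp only [Expr.eval_pos, Expr.eval, Op.eval, Function.update_self, hB 0 (by decide),
        hB 4 (by decide), hB 5 (by decide), Finset.mem_filter, Finset.mem_univ, true_and]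
      have hm : Marked G ℓ τ D v ↔ A₅ 0 v = 0 ∧ (A₅ 4 v ≠ 0 ∨ B 11 v ≠ 0 ∧ A₅ 5 v ≠ 0) := by
        rw [(ball v).2, Ne, hit, Ne, near, Ne, excl]
        unfold Marked
        push Not
        refine and_congr Iff.rfl (or_congr Iff.rfl (and_congr Iff.rfl ?_))
        tauto
      have := (ball v).1
      simp only [Nat.add_eq_zero_iff, mul_eq_zero]
      by_cases h : Marked G ℓ τ D v
      · rw [if_pos h]
        rw [hm] at h
        rw [if_neg (by tauto), h.1]
      · rw [if_neg h]
        rw [hm] at h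
        rcases (show A₅ 0 v = 1 ∨ A₅ 0 v = 0 by omega) with h0 | h0
        · rw [h0]; simp
        · rw [if_pos (by tauto)]; simp)
  refine ⟨B, Finset.univ.filter (Marked G ℓ τ D), ?_, _, _, _, f7, f8, f9, fun v =>
    Finset.mem_filter.trans (and_iff_right (Finset.mem_univ v))⟩
  rw [← e12, ← e11, ← e10, ← e9, ← e8, ← e7, ← e6, ← e5, ← e4, ← e3, ← e2, ← e1, ← e0]
  rfl

end Tuple

/-! ### All tuples: output, word size and running time -/

section Analysis

variable {n : ℕ} {es : List (Fin n × Fin n)} {I : ℕ → ℕ} {ρ : Fin 9 → ℕ}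
  {A : Fin 16 → ℕ → ℕ} {o : List ℕ} {G : SimpleGraph (Fin n)} {ℓ U : ℕ}

/-- Only the entries of a tuple with indices below `4ℓ - 2` matter. -/
theorem MarksMajors.congr {V : Type*} {G : SimpleGraph V} {C : Set V} {N : ℕ} {τ τ' : ℕ → V}
    (h6 : 6 ≤ ℓ) (hτ : ∀ j < 4 * ℓ - 2, τ j = τ' j) (h : MarksMajors G ℓ C N τ) :
    MarksMajors G ℓ C N τ' := by
  have hz : zone G ℓ τ = zone G ℓ τ' := by
    ext v
    refine or_congr (and_congr ?_ (and_congr ?_ ?_)) ?_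
    · exact forall₂_congr fun j hj => by rw [hτ j (by omega)]
    · exact forall₃_congr fun j _ hj => by rw [hτ j (by omega)]
    · rw [hτ _ (by omega), hτ _ (by omega)]
    · exact exists_congr fun j => and_congr_right fun _ => and_congr_right fun hj => by
        rw [hτ j (by omega)]
  have hm : ∀ D v, Marked G ℓ τ D v ↔ Marked G ℓ τ' D v := by
    intro D v
    refine and_congr ?_ (or_congr ?_ ?_)
    · exact forall₂_congr fun j hj => by rw [hτ j (by omega)]
    · exact exists_congr fun j => and_congr_right fun _ => and_congr_right fun hj => by
        rw [hτ j (by omega)]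
    · rw [hτ _ (by omega), hτ _ (by omega)]
  have hb : ∀ d₁ d₂ d₃, Between ℓ τ d₁ d₂ d₃ = Between ℓ τ' d₁ d₂ d₃ := by
    intro d₁ d₂ d₃
    unfold Between
    rw [hτ _ (by omega), hτ _ (by omega)]
  intro d₁ d₂ d₃ h1 h2 h3
  rw [← hz, ← hτ _ (by omega)] at h1 h2 h3
  have := h d₁ d₂ d₃ h1 h2 h3
  simpa only [hm, hb] using this

/-- Every tuple is encoded by the digits of a number. -/
theorem exists_digits (T : ℕ) (τ : ℕ → Fin n) : ∃ i < n ^ T, ∀ j < T, i / n ^ j % n = τ j := by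
  refine ⟨finFunctionFinEquiv fun j : Fin T => τ j, Fin.isLt _, fun j hj => ?_⟩
  rw [← finFunctionFinEquiv_symm_apply_val _ (⟨j, hj⟩ : Fin T), Equiv.symm_apply_apply]

/-- Some set in the output is as good as the tuple `τ`. -/
theorem Setting.run_markAll (S : Setting es I ρ) (hes : IsEdgeOrder G es) (h6 : 6 ≤ ℓ)
    (h3 : ρ 3 = n ^ (4 * ℓ - 2)) :
    ∃ L : List (Finset (Fin n)), L.length = n ^ (4 * ℓ - 2) ∧
      ((Cmd.markAll ℓ).run I ρ (A, o)).2 = o ++ encodeSets L ∧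
      ∀ C τ, MarksMajors G ℓ C n τ → ∃ X ∈ L, (∀ x, IsMajor G C x → x ∈ X) ∧ ∀ x ∈ X, x ∉ C := by
  have key := iter_induction
    (f := fun j => Cmd.run I (Cmd.mark ℓ) (Function.update ρ 5 j)) (x := (A, o))
    (n := n ^ (4 * ℓ - 2))
    (fun j y => ∃ L : List (Finset (Fin n)), L.length = j ∧ y.2 = o ++ encodeSets L ∧
      ∀ i < j, ∃ X ∈ L, ∀ (C : Set (Fin n)) (τ : ℕ → Fin n), (∀ j, (τ j : ℕ) = i / n ^ j % n) →
        MarksMajors G ℓ C n τ → (∀ x, IsMajor G C x → x ∈ X) ∧ ∀ x ∈ X, x ∉ C)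
    ⟨[], rfl, by simp [encodeSets], by simp⟩ (by
    rintro i hi ⟨B, o'⟩ ⟨L, h1, h2, h4⟩
    have hn : 0 < n := Nat.pos_of_ne_zero fun e => by
      subst e
      rw [zero_pow (by omega)] at hi
      omega
    simp only at h2
    subst h2
    obtain ⟨B', X, e1, d₁, d₂, d₃, k1, k2, k3, k4⟩ := (S.update (le_refl 5) i).run_mark (A := B)
      (o := o ++ encodeSets L) (τ := fun j => ⟨i / n ^ j % n, Nat.mod_lt _ hn⟩) hes h6
      (fun j => by rw [Function.update_self])
    refine ⟨L ++ [X], by simp [h1], ?_, fun i' hi' => ?_⟩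
    · simp only [e1]
      simp [encodeSets]
    · rcases Nat.lt_or_ge i' i with hlt | hge
      · obtain ⟨Y, hY, hY'⟩ := h4 i' hlt
        exact ⟨Y, List.mem_append_left _ hY, hY'⟩
      · obtain rfl : i' = i := by omega
        refine ⟨X, by simp, fun C τ hτ hC => ?_⟩
        obtain rfl : τ = fun j => ⟨i' / n ^ j % n, Nat.mod_lt _ hn⟩ :=
          funext fun j => Fin.ext (hτ j)
        have h := hC d₁ d₂ d₃ k1 k2 k3
        exact ⟨fun x hx => (k4 x).2 (h.1 x hx), fun x hx hxC => h.2 x hxC ((k4 x).1 hx)⟩)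
  have hrun : (Cmd.markAll ℓ).run I ρ (A, o) = iter (fun j => Cmd.run I (Cmd.mark ℓ)
      (Function.update ρ 5 j)) (n ^ (4 * ℓ - 2)) (A, o) := by
    rw [← h3]; rfl
  rw [hrun]
  obtain ⟨L, h1, h2, h4⟩ := key
  refine ⟨L, h1, h2, fun C τ hC => ?_⟩
  obtain ⟨i, hi, hd⟩ := exists_digits (4 * ℓ - 2) τ
  have hn : 0 < n := (τ 0).pos
  obtain ⟨X, hX, h⟩ := h4 i hi
  exact ⟨X, hX, h C (fun j => ⟨i / n ^ j % n, Nat.mod_lt _ hn⟩) (fun _ => rfl)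
    (hC.congr h6 fun j hj => Fin.ext (hd j hj).symm)⟩

namespace Cmd

theorem ok_fill {q : Fin 16} {e : Expr} (h6 : ρ 6 = 0)
    (h : ∀ A : Fin 16 → ℕ → ℕ, (∀ q v, A q v ≤ U) → ∀ j, e.eval I A (Function.update ρ 6 j) ≤ U) :
    Ok I U ρ (fill q e) :=
  ⟨by decide, by decide, h6, fun j _ A hA => h A hA j⟩

theorem ok_sweep {q : Fin 16} {f : Expr → Expr → Expr} (h8 : ρ 8 = 0)
    (h : ∀ (A : Fin 16 → ℕ → ℕ) (ρ : Fin 9 → ℕ), (∀ q v, A q v ≤ U) → ∀ x y,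
      (f x y).eval I A ρ ≤ U) : Ok I U ρ (sweep q f) :=
  ⟨by decide, by decide, h8, fun _ _ => ⟨fun A hA => h A _ hA _ _, fun A hA => h A _ hA _ _⟩⟩

theorem ok_role (h6 : ρ 6 = 0) (hU : 2 ≤ U) (q : Fin 16) (a b : ℕ) : Ok I U ρ (role q a b) :=
  ok_fill h6 fun A _ j => by
    rw [Expr.eval_pos]
    split_ifs <;> omega

theorem ok_neighbors (h6 : ρ 6 = 0) (h8 : ρ 8 = 0) (hU : 2 ≤ U) (q s : Fin 16) :
    Ok I U ρ (neighbors q s) :=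
  ⟨ok_fill h6 fun _ _ _ => Nat.zero_le _, ok_sweep h8 fun A ρ _ x y => by
    rw [Expr.eval_pos]
    split_ifs <;> omega⟩

theorem ok_distances (h6 : ρ 6 = 0) (h7 : ρ 7 = 0) (h8 : ρ 8 = 0) (hU : ρ 0 ≤ U) (q : Fin 16)
    (j : ℕ) : Ok I U ρ (distances q j) :=
  ⟨ok_fill h6 fun A _ j => by
    simp only [Expr.eval, Op.eval]
    exact (Nat.mul_le_mul_left _ (Nat.sub_le _ _)).trans (by simpa using hU),
   by decide, by decide, h7, fun i _ => ok_sweep (by simpa using h8) fun A ρ hA x y => by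
    rw [Expr.eval_min]
    exact (min_le_left _ _).trans (hA _ _)⟩

theorem ok_mark (h6 : ρ 6 = 0) (h7 : ρ 7 = 0) (h8 : ρ 8 = 0) (hU : 2 ≤ U) (h0 : ρ 0 < U) :
    Ok I U ρ (mark ℓ) :=
  ⟨ok_role h6 hU _ _ _, ok_role h6 hU _ _ _, ok_role h6 hU _ _ _, ok_role h6 hU _ _ _,
    ok_neighbors h6 h8 hU _ _, ok_neighbors h6 h8 hU _ _,
    ok_fill h6 fun A _ j => by
      simp only [Expr.eval, Op.eval]
      refine (Nat.add_le_add_left (Nat.mul_le_mul_left _ (Nat.sub_le _ _)) 1).trans ?_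
      rw [Function.update_of_ne (by decide)]
      omega,
    ok_distances h6 h7 h8 h0.le _ _, ok_distances h6 h7 h8 h0.le _ _,
    ok_distances h6 h7 h8 h0.le _ _,
    ok_fill h6 fun A _ j => by
      show Expr.eval _ _ _ (Expr.le _ _) + Expr.eval _ _ _ (Expr.le _ _) ≤ U
      rw [Expr.eval_le, Expr.eval_le]
      split_ifs <;> omega,
    ok_neighbors h6 h8 hU _ _, by decide, by decide, h6, fun _ _ => trivial⟩

/-- The program stores only numbers up to the number of vertices plus one, and up to two. -/
theorem ok_markAll (h : ∀ r, 5 ≤ r → ρ r = 0) (hU : 2 ≤ U) (h0 : ρ 0 < U) :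
    Ok I U ρ (markAll ℓ) :=
  ⟨by decide, by decide, h 5 le_rfl, fun j _ => ok_mark (by simpa using h 6 (by decide))
    (by simpa using h 7 (by decide)) (by simpa using h 8 (by decide)) hU (by simpa using h0)⟩

/-- The degree of a polynomial that bounds the running time of a command, where `w r` is the degree
of a polynomial that bounds the content of register `r`. -/
def timeDeg (w : Fin 9 → ℕ) : Cmd → ℕ
  | store _ _ _ => 0
  | write _ => 0
  | seq c c' => max (timeDeg w c) (timeDeg w c')
  | loop _ a c => w a + timeDeg w c

theorem exists_time_le (w : Fin 9 → ℕ) (k : ℕ) (c : Cmd) : ∃ K, ∀ (N : ℕ) (ρ : Fin 9 → ℕ), 1 ≤ N →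
    (∀ r, ρ r ≤ k * N ^ w r) → c.time ρ ≤ K * N ^ c.timeDeg w := by
  induction c with
  | store q i e => exact ⟨_, fun N ρ _ _ => by rw [timeDeg, pow_zero, mul_one, time]⟩
  | write e => exact ⟨_, fun N ρ _ _ => by rw [timeDeg, pow_zero, mul_one, time]⟩
  | seq c c' ih ih' =>
    obtain ⟨K, hK⟩ := ih
    obtain ⟨K', hK'⟩ := ih'
    refine ⟨K + K', fun N ρ hN hρ => ?_⟩
    simp only [time, timeDeg]
    rw [add_mul]
    exact Nat.add_le_add
      ((hK N ρ hN hρ).trans (Nat.mul_le_mul_left _ (Nat.pow_le_pow_right hN (le_max_left _ _))))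
      ((hK' N ρ hN hρ).trans (Nat.mul_le_mul_left _ (Nat.pow_le_pow_right hN (le_max_right _ _))))
  | loop i a c ih =>
    obtain ⟨K, hK⟩ := ih
    refine ⟨k * (K + 2) + 2, fun N ρ hN hρ => ?_⟩
    simp only [time, timeDeg]
    have h1 : 1 ≤ N ^ timeDeg w c := Nat.one_le_pow _ _ hN
    have h2 : 1 ≤ N ^ (w a + timeDeg w c) := Nat.one_le_pow _ _ hN
    calc ρ a * (c.time ρ + 2) + 2
        ≤ k * N ^ w a * (K * N ^ timeDeg w c + 2 * N ^ timeDeg w c) +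
          2 * N ^ (w a + timeDeg w c) := by
          refine Nat.add_le_add (Nat.mul_le_mul (hρ a) (Nat.add_le_add (hK N ρ hN hρ) ?_)) ?_ <;>
            omega
      _ = (k * (K + 2) + 2) * N ^ (w a + timeDeg w c) := by
          rw [pow_add]; ring

end Cmd

/-- Set register `3` to the `j`-th power of register `0`. -/
def powerProg : ℕ → Prog
  | 0 => .copy 3 4
  | j + 1 => .seq (powerProg j) (.arith .mul 3 3 0)

/-- The preparation of the registers from the input. -/
def setupProg (T : ℕ) : Prog :=
  .seq (.load 0 0) <| .seq (.const 4 1) <| .seq (.load 1 4) <| .seq (.arith .add 2 1 1) <|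
  .seq (.arith .add 2 2 4) <| .seq (.arith .add 2 2 4) <| powerProg T

theorem exec_powerProg {W : ℕ} {s : State} (h0 : s.reg 0 = n) (h4 : s.reg 4 = 1) {T : ℕ}
    (hW : (n + 1) ^ T < W) (j : ℕ) (hj : j ≤ T) :
    Exec W (powerProg j) s (j + 1) { s with reg := Function.update s.reg 3 (n ^ j) } := by
  induction j with
  | zero =>
    have := Exec.copy (W := W) s 3 4
    rwa [h4] at this
  | succ j ih =>
    have h := Exec.arith (W := W) { s with reg := Function.update s.reg 3 (n ^ j) } .mul 3 3 0 (by
      have : n ^ (j + 1) ≤ (n + 1) ^ T :=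
        (Nat.pow_le_pow_left (by omega) _).trans (Nat.pow_le_pow_right (by omega) hj)
      simp [Op.eval, h0, ← pow_succ]
      omega)
    have := Exec.seq (ih (by omega)) h
    simpa [powerProg, Op.eval, h0, ← pow_succ] using this

theorem getD_flatMap_pair {α : Type*} (f g : α → ℕ) (l : List α) (e : ℕ) (he : e < l.length) :
    (l.flatMap fun x => [f x, g x]).getD (2 * e) 0 = f l[e] ∧
      (l.flatMap fun x => [f x, g x]).getD (2 * e + 1) 0 = g l[e] := by
  induction l generalizing e with
  | nil => simp at he
  | cons x l ih =>
    rcases e with _ | e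
    · simp
    · have := ih e (by simpa using he)
      simpa [mul_add] using this

theorem length_encodeInput (n : ℕ) (es : List (Fin n × Fin n)) :
    (encodeInput n es).length = 2 + 2 * es.length := by
  simp [encodeInput]
  omega

/-- The contents of the registers after the preparation. -/
def registers (n m T : ℕ) : Fin 9 → ℕ := ![n, m, 2 + 2 * m, n ^ T, 1, 0, 0, 0, 0]

theorem setting_registers (es : List (Fin n × Fin n)) (T : ℕ) :
    Setting es (initState (encodeInput n es)).mem (registers n es.length T) := by
  refine ⟨rfl, rfl, rfl, fun e he => ?_, fun e he => ?_⟩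
  · have := (getD_flatMap_pair (fun e : Fin n × Fin n => (e.1 : ℕ)) (fun e => (e.2 : ℕ)) es e he).1
    rw [add_comm]
    simpa [initState, encodeInput] using this
  · have := (getD_flatMap_pair (fun e : Fin n × Fin n => (e.1 : ℕ)) (fun e => (e.2 : ℕ)) es e he).2
    rw [show 3 + 2 * e = 2 * e + 1 + 2 by ring]
    simpa [initState, encodeInput] using this

theorem exec_setupProg {W : ℕ} (es : List (Fin n × Fin n)) {T : ℕ} (hW : (n + 1) ^ T < W)
    (hW' : 2 + 2 * es.length < W) :
    ∃ s, Exec W (setupProg T) (initState (encodeInput n es)) (T + 7) s ∧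
      Holds (initState (encodeInput n es)).mem (registers n es.length T) (fun _ _ => 0) s ∧
      s.out = [] := by
  have h0 : (initState (encodeInput n es)).mem 0 = n := rfl
  have h1 : (initState (encodeInput n es)).mem 1 = es.length := rfl
  have h2 : (initState (encodeInput n es)).reg = fun _ => 0 := rfl
  rw [show T + 7 = 1 + (1 + (1 + (1 + (1 + (1 + (T + 1)))))) by omega]
  refine ⟨_, .seq (.load _ _ _) (.seq (.const _ _ _ ?_) (.seq (.load _ _ _)
    (.seq (.arith _ _ _ _ _ ?_) (.seq (.arith _ _ _ _ _ ?_) (.seq (.arith _ _ _ _ _ ?_)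
      (exec_powerProg (n := n) ?_ ?_ hW T le_rfl)))))), ⟨?_, ?_⟩, rfl⟩
  · omega
  · simp [Op.eval, h0, h1, h2]; omega
  · simp [Op.eval, h0, h1, h2]; omega
  · simp [Op.eval, h0, h1, h2]; omega
  · simp [Op.eval, h0, h1, h2]
  · simp [Op.eval, h0, h1, h2]
  · intro r
    fin_cases r <;> simp [registers, Op.eval, h0, h1, h2]
    omega
  · funext a
    show (initState (encodeInput n es)).mem a = layout (2 + 2 * es.length) _ _ a
    unfold layout
    split_ifs with ha
    · rfl
    · exact List.getD_eq_default _ _ (by rw [length_encodeInput]; omega)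

end Analysis

section Bounds

variable {n : ℕ} {es : List (Fin n × Fin n)} {G : SimpleGraph (Fin n)} {ℓ : ℕ}

theorem IsEdgeOrder.length_le (h : IsEdgeOrder G es) : es.length ≤ n * n := by
  have := (List.Nodup.of_map _ h.1).length_le_card
  simpa using this

theorem IsEdgeOrder.memory_le (h : IsEdgeOrder G es) : 2 + 2 * es.length ≤ 4 * (n + 1) ^ 2 := by
  have := h.length_le
  nlinarith

theorem IsEdgeOrder.encodeInput_le (h : IsEdgeOrder G es) (a : ℕ) :
    (initState (encodeInput n es)).mem a ≤ 4 * (n + 1) ^ 2 := by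
  have h2 := h.memory_le
  have hn : n ≤ 4 * (n + 1) ^ 2 := by nlinarith
  show (encodeInput n es).getD a 0 ≤ _
  rw [List.getD_eq_getElem?_getD]
  rcases lt_or_ge a (encodeInput n es).length with ha | ha
  · rw [List.getElem?_eq_getElem ha, Option.getD_some]
    have := List.getElem_mem ha
    generalize (encodeInput n es)[a] = x at this ⊢
    simp only [encodeInput, List.mem_cons, List.mem_flatMap, List.not_mem_nil, or_false] at this
    rcases this with rfl | rfl | ⟨e, -, rfl | rfl⟩
    · exact hn
    · omega
    · exact e.1.2.le.trans hn
    · exact e.2.2.le.trans hn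
  · rw [List.getElem?_eq_none ha]
    exact Nat.zero_le _

/-- The degrees of the polynomials that bound the registers. -/
theorem registers_le {m T N : ℕ} (hm : 2 + 2 * m ≤ 4 * N ^ 2) (hn : n ≤ N) (h1 : 1 ≤ N)
    (r : Fin 9) : registers n m T r ≤ 4 * N ^ (![1, 2, 2, T, 0, 0, 0, 0, 0] : Fin 9 → ℕ) r := by
  have hp : n ^ T ≤ N ^ T := Nat.pow_le_pow_left hn T
  fin_cases r <;> simp [registers] <;> omega

/-- For each tuple, the time is dominated by the rounds of the algorithm of Bellman and Ford, each
of which looks at all edges. -/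
theorem timeDeg_markAll (T : ℕ) :
    (Cmd.markAll ℓ).timeDeg ![1, 2, 2, T, 0, 0, 0, 0, 0] = T + 3 := by
  simp [Cmd.markAll, Cmd.mark, Cmd.role, Cmd.neighbors, Cmd.gather, Cmd.sweep, Cmd.fill, Cmd.costs,
    Cmd.distances, Cmd.relax, Cmd.between, Cmd.output, Cmd.timeDeg]

end Bounds

end LongEvenHole


open LongEvenHole
theorem mainTheorem6 (ℓ : ℕ) (hℓ : 6 ≤ ℓ) (heven : Even ℓ) :
    ∃ (p : Prog) (c r : ℕ), ∀ (n : ℕ) (G : SimpleGraph (Fin n)) (es : List (Fin n × Fin n)),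
      IsCandidate G ℓ → IsEdgeOrder G es →
      ∃ (t : ℕ) (s : State) (L : List (Finset (Fin n))),
        Exec (c * (n + 1) ^ r) p (initState (encodeInput n es)) t s ∧
        t ≤ c * (n + 1) ^ (4 * ℓ + 2) ∧
        s.out = encodeSets L ∧
        L.length ≤ c * (n + 1) ^ (4 * ℓ - 1) ∧
        ∀ C : Set (Fin n), IsLightestLongEvenHole G ℓ es C →
          ∃ X ∈ L, (∀ x, IsMajor G C x → x ∈ X) ∧ ∀ x ∈ X, x ∉ C := by
  obtain ⟨T, hT⟩ : ∃ T, T = 4 * ℓ - 2 := ⟨_, rfl⟩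
  obtain ⟨K, hK⟩ := (Cmd.markAll ℓ).exists_time_le ![1, 2, 2, T, 0, 0, 0, 0, 0] 4
  rw [timeDeg_markAll] at hK
  obtain ⟨D, hD⟩ : ∃ D, D = (Cmd.markAll ℓ).deg := ⟨_, rfl⟩
  refine ⟨.seq (setupProg T) (Cmd.markAll ℓ).compile, 4 ^ (D + 1) + (T + 7) + K, T * (D + 1),
    fun n G es hG hes => ?_⟩
  -- the bound on all registers and on the memory
  obtain ⟨U, hU⟩ : ∃ U, U = 4 * (n + 1) ^ T := ⟨_, rfl⟩
  have hpow : ∀ {i j}, i ≤ j → (n + 1) ^ i ≤ (n + 1) ^ j := fun h =>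
    Nat.pow_le_pow_right (by omega) h
  have h1 : n + 1 ≤ (n + 1) ^ T := Nat.le_self_pow (by omega) _
  have h2 : 4 * (n + 1) ^ 2 ≤ U := hU ▸ Nat.mul_le_mul_left 4 (hpow (by omega))
  have h3 : 2 + 2 * es.length ≤ U := (hes.memory_le).trans h2
  obtain ⟨W, hW⟩ : ∃ W, W = (4 ^ (D + 1) + (T + 7) + K) * (n + 1) ^ (T * (D + 1)) := ⟨_, rfl⟩
  have hpos : 0 < (n + 1) ^ (T * (D + 1)) := by positivity
  have hUW : U ^ (D + 1) < W := by
    rw [hU, mul_pow, ← pow_mul, hW]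
    exact Nat.mul_lt_mul_of_pos_right (by omega) hpos
  have hU1 : U ≤ U ^ (D + 1) := Nat.le_self_pow (by omega) _
  have hUD : U ^ D ≤ U ^ (D + 1) := Nat.pow_le_pow_right (by omega) (by omega)
  obtain ⟨s₀, e0, g0, o0⟩ := exec_setupProg (W := W) (T := T) es (by omega) (by omega)
  have hr : ∀ r, registers n es.length T r ≤ U := fun r => by
    have hp : n ^ T ≤ (n + 1) ^ T := Nat.pow_le_pow_left (by omega) T
    fin_cases r <;> simp [registers] <;> omega
  have hok : Cmd.Ok (initState (encodeInput n es)).mem U (registers n es.length T)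
      (Cmd.markAll ℓ) := by
    refine Cmd.ok_markAll (fun r hr => ?_) (by omega) (show n < U by omega)
    fin_cases r <;> first | rfl | exact absurd hr (by decide)
  obtain ⟨-, t, s, e1, ht, -, o1⟩ := Cmd.exec (X := U) (by omega) le_rfl
    (fun a => (hes.encodeInput_le a).trans h2) (Cmd.markAll ℓ) (hD ▸ hUD.trans_lt hUW) hok hr rfl
    (fun _ _ => Nat.zero_le _) s₀ g0
  obtain ⟨L, l1, l2, l3⟩ := (setting_registers es T).run_markAll (A := fun _ _ => 0) (o := s₀.out)
    hes hℓ (hT ▸ rfl)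
  refine ⟨T + 7 + t, s, L, hW ▸ .seq e0 e1, ?_, ?_, ?_, fun C hC => ?_⟩
  · have h4 : t ≤ K * (n + 1) ^ (4 * ℓ + 2) := (ht.trans (hK (n + 1) _ (by omega)
      (registers_le (hes.memory_le) (by omega) (by omega)))).trans
      (Nat.mul_le_mul_left _ (hpow (by omega)))
    have h5 : 0 < (n + 1) ^ (4 * ℓ + 2) := by positivity
    have h6 : (T + 7) * 1 ≤ (T + 7) * (n + 1) ^ (4 * ℓ + 2) := Nat.mul_le_mul_left _ h5
    rw [add_mul, add_mul]
    omega
  · rw [o1, l2, o0, List.nil_append]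
  · have h4 : n ^ (4 * ℓ - 2) ≤ (n + 1) ^ (4 * ℓ - 1) :=
      (Nat.pow_le_pow_left (by omega) _).trans (hpow (by omega))
    rw [l1]
    exact h4.trans (Nat.le_mul_of_pos_left _ (by positivity))
  · obtain ⟨τ, hτ⟩ := hG.exists_marksMajors hℓ heven hC
    exact l3 C τ hτ
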